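/- **Setting.** Let $\mathcal K$ be a finite-dimensional complex Hilbert space, $\mathcal H_{\rm R}$ a complex Hilbert space, $K$ a self-adjoint operator on $\mathcal K$, $H_{\rm R}$ a (possibly unbounded) self-adjoint operator on $\mathcal H_{\rm R}$ and $V\in\mathcal B(\mathcal K,\mathcal K\otimes\mathcal H_{\rm R})$. Let $\Gamma_{\rm s}(\mathcal H_{\rm R})$ be the bosonic Fock space with vacuum $\Omega$, let $\mathcal H=\mathcal K\otimes\Gamma_{\rm s}(\mathcal H_{\rm R})$, and let $I_{\mathcal K}:\mathcal K\to\mathcal H$, $I_{\mathcal K}k=k\otimes\Omega$. On $n$-particle vectors with values in $\mathcal K$ let $a(V)\psi=\sqrt n\,(V^*\otimes 1)\psi$, and let $a^*(V)$ be its adjoint. Let $H_0=K+\mathrm d\Gamma(H_{\rm R})$ and, for $\lambda>0$, let $H_\lambda$ be the self-adjoint operator which equals $H_0+\lambda(a(V)+a^*(V))$ on the algebraic tensor product of $\mathcal K$ with the finite-particle vectors over $\mathrm{Dom}(H_{\rm R})$ (it is essentially self-adjoint there). Put $$T_\lambda(t,t_0)=e^{itH_0}e^{-i(t-t_0)H_\lambda}e^{-it_0H_0}.$$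 For $k\in\mathrm{sp}\,K$ let $1_{\mathcal K_k}$ be the corresponding spectral projection of $K$, and let $\mathcal F=\{k-k' : k,k'\in\mathrm{sp}\,K\}$. Operators $S\in\mathcal B(\mathcal K)$ are identified with $S\otimes 1$ where they act on $\mathcal H$ or on $\mathcal K\otimes\mathcal H_{\rm R}$; on the latter space $e^{-itH_0}$ means $e^{-it(K+H_{\rm R})}$. **Assumptions.** 1. For every $\omega\in\mathcal F$ there are a Hilbert space $\mathfrak h_\omega$, an open set $I_\omega\subset\mathbb R$ with $\omega\in I_\omega$, and a unitary identification $\mathrm{Ran}\,1_{I_\omega}(H_{\rm R})\simeq L^2(I_\omega)\otimes\mathfrak h_\omega= L^2(I_\omega;\mathfrak h_\omega)$ under which $H_{\rm R}$ is multiplication by the variable $x\in I_\omega$. The sets $I_\omega$ are pairwise disjoint. 2. For every $\omega\in\mathcal F$ there is a measurable function $v:I_\omega\to\mathcal B(\mathcal K,\mathcal K\otimes\mathfrak h_\omega)$, continuous at $\omega$, such that for every $k\in\mathcal K$, under the identification above, $(Vk)(x)=v(x)k$ for almost all $x\in I_\omega$. 4. For all $S\in\mathcal B(\mathcal K)$,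 $\displaystyle\int_0^\infty\|V^*\,(S\otimes 1)\,e^{-itH_0}V\|\,dt<\infty$. **Theorem.** Suppose that Assumptions 1, 2 and 4 hold, and let $$\Upsilon=-i\sum_{k\in\mathrm{sp}\,K}\int_0^\infty 1_{\mathcal K_k}V^*e^{-it(K+H_{\rm R}-k)}V\,1_{\mathcal K_k}\,dt .$$ Let $T<\infty$, $\ell\in\mathbb N=\{0,1,2,\dots\}$ and $S_1,\dots,S_\ell\in\mathcal B(\mathcal K)$. Then $$\lim_{\lambda\downarrow0} I_{\mathcal K}^*\,T_\lambda(\lambda^{-2}t,\lambda^{-2}t_\ell)\,S_\ell\cdots S_2\,T_\lambda(\lambda^{-2}t_2,\lambda^{-2}t_1)\,S_1\,T_\lambda(\lambda^{-2}t_1,\lambda^{-2}t_0)\,I_{\mathcal K} = e^{-i(t-t_\ell)\Upsilon}S_\ell\cdots S_2\,e^{-i(t_2-t_1)\Upsilon}S_1\,e^{-i(t_1-t_0)\Upsilon}$$ in the norm of $\mathcal B(\mathcal K)$, uniformly for all ordered times $T\ge t\ge t_\ell\ge\dots\ge t_1\ge t_0\ge -T$ (for $\ell=0$ the two sides are $I_{\mathcal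 K}^*T_\lambda(\lambda^{-2}t,\lambda^{-2}t_0)I_{\mathcal K}$ and $e^{-i(t-t_0)\Upsilon}$). -/

import Mathlib

open Filter Topology MeasureTheory
open scoped TensorProduct InnerProductSpace ENNReal

universe u v w

/-! ### Unitary groups generated by (essentially) self-adjoint operators -/

section UnitaryGroups

variable {E : Type u} [NormedAddCommGroup E] [InnerProductSpace ℂ E]

/-- `U` is a strongly continuous one-parameter unitary group with
`d/dt U(t) x = - i y` at `t = 0` for every pair `(x, y)` in the graph `G` of an operator.
(The group law makes the isometries `U t` invertible, hence unitary.) -/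
structure IsUnitaryGroupGeneratedBy (G : Submodule ℂ (E × E)) (U : ℝ → E →L[ℂ] E) : Prop where
  zero : U 0 = 1
  add : ∀ s t : ℝ, U (s + t) = U s * U t
  norm_map : ∀ (t : ℝ) (x : E), ‖U t x‖ = ‖x‖
  continuous : ∀ x : E, Continuous fun t : ℝ => U t x
  hasDerivAt : ∀ p ∈ G, HasDerivAt (fun t : ℝ => U t p.1) (-(Complex.I • p.2)) 0

open Classical in
/-- `unitaryGroup G t` is `e^{-itA}`, where `A` is the closure of the operator with graph `G`.
There is exactly one strongly continuous unitary group as above precisely when the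
densely defined symmetric operator with graph `G` is essentially self-adjoint
(in particular when it is self-adjoint); otherwise the value is `0`. -/
noncomputable def unitaryGroup (G : Submodule ℂ (E × E)) (t : ℝ) : E →L[ℂ] E :=
  if h : ∃! U : ℝ → E →L[ℂ] E, IsUnitaryGroupGeneratedBy G U then h.choose t else 0

/-- The range of the spectral projection `1_B(A)` of the self-adjoint operator `A`: the vectors
`x` whose spectral measure `μ`, i.e. the finite Borel measure with
`⟨x, e^{-itA} x⟩ = ∫ e^{-its} dμ(s)` for all `t`, is carried by `B`. -/
def spectralRange (A : E →ₗ.[ℂ] E) (B : Set ℝ) : Set E :=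
  {x | ∃ μ : Measure ℝ, IsFiniteMeasure μ ∧
    (∀ t : ℝ, ⟪x, unitaryGroup A.graph t x⟫_ℂ = ∫ s : ℝ, Complex.exp (-(Complex.I * t * s)) ∂μ) ∧
    μ Bᶜ = 0}

end UnitaryGroups

/-! ### Tensoring with a finite-dimensional Hilbert space -/

section Tensor

variable {𝓚 : Type v} [NormedAddCommGroup 𝓚] [InnerProductSpace ℂ 𝓚]
variable {X : Type u} [NormedAddCommGroup X] [InnerProductSpace ℂ X]

/-- The contraction `⟨u| ⊗ 1 : 𝓚 ⊗ X → X`. -/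
noncomputable def partialInner (X : Type u) [NormedAddCommGroup X] [InnerProductSpace ℂ X]
    (u : 𝓚) : 𝓚 ⊗[ℂ] X →L[ℂ] X :=
  (TensorProduct.lidIsometry ℂ X).toContinuousLinearEquiv.toContinuousLinearMap ∘L
    (innerSL ℂ u).rTensor X

lemma partialInner_tmul (u k : 𝓚) (x : X) : partialInner X u (k ⊗ₜ x) = ⟪u, k⟫_ℂ • x := by
  simp [partialInner]

/-- If `𝓚` is finite-dimensional, the algebraic tensor product `𝓚 ⊗ X` with a Hilbert space is
already complete, so it is the tensor product of Hilbert spaces. -/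
instance instCompleteSpaceTensor [FiniteDimensional ℂ 𝓚] [CompleteSpace X] :
    CompleteSpace (𝓚 ⊗[ℂ] X) := by
  let b := stdOrthonormalBasis ℂ 𝓚
  let S : (Fin (Module.finrank ℂ 𝓚) → X) →L[ℂ] 𝓚 ⊗[ℂ] X :=
    ∑ i, (TensorProduct.mkL ℂ 𝓚 X (b i)) ∘L ContinuousLinearMap.proj i
  let T : 𝓚 ⊗[ℂ] X →L[ℂ] (Fin (Module.finrank ℂ 𝓚) → X) :=
    ContinuousLinearMap.pi fun i => partialInner X (b i)
  have hST : ∀ z, S (T z) = z := by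
    intro z
    induction z with
    | zero => simp
    | add x y hx hy => rw [map_add, map_add, hx, hy]
    | tmul k x =>
      simp only [S, T, FunLike.coe_sum, Finset.sum_apply,
        ContinuousLinearMap.comp_apply, ContinuousLinearMap.proj_apply,
        ContinuousLinearMap.coe_pi', partialInner_tmul, TensorProduct.mkL_apply_apply]
      simp only [TensorProduct.tmul_smul]
      simp only [TensorProduct.smul_tmul']
      rw [← TensorProduct.sum_tmul, b.sum_repr' k]
  have hTS : ∀ f, T (S f) = f := by
    intro f
    ext j
    simp [S, T, partialInner_tmul, b.inner_eq_ite]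
  let e : (𝓚 ⊗[ℂ] X) ≃L[ℂ] (Fin (Module.finrank ℂ 𝓚) → X) :=
    ContinuousLinearEquiv.equivOfInverse T S hST hTS
  exact (completeSpace_congr (e := e.toEquiv) e.isUniformEmbedding).2 inferInstance

end Tensor

/-! ### Bosonic Fock space -/

/-- A bundled complex inner product space, used to define tensor powers by recursion. -/
structure BundledInner where
  carrier : Type u
  [grp : NormedAddCommGroup carrier]
  [inn : InnerProductSpace ℂ carrier]

attribute [instance] BundledInner.grp BundledInner.inn

section Fock

/-- The algebraic tensor powers `⊗⁰ R = ℂ`, `⊗ⁿ⁺¹ R = R ⊗ (⊗ⁿ R)` with their inner product. -/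
noncomputable def algTensorPower (R : Type u) [NormedAddCommGroup R] [InnerProductSpace ℂ R] :
    ℕ → BundledInner.{u}
  | 0 => ⟨EuclideanSpace ℂ PUnit.{u + 1}⟩
  | n + 1 => ⟨R ⊗[ℂ] (algTensorPower R n).carrier⟩

/-- The Hilbert space `⊗ⁿ R`. -/
abbrev HilbertTensorPower (R : Type u) [NormedAddCommGroup R] [InnerProductSpace ℂ R] (n : ℕ) :
    Type u :=
  UniformSpace.Completion (algTensorPower R n).carrier

variable {R : Type u} [NormedAddCommGroup R] [InnerProductSpace ℂ R]

/-- The elementary tensor `f₀ ⊗ (f₁ ⊗ (⋯ ⊗ fₙ₋₁))`. -/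
noncomputable def elemTensor : (n : ℕ) → (Fin n → R) → (algTensorPower R n).carrier
  | 0, _ => (EuclideanSpace.single PUnit.unit (1 : ℂ) : EuclideanSpace ℂ PUnit.{u + 1})
  | n + 1, f => ((f 0) ⊗ₜ[ℂ] (elemTensor n (Fin.tail f)) : R ⊗[ℂ] (algTensorPower R n).carrier)

lemma elemTensor_update_add : ∀ (n : ℕ) (f : Fin n → R) (i : Fin n) (x y : R),
    elemTensor n (Function.update f i (x + y)) =
      elemTensor n (Function.update f i x) + elemTensor n (Function.update f i y)
  | 0, _, i, _, _ => i.elim0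
  | n + 1, f, i, x, y => by
    induction i using Fin.cases with
    | zero =>
      simp only [elemTensor, Function.update_self, Fin.tail_update_zero]
      exact TensorProduct.add_tmul _ _ _
    | succ i =>
      simp only [elemTensor, Fin.tail_update_succ, elemTensor_update_add n]
      rw [Function.update_of_ne (Fin.succ_ne_zero i).symm,
        Function.update_of_ne (Fin.succ_ne_zero i).symm,
        Function.update_of_ne (Fin.succ_ne_zero i).symm]
      exact TensorProduct.tmul_add _ _ _

lemma elemTensor_update_smul : ∀ (n : ℕ) (f : Fin n → R) (i : Fin n) (c : ℂ) (x : R),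
    elemTensor n (Function.update f i (c • x)) = c • elemTensor n (Function.update f i x)
  | 0, _, i, _, _ => i.elim0
  | n + 1, f, i, c, x => by
    induction i using Fin.cases with
    | zero =>
      simp only [elemTensor, Function.update_self, Fin.tail_update_zero]
      exact (TensorProduct.smul_tmul' _ _ _).symm
    | succ i =>
      simp only [elemTensor, Fin.tail_update_succ, elemTensor_update_smul n]
      rw [Function.update_of_ne (Fin.succ_ne_zero i).symm,
        Function.update_of_ne (Fin.succ_ne_zero i).symm]
      exact TensorProduct.tmul_smul _ _ _

/-- The elementary tensor as a multilinear map. -/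
noncomputable def elemTensorMultilinear (R : Type u) [NormedAddCommGroup R]
    [InnerProductSpace ℂ R] (n : ℕ) :
    MultilinearMap ℂ (fun _ : Fin n => R) (algTensorPower R n).carrier where
  toFun := elemTensor n
  map_update_add' := by
    intro inst f i x y
    rw [Subsingleton.elim inst (instDecidableEqFin n)]
    exact elemTensor_update_add n f i x y
  map_update_smul' := by
    intro inst f i c x
    rw [Subsingleton.elim inst (instDecidableEqFin n)]
    exact elemTensor_update_smul n f i c x

/-- The symmetrized elementary tensor
`Symⁿ (f₁ ⊗ ⋯ ⊗ fₙ) = (1/n!) ∑_σ f_{σ(1)} ⊗ ⋯ ⊗ f_{σ(n)}`, as a multilinear map. -/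
noncomputable def symTensor (R : Type u) [NormedAddCommGroup R] [InnerProductSpace ℂ R] (n : ℕ) :
    MultilinearMap ℂ (fun _ : Fin n => R) (HilbertTensorPower R n) :=
  UniformSpace.Completion.toComplL.toLinearMap.compMultilinearMap
    ((n.factorial : ℂ)⁻¹ •
      ∑ σ : Equiv.Perm (Fin n), (elemTensorMultilinear R n).domDomCongr σ)

/-- The `n`-particle space `Γₛⁿ(R)`, the range of the projection `Symⁿ` on `⊗ⁿ R`: the closed
linear span of the symmetrized elementary tensors. -/
noncomputable def nParticleSpace (R : Type u) [NormedAddCommGroup R] [InnerProductSpace ℂ R]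
    (n : ℕ) : Submodule ℂ (HilbertTensorPower R n) :=
  (Submodule.span ℂ (Set.range (symTensor R n))).topologicalClosure

/-- The bosonic Fock space `Γₛ(R)`, the Hilbert space direct sum of the `Γₛⁿ(R)`. -/
abbrev FockSpace (R : Type u) [NormedAddCommGroup R] [InnerProductSpace ℂ R] : Type u :=
  lp (fun n : ℕ => nParticleSpace R n) 2

instance instCompleteSpaceNParticle (n : ℕ) : CompleteSpace (nParticleSpace R n) :=
  (Submodule.isClosed_topologicalClosure _).completeSpace_coe

/-- `Symⁿ (f₁ ⊗ ⋯ ⊗ fₙ)` as a vector of Fock space, multilinear in `f₁, …, fₙ`. -/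
noncomputable def symVec (R : Type u) [NormedAddCommGroup R] [InnerProductSpace ℂ R] (n : ℕ) :
    MultilinearMap ℂ (fun _ : Fin n => R) (FockSpace R) :=
  (lp.lsingle (𝕜 := ℂ) (E := fun n : ℕ => nParticleSpace R n) 2 n).compMultilinearMap
    ((symTensor R n).codRestrict (nParticleSpace R n) fun f =>
      Submodule.le_topologicalClosure _ (Submodule.subset_span ⟨f, rfl⟩))

/-- The vacuum `Ω`. -/
noncomputable def vacuum (R : Type u) [NormedAddCommGroup R] [InnerProductSpace ℂ R] :
    FockSpace R :=
  symVec R 0 Fin.elim0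

/-- The linear map `φ ↦ Symⁿ⁺¹ (φ ⊗ f₁ ⊗ ⋯ ⊗ fₙ)`. -/
noncomputable def symCons {n : ℕ} (f : Fin n → R) : R →ₗ[ℂ] FockSpace R where
  toFun φ := (symVec R (n + 1)).curryLeft φ f
  map_add' x y := by rw [map_add]; rfl
  map_smul' c x := by rw [map_smul]; rfl

end Fock

/-! ### Pauli-Fierz operators and their weak coupling limit -/

section PauliFierz

variable {𝓚 : Type v} [NormedAddCommGroup 𝓚] [InnerProductSpace ℂ 𝓚]
  [FiniteDimensional ℂ 𝓚] [CompleteSpace 𝓚]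
variable {R : Type u} [NormedAddCommGroup R] [InnerProductSpace ℂ R] [CompleteSpace R]

/-- `a*(V)` on the vector `k ⊗ Symⁿ (f₁ ⊗ ⋯ ⊗ fₙ)`: the vector `√(n+1) (1 ⊗ Symⁿ⁺¹) (V ⊗ 1)`
of it. -/
noncomputable def creationVec (V : 𝓚 →L[ℂ] 𝓚 ⊗[ℂ] R) (k : 𝓚) {n : ℕ} (f : Fin n → R) :
    𝓚 ⊗[ℂ] FockSpace R :=
  (Real.sqrt (n + 1) : ℂ) • (symCons f).lTensor 𝓚 (V k)

/-- `a(V)` on the vector `k ⊗ Symⁿ (f₁ ⊗ ⋯ ⊗ fₙ)`: the vector `√n (V* ⊗ 1)` of it, where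
`Symⁿ (f₁ ⊗ ⋯ ⊗ fₙ) = (1/n) ∑ⱼ fⱼ ⊗ Symⁿ⁻¹ (f₁ ⊗ ⋯ (without fⱼ) ⋯ ⊗ fₙ)`. -/
noncomputable def annihilationVec (V : 𝓚 →L[ℂ] 𝓚 ⊗[ℂ] R) (k : 𝓚) :
    {n : ℕ} → (Fin n → R) → 𝓚 ⊗[ℂ] FockSpace R
  | 0, _ => 0
  | n + 1, f => ((Real.sqrt (n + 1) : ℂ) / (n + 1)) •
      ∑ j : Fin (n + 1), (ContinuousLinearMap.adjoint V (k ⊗ₜ[ℂ] f j)) ⊗ₜ[ℂ]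
        symVec R n (fun i => f (j.succAbove i))

/-- `H₀ = K + dΓ(H_R)` on the vector `k ⊗ Symⁿ (f₁ ⊗ ⋯ ⊗ fₙ)`, for `fⱼ` in the domain of `H_R`. -/
noncomputable def freeVec (K : 𝓚 →L[ℂ] 𝓚) (HR : R →ₗ.[ℂ] R) (k : 𝓚) {n : ℕ}
    (f : Fin n → HR.domain) : 𝓚 ⊗[ℂ] FockSpace R :=
  (K k) ⊗ₜ[ℂ] symVec R n (fun i => (f i : R)) +
    ∑ j : Fin n, k ⊗ₜ[ℂ] symVec R n (Function.update (fun i => (f i : R)) j (HR (f j)))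

/-- The graph of `H_λ = K + dΓ(H_R) + λ (a(V) + a*(V))` on the algebraic tensor product of `𝓚`
with the finite particle space over the domain of `H_R`. For `λ = 0` this is the graph of the free
operator `H₀`. -/
noncomputable def pauliFierzGraph (K : 𝓚 →L[ℂ] 𝓚) (HR : R →ₗ.[ℂ] R) (V : 𝓚 →L[ℂ] 𝓚 ⊗[ℂ] R) (lam : ℝ) :
    Submodule ℂ ((𝓚 ⊗[ℂ] FockSpace R) × (𝓚 ⊗[ℂ] FockSpace R)) :=
  Submodule.span ℂ {p | ∃ (n : ℕ) (k : 𝓚) (f : Fin n → HR.domain),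
    p = (k ⊗ₜ[ℂ] symVec R n (fun i => (f i : R)),
      freeVec K HR k f + (lam : ℂ) •
        (annihilationVec V k (fun i => (f i : R)) + creationVec V k (fun i => (f i : R))))}

/-- `e^{-itH_λ}`. -/
noncomputable def pauliFierzGroup (K : 𝓚 →L[ℂ] 𝓚) (HR : R →ₗ.[ℂ] R) (V : 𝓚 →L[ℂ] 𝓚 ⊗[ℂ] R)
    (lam t : ℝ) : 𝓚 ⊗[ℂ] FockSpace R →L[ℂ] 𝓚 ⊗[ℂ] FockSpace R :=
  unitaryGroup (E := 𝓚 ⊗[ℂ] FockSpace R) (pauliFierzGraph K HR V lam) t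

/-- `T_λ(t, t₀) = e^{itH₀} e^{-i(t-t₀)H_λ} e^{-it₀H₀}`. -/
noncomputable def interactionPropagator (K : 𝓚 →L[ℂ] 𝓚) (HR : R →ₗ.[ℂ] R)
    (V : 𝓚 →L[ℂ] 𝓚 ⊗[ℂ] R) (lam t t₀ : ℝ) :
    𝓚 ⊗[ℂ] FockSpace R →L[ℂ] 𝓚 ⊗[ℂ] FockSpace R :=
  pauliFierzGroup K HR V 0 (-t) * pauliFierzGroup K HR V lam (t - t₀) *
    pauliFierzGroup K HR V 0 t₀

/-- The embedding `I_𝓚 : 𝓚 → 𝓚 ⊗ Γₛ(R)`, `k ↦ k ⊗ Ω`. -/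
noncomputable def vacuumEmbedding (𝓚 : Type v) [NormedAddCommGroup 𝓚] [InnerProductSpace ℂ 𝓚]
    (R : Type u) [NormedAddCommGroup R] [InnerProductSpace ℂ R] :
    𝓚 →L[ℂ] 𝓚 ⊗[ℂ] FockSpace R :=
  (TensorProduct.mkL ℂ 𝓚 (FockSpace R)).flip (vacuum R)

/-- For `S = (S₁, …, S_ℓ)` and times `τ = (t₀, t₁, …, t_ℓ, t)`, the product
`P(t, t_ℓ) S_ℓ ⋯ S₂ P(t₂, t₁) S₁ P(t₁, t₀)`. -/
def multiTimeProduct {A : Type w} [Monoid A] (P : ℝ → ℝ → A) :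
    (ℓ : ℕ) → (Fin ℓ → A) → (Fin (ℓ + 2) → ℝ) → A
  | 0, _, τ => P (τ 1) (τ 0)
  | ℓ + 1, S, τ => P (τ (Fin.last (ℓ + 2))) (τ (Fin.last (ℓ + 1)).castSucc) *
      S (Fin.last ℓ) * multiTimeProduct P ℓ (Fin.init S) (Fin.init τ)

/-- The set of (real) eigenvalues of the self-adjoint matrix `K`, i.e. its spectrum. -/
def eigenvalueSet (K : 𝓚 →L[ℂ] 𝓚) : Set ℝ :=
  {k | Module.End.HasEigenvalue (K : 𝓚 →ₗ[ℂ] 𝓚) (k : ℂ)}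

/-- The set `𝓕` of Bohr frequencies `k - k'`, where `k, k' ∈ sp K`. -/
def bohrFrequencies (K : 𝓚 →L[ℂ] 𝓚) : Set ℝ :=
  {ω | ∃ k ∈ eigenvalueSet K, ∃ k' ∈ eigenvalueSet K, ω = k - k'}

/-- The spectral projection `1_{𝓚_k}` of `K` onto the eigenspace of `k`. -/
noncomputable def eigenprojection (K : 𝓚 →L[ℂ] 𝓚) (k : ℝ) : 𝓚 →L[ℂ] 𝓚 :=
  (Module.End.eigenspace (K : 𝓚 →ₗ[ℂ] 𝓚) (k : ℂ)).starProjection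

/-- `e^{-itH₀}` on the one-particle sector `𝓚 ⊗ R`, i.e.
`e^{-it(K + H_R)} = e^{-itK} ⊗ e^{-itH_R}`. -/
noncomputable def oneParticleGroup (K : 𝓚 →L[ℂ] 𝓚) (HR : R →ₗ.[ℂ] R) (t : ℝ) :
    𝓚 ⊗[ℂ] R →L[ℂ] 𝓚 ⊗[ℂ] R :=
  TensorProduct.mapL (NormedSpace.exp ((-(Complex.I * t)) • K)) (unitaryGroup HR.graph t)

/-- `Υ = - i ∑_{k ∈ sp K} ∫₀^∞ 1_{𝓚_k} V* e^{-it(K + H_R - k)} V 1_{𝓚_k} dt`. -/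
noncomputable def upsilon (K : 𝓚 →L[ℂ] 𝓚) (HR : R →ₗ.[ℂ] R) (V : 𝓚 →L[ℂ] 𝓚 ⊗[ℂ] R) :
    𝓚 →L[ℂ] 𝓚 :=
  -(∑ᶠ k ∈ eigenvalueSet K, Complex.I • ∫ t in Set.Ioi (0 : ℝ),
    eigenprojection K k ∘L ContinuousLinearMap.adjoint V ∘L
      (Complex.exp (Complex.I * t * k) • oneParticleGroup K HR t) ∘L V ∘L eigenprojection K k)

/-- First assumption: for each Bohr frequency `ω` an open set `I ω ∋ ω` and an identification
`J ω` of `L²(I ω) ⊗ 𝔥 ω = L²(I ω; 𝔥 ω)` with the range of `1_{I ω}(H_R)`, under which `H_R` acts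
as multiplication by the variable; the sets `I ω` are pairwise disjoint. -/
structure SpectralAssumption (K : 𝓚 →L[ℂ] 𝓚) (HR : R →ₗ.[ℂ] R)
    (𝔥 : bohrFrequencies K → Type w) [∀ ω, NormedAddCommGroup (𝔥 ω)]
    [∀ ω, InnerProductSpace ℂ (𝔥 ω)] (I : bohrFrequencies K → Set ℝ)
    (J : ∀ ω, Lp (𝔥 ω) 2 (volume.restrict (I ω)) →ₗᵢ[ℂ] R) : Prop where
  isOpen : ∀ ω, IsOpen (I ω)
  mem : ∀ ω, (ω : ℝ) ∈ I ω
  disjoint : Pairwise fun ω ω' => Disjoint (I ω) (I ω')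
  range_eq : ∀ ω, Set.range (J ω) = spectralRange HR (I ω)
  multiplication : ∀ ω (f g : Lp (𝔥 ω) 2 (volume.restrict (I ω))),
    (J ω f, J ω g) ∈ HR.graph ↔ ∀ᵐ x ∂(volume.restrict (I ω)), g x = (x : ℂ) • f x

/-- Second assumption: on each `I ω` the operator `V` is given by a measurable function
`v ω : I ω → B(𝓚, 𝓚 ⊗ 𝔥 ω)`, i.e. `(V k)(x) = v(x) k` for almost all `x ∈ I ω`, and
`v ω` is continuous at `ω`. The identity is expressed by pairing the factor `𝓚` with arbitrary
vectors `k'`. -/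
structure FormFactorAssumption (K : 𝓚 →L[ℂ] 𝓚) (V : 𝓚 →L[ℂ] 𝓚 ⊗[ℂ] R)
    (𝔥 : bohrFrequencies K → Type w) [∀ ω, NormedAddCommGroup (𝔥 ω)]
    [∀ ω, InnerProductSpace ℂ (𝔥 ω)] [∀ ω, CompleteSpace (𝔥 ω)] (I : bohrFrequencies K → Set ℝ)
    (J : ∀ ω, Lp (𝔥 ω) 2 (volume.restrict (I ω)) →ₗᵢ[ℂ] R)
    (v : ∀ ω, ℝ → 𝓚 →L[ℂ] 𝓚 ⊗[ℂ] 𝔥 ω) : Prop where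
  measurable : ∀ ω, Measurable fun x : I ω => v ω x
  eq_ae : ∀ ω (k k' : 𝓚), ∀ᵐ x ∂(volume.restrict (I ω)),
    (ContinuousLinearMap.adjoint (J ω).toContinuousLinearMap (partialInner R k' (V k))) x =
      partialInner (𝔥 ω) k' (v ω x k)
  continuousAt : ∀ ω, ContinuousAt (v ω) ω

/-- Third assumption: `∫₀^∞ ‖V* (S ⊗ 1) e^{-itH₀} V‖ dt < ∞` for all `S ∈ B(𝓚)`. -/
def IntegrabilityAssumption (K : 𝓚 →L[ℂ] 𝓚) (HR : R →ₗ.[ℂ] R) (V : 𝓚 →L[ℂ] 𝓚 ⊗[ℂ] R) : Prop :=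
  ∀ S : 𝓚 →L[ℂ] 𝓚, ∫⁻ t in Set.Ioi (0 : ℝ),
    ‖ContinuousLinearMap.adjoint V ∘L S.rTensor R ∘L oneParticleGroup K HR t ∘L V‖ₑ < ⊤

end PauliFierz

/-!
# The weak coupling limit of Pauli-Fierz operators

In the interaction picture the propagator `W(t, s)` solves `∂ₜ W = -iλ Φ(t) W`, where the field
`Φ(t)` is built from the system operators `E_α(t) = e^{itK} E_α e^{-itK}` and the form factors
`v_α(t) = e^{itH_R} v_α` of a decomposition `V = ∑ E_α ⊗ v_α`. For the vacuum component
`m(t) = I* W(t, s) X` of a state only the annihilation part of the field contributes,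

  `m'(t) = -iλ ∑ E_α(t)* I* a(v_α(t)) W(t, s) X`.

The canonical commutation relations give Duhamel's formula

  `a(g) W(t, s) X = W(t, s) a(g) X - iλ ∑ ∫ₛᵗ ⟨g, v_β(r)⟩ W(t, r) E_β(r) W(r, s) X dr`,

so only the correlation functions `⟨v_α, e^{-ixH_R} v_β⟩` enter, and these are integrable over
`(0, ∞)`: they are matrix elements of `V* (S ⊗ 1) e^{-itH₀} V` (`integrableCorr_matrixCoupling`).
A state is called tame (`CoupledModel.IsTame`) if all its annihilations `a(g) X` are bounded through
the correlations of `g` with the coupling in the past. The vacuum is tame, and tameness survives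
system operators and the evolution; hence no Wick expansion is needed, and intermediate operators
`S_j` are treated just as the vacuum.

For tame states `m' = O(λ²)`, and inserting Duhamel's formula into the equation for `m` gives
`m'(t) = λ² A(t) m(t) + error`, where `A(t) = e^{itK} A(0) e^{-itK}` (`Coupling.generatorAt`) is the
integral of the correlations (`CoupledModel.IsTame.exists_residual`). The matrix elements of `A(t)`
oscillate with the Bohr frequencies of `K`; its mean `G`, the block diagonal part of `A(0)`, is
`-iΥ` (`inner_upsilon`), and `A - G` has a bounded primitive `B`. Therefore
`e^{-λ²(t-s)G} (1 - λ² B(t)) m(t)` is constant up to `o(1)` for times of order `λ⁻²`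
(`CoupledModel.exists_averaging_bound`). An induction on the number of time intervals concludes
(`CoupledModel.exists_multiTime_bound`).

Three facts about the unbounded operators carry this. Stone's theorem for essentially self-adjoint
graphs is proved with Yosida approximations. Essential self-adjointness of `H_λ` on the finite
particle vectors follows from Carleman's argument: for `y` orthogonal to the range of `H_λ + is`, the
`n`-particle components satisfy a balance equation with coefficients of order `√n`, which has no
square summable solutions as `∑ 1/n = ∞` (`CoupledModel.isEssentiallySelfAdjointGraph_coupled`).
Duhamel's formula is established sector by sector; the difference of its two sides solves a
homogeneous nearest-neighbour hierarchy with coefficients of order `√n`, whose only solution with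
`O(√n)` growth is zero (`hierarchy_eq_zero`, `CoupledModel.AnnPair.prop`).
-/

/-! ### Strongly continuous families of bounded operators -/

section StronglyContinuous

variable {E F : Type*} [NormedAddCommGroup E] [NormedSpace ℂ E]
  [NormedAddCommGroup F] [NormedSpace ℂ F]

/-- A strongly continuous, uniformly bounded family of operators is jointly continuous. -/
theorem continuous_uncurry_of_strong {U : ℝ → E →L[ℂ] F} {C : ℝ}
    (hU : ∀ x, Continuous fun t => U t x) (hC : ∀ t x, ‖U t x‖ ≤ C * ‖x‖) :
    Continuous fun p : ℝ × E => U p.1 p.2 := by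
  rw [continuous_iff_continuousAt]
  rintro ⟨t, x⟩
  have h1 : Tendsto (fun p : ℝ × E => U p.1 x) (𝓝 (t, x)) (𝓝 (U t x)) :=
    ((hU x).tendsto t).comp continuous_fst.continuousAt
  have h2 : Tendsto (fun p : ℝ × E => U p.1 (p.2 - x)) (𝓝 (t, x)) (𝓝 0) := by
    refine squeeze_zero_norm (fun p => hC p.1 _) ?_
    have : Tendsto (fun p : ℝ × E => C * ‖p.2 - x‖) (𝓝 (t, x)) (𝓝 (C * ‖x - x‖)) :=
      (Continuous.tendsto (by fun_prop) (t, x))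
    simpa using this
  have := h1.add h2
  simp only [map_sub, add_zero] at this
  simpa [ContinuousAt] using this

theorem Continuous.strong_apply {U : ℝ → E →L[ℂ] F} {C : ℝ}
    (hU : ∀ x, Continuous fun t => U t x) (hC : ∀ t x, ‖U t x‖ ≤ C * ‖x‖)
    {α : Type*} [TopologicalSpace α] {f : α → ℝ} {y : α → E} (hf : Continuous f)
    (hy : Continuous y) : Continuous fun a => U (f a) (y a) :=
  (continuous_uncurry_of_strong hU hC).comp (hf.prodMk hy)

/-- The product rule for a strongly continuous family applied to a differentiable vector. The
family only has to be differentiable on the single vector `y t`. -/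
theorem HasDerivAt.strong_apply {U : ℝ → E →L[ℂ] F} {C : ℝ}
    (hU : ∀ x, Continuous fun t => U t x) (hC : ∀ t x, ‖U t x‖ ≤ C * ‖x‖)
    {y : ℝ → E} {t : ℝ} {y' : E} {d : F} (hd : HasDerivAt (fun s => U s (y t)) d t)
    (hy : HasDerivAt y y' t) : HasDerivAt (fun s => U s (y s)) (d + U t y') t := by
  rw [hasDerivAt_iff_tendsto_slope] at *
  have h2 : Tendsto (fun s => U s (slope y t s)) (𝓝[≠] t) (𝓝 (U t y')) := by
    have := (continuous_uncurry_of_strong hU hC).tendsto (t, y')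
    exact this.comp ((tendsto_nhdsWithin_of_tendsto_nhds tendsto_id).prodMk_nhds hy)
  refine (hd.add h2).congr fun s => ?_
  simp only [slope, vsub_eq_sub, ← Complex.coe_smul, map_smul, map_sub, ← smul_add]
  congr 1
  abel

theorem HasDerivAt.clm_const {L : E →L[ℂ] F} {y : ℝ → E} {y' : E} {t : ℝ}
    (hy : HasDerivAt y y' t) : HasDerivAt (fun s => L (y s)) (L y') t :=
  (L.restrictScalars ℝ).hasFDerivAt.comp_hasDerivAt t hy

end StronglyContinuous

/-! ### Exponentials of bounded skew-adjoint operators -/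

section SkewAdjoint

variable {E : Type*} [NormedAddCommGroup E] [InnerProductSpace ℂ E] [CompleteSpace E]

theorem hasDerivAt_exp_smul_apply (B : E →L[ℂ] E) (x : E) (t : ℝ) :
    HasDerivAt (fun s : ℝ => NormedSpace.exp (s • B) x) (NormedSpace.exp (t • B) (B x)) t := by
  have h := hasDerivAt_exp_smul_const (𝕂 := ℝ) B t
  have := ((ContinuousLinearMap.apply ℝ E x).comp
    (ContinuousLinearMap.restrictScalarsL ℂ E E ℝ ℝ)).hasFDerivAt.comp_hasDerivAt t h
  exact this

theorem exp_smul_neg_mul (B : E →L[ℂ] E) (t : ℝ) :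
    NormedSpace.exp ((-t) • B) * NormedSpace.exp (t • B) = 1 := by
  let _ : NormedAlgebra ℚ (E →L[ℂ] E) := NormedAlgebra.restrictScalars ℚ ℝ _
  rw [← NormedSpace.exp_add_of_commute, neg_smul, neg_add_cancel, NormedSpace.exp_zero]
  exact ((Commute.refl B).smul_left _).smul_right _

theorem norm_exp_smul_apply {B : E →L[ℂ] E} (hB : star B = -B) (t : ℝ) (x : E) :
    ‖NormedSpace.exp (t • B) x‖ = ‖x‖ := by
  let _ : NormedAlgebra ℚ (E →L[ℂ] E) := NormedAlgebra.restrictScalars ℚ ℝ _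
  have h : ContinuousLinearMap.adjoint (NormedSpace.exp (t • B)) * NormedSpace.exp (t • B) = 1 := by
    rw [← ContinuousLinearMap.star_eq_adjoint, NormedSpace.star_exp, star_smul, hB]
    simpa using exp_smul_neg_mul B t
  have h2 : ⟪NormedSpace.exp (t • B) x, NormedSpace.exp (t • B) x⟫_ℂ = ⟪x, x⟫_ℂ := by
    rw [← ContinuousLinearMap.adjoint_inner_left, ← mul_apply_eq_comp, h,
      one_apply_eq_self]
  rw [@norm_eq_sqrt_re_inner ℂ, @norm_eq_sqrt_re_inner ℂ _ _ _ _ x, h2]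

theorem norm_exp_smul_sub_le {B : E →L[ℂ] E} (hB : star B = -B) (t : ℝ) (x : E) :
    ‖NormedSpace.exp (t • B) x - x‖ ≤ ‖B x‖ * |t| := by
  have := Convex.norm_image_sub_le_of_norm_hasDerivWithin_le (𝕜 := ℝ) (s := Set.univ)
    (f := fun s : ℝ => NormedSpace.exp (s • B) x) (C := ‖B x‖) (x := 0) (y := t)
    (fun s _ => (hasDerivAt_exp_smul_apply B x s).hasDerivWithinAt)
    (fun s _ => (norm_exp_smul_apply hB s _).le) convex_univ trivial trivial
  simpa [NormedSpace.exp_zero] using this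

/-- Duhamel's estimate for commuting generators. -/
theorem norm_exp_smul_sub_exp_smul_le {B C : E →L[ℂ] E} (hB : star B = -B) (hC : star C = -C)
    (hBC : Commute B C) (t : ℝ) (x : E) :
    ‖NormedSpace.exp (t • B) x - NormedSpace.exp (t • C) x‖ ≤ ‖B x - C x‖ * |t| := by
  let _ : NormedAlgebra ℚ (E →L[ℂ] E) := NormedAlgebra.restrictScalars ℚ ℝ _
  have h : NormedSpace.exp (t • B) = NormedSpace.exp (t • C) * NormedSpace.exp (t • (B - C)) := by
    rw [← NormedSpace.exp_add_of_commute, ← smul_add, add_sub_cancel]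
    exact ((hBC.symm.sub_right (Commute.refl C)).smul_left _).smul_right _
  rw [h, mul_apply_eq_comp, ← map_sub, norm_exp_smul_apply hC]
  exact norm_exp_smul_sub_le (by rw [star_sub, hB, hC]; abel) t x

end SkewAdjoint

/-! ### Stone's theorem for essentially self-adjoint graphs -/

section Stone

variable {E : Type u} [NormedAddCommGroup E] [InnerProductSpace ℂ E]

namespace IsUnitaryGroupGeneratedBy

variable {G : Submodule ℂ (E × E)} {U : ℝ → E →L[ℂ] E}

theorem norm_le (hU : IsUnitaryGroupGeneratedBy G U) (t : ℝ) (x : E) : ‖U t x‖ ≤ 1 * ‖x‖ := by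
  rw [one_mul, hU.norm_map]

theorem neg_apply (hU : IsUnitaryGroupGeneratedBy G U) (t : ℝ) (x : E) : U (-t) (U t x) = x := by
  rw [← mul_apply_eq_comp, ← hU.add, neg_add_cancel, hU.zero,
    one_apply_eq_self]

theorem apply_neg (hU : IsUnitaryGroupGeneratedBy G U) (t : ℝ) (x : E) : U t (U (-t) x) = x := by
  simpa using hU.neg_apply (-t) x

theorem inner_map_map (hU : IsUnitaryGroupGeneratedBy G U) (t : ℝ) (x y : E) :
    ⟪U t x, U t y⟫_ℂ = ⟪x, y⟫_ℂ :=
  (LinearIsometry.mk (U t).toLinearMap (hU.norm_map t)).inner_map_map x y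

theorem inner_left (hU : IsUnitaryGroupGeneratedBy G U) (t : ℝ) (x y : E) :
    ⟪U t x, y⟫_ℂ = ⟪x, U (-t) y⟫_ℂ := by
  rw [← hU.inner_map_map t x, hU.apply_neg]

theorem continuous_apply (hU : IsUnitaryGroupGeneratedBy G U) {α : Type*} [TopologicalSpace α]
    {f : α → ℝ} {y : α → E} (hf : Continuous f) (hy : Continuous y) :
    Continuous fun a => U (f a) (y a) :=
  Continuous.strong_apply hU.continuous hU.norm_le hf hy

theorem hasDerivAt_of_mem (hU : IsUnitaryGroupGeneratedBy G U) {p : E × E} (hp : p ∈ G) (t : ℝ) :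
    HasDerivAt (fun s => U s p.1) (-(Complex.I • U t p.2)) t := by
  have h0 : HasDerivAt (fun s => U s p.1) (-(Complex.I • p.2)) (t - t) := by
    rw [sub_self]; exact hU.hasDerivAt p hp
  have h1 : HasDerivAt (fun s : ℝ => U (s - t) p.1) (-(Complex.I • p.2)) t := by
    simpa using HasDerivAt.comp_sub_const t t h0
  have h2 := h1.clm_const (L := U t)
  simp only [← mul_apply_eq_comp, ← hU.add, add_sub_cancel] at h2
  simpa using h2

/-- The integrated equation of motion, which passes to the closure of the graph. -/
theorem sub_eq_integral [CompleteSpace E] (hU : IsUnitaryGroupGeneratedBy G U) {p : E × E}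
    (hp : p ∈ G.topologicalClosure) (t : ℝ) :
    U t p.1 - p.1 = ∫ s in (0 : ℝ)..t, -(Complex.I • U s p.2) := by
  have hcl : IsClosed {p : E × E | U t p.1 - p.1 = ∫ s in (0 : ℝ)..t, -(Complex.I • U s p.2)} := by
    refine isClosed_eq (by fun_prop) ?_
    refine intervalIntegral.continuous_parametric_intervalIntegral_of_continuous' ?_ 0 t
    exact ((hU.continuous_apply continuous_snd (continuous_snd.comp continuous_fst)).const_smul
      Complex.I).neg
  have hsub : (G : Set (E × E)) ⊆
      {p : E × E | U t p.1 - p.1 = ∫ s in (0 : ℝ)..t, -(Complex.I • U s p.2)} := by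
    intro q hq
    rw [Set.mem_ofPred_eq, intervalIntegral.integral_eq_sub_of_hasDerivAt
      (fun s _ => hU.hasDerivAt_of_mem hq s)
      (Continuous.intervalIntegrable (by have := hU.continuous q.2; fun_prop) _ _)]
    simp [hU.zero]
  exact closure_minimal hsub hcl hp

/-- The group is differentiable on the domain of the closure of the operator. -/
theorem hasDerivAt_of_mem_closure [CompleteSpace E] (hU : IsUnitaryGroupGeneratedBy G U)
    {p : E × E} (hp : p ∈ G.topologicalClosure) (t : ℝ) :
    HasDerivAt (fun s => U s p.1) (-(Complex.I • U t p.2)) t := by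
  have h1 : (fun s => U s p.1) = fun s => p.1 + ∫ r in (0 : ℝ)..s, -(Complex.I • U r p.2) := by
    funext s
    rw [← hU.sub_eq_integral hp s]; abel
  rw [h1]
  have hc : Continuous fun r => -(Complex.I • U r p.2) := by
    have := hU.continuous p.2; fun_prop
  exact (intervalIntegral.integral_hasDerivAt_right (hc.intervalIntegrable _ _)
    (hc.stronglyMeasurableAtFilter _ _) hc.continuousAt).const_add _

end IsUnitaryGroupGeneratedBy

/-- The graph of a densely defined symmetric operator `A` such that `A + is` has dense range for
every real `s ≠ 0`, i.e. of an essentially self-adjoint operator. Density of the domain and of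
the ranges is expressed through orthogonal complements. -/
structure IsEssentiallySelfAdjointGraph (G : Submodule ℂ (E × E)) : Prop where
  symm : ∀ p ∈ G, ∀ q ∈ G, ⟪p.2, q.1⟫_ℂ = ⟪p.1, q.2⟫_ℂ
  dense : ∀ y : E, (∀ p ∈ G, ⟪p.1, y⟫_ℂ = 0) → y = 0
  range : ∀ s : ℝ, s ≠ 0 → ∀ y : E, (∀ p ∈ G, ⟪p.2 + (Complex.I * s) • p.1, y⟫_ℂ = 0) → y = 0

namespace IsEssentiallySelfAdjointGraph

variable {G : Submodule ℂ (E × E)}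

theorem symm_closure (hG : IsEssentiallySelfAdjointGraph G) :
    ∀ p ∈ G.topologicalClosure, ∀ q ∈ G.topologicalClosure, ⟪p.2, q.1⟫_ℂ = ⟪p.1, q.2⟫_ℂ := by
  have h1 : ∀ p ∈ G, ∀ q ∈ G.topologicalClosure, ⟪p.2, q.1⟫_ℂ = ⟪p.1, q.2⟫_ℂ := by
    intro p hp q hq
    have hcl : IsClosed {q : E × E | ⟪p.2, q.1⟫_ℂ = ⟪p.1, q.2⟫_ℂ} :=
      isClosed_eq (by fun_prop) (by fun_prop)
    exact closure_minimal (fun q hq => hG.symm p hp q hq) hcl hq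
  intro p hp q hq
  have hcl : IsClosed {p : E × E | ⟪p.2, q.1⟫_ℂ = ⟪p.1, q.2⟫_ℂ} :=
    isClosed_eq (by fun_prop) (by fun_prop)
  exact closure_minimal (fun p hp => h1 p hp q hq) hcl hp

/-- The cross terms cancel because the operator is symmetric. -/
theorem norm_sq_add (hG : IsEssentiallySelfAdjointGraph G) (s : ℝ) {p : E × E}
    (hp : p ∈ G.topologicalClosure) :
    ‖p.2 + (Complex.I * s) • p.1‖ ^ 2 = ‖p.2‖ ^ 2 + s ^ 2 * ‖p.1‖ ^ 2 := by
  have h := hG.symm_closure p hp p hp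
  rw [@norm_add_sq ℂ, inner_smul_right, norm_smul]
  have him : (⟪p.2, p.1⟫_ℂ).im = 0 := by
    have h2 := congrArg Complex.im h
    rw [← inner_conj_symm p.1 p.2, Complex.conj_im] at h2
    linarith
  have : RCLike.re (Complex.I * s * ⟪p.2, p.1⟫_ℂ) = 0 := by simp [him]
  rw [this]
  simp [mul_pow]

theorem norm_fst_le (hG : IsEssentiallySelfAdjointGraph G) (s : ℝ) {p : E × E}
    (hp : p ∈ G.topologicalClosure) : |s| * ‖p.1‖ ≤ ‖p.2 + (Complex.I * s) • p.1‖ := by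
  apply le_of_sq_le_sq _ (norm_nonneg _)
  rw [hG.norm_sq_add s hp, mul_pow, sq_abs]
  nlinarith [sq_nonneg ‖p.2‖]

theorem norm_snd_le (hG : IsEssentiallySelfAdjointGraph G) (s : ℝ) {p : E × E}
    (hp : p ∈ G.topologicalClosure) : ‖p.2‖ ≤ ‖p.2 + (Complex.I * s) • p.1‖ := by
  apply le_of_sq_le_sq _ (norm_nonneg _)
  rw [hG.norm_sq_add s hp]
  nlinarith [mul_nonneg (sq_nonneg s) (sq_nonneg ‖p.1‖)]

theorem dense_domain [CompleteSpace E] (hG : IsEssentiallySelfAdjointGraph G) :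
    Dense {x : E | ∃ p ∈ G, p.1 = x} := by
  have h1 : (G.map (LinearMap.fst ℂ E E)).topologicalClosure = ⊤ := by
    rw [Submodule.topologicalClosure_eq_top_iff, Submodule.eq_bot_iff]
    intro z hz
    rw [Submodule.mem_orthogonal] at hz
    exact hG.dense z fun p hp => hz _ ⟨p, hp, rfl⟩
  exact Submodule.dense_iff_topologicalClosure_eq_top.2 h1

theorem eq_of_add_eq (hG : IsEssentiallySelfAdjointGraph G) {s : ℝ} (hs : s ≠ 0) {p q : E × E}
    (hp : p ∈ G.topologicalClosure) (hq : q ∈ G.topologicalClosure)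
    (h : p.2 + (Complex.I * s) • p.1 = q.2 + (Complex.I * s) • q.1) : p.1 = q.1 := by
  have h1 := hG.norm_fst_le s (Submodule.sub_mem _ hp hq)
  have h2 : (p - q).2 + (Complex.I * s) • (p - q).1 = 0 := by
    rw [Prod.fst_sub, Prod.snd_sub, smul_sub, ← sub_eq_zero.2 h]; abel
  rw [h2, norm_zero] at h1
  have hs' : 0 < |s| := abs_pos.2 hs
  have h3 : ‖(p - q).1‖ = 0 := by nlinarith [norm_nonneg (p - q).1]
  exact sub_eq_zero.1 (norm_eq_zero.1 h3)

variable [CompleteSpace E]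

/-- The range of `A + is` for the closure of the operator is dense, and closed by the lower bounds
on `A + is`; hence it is the whole space. -/
theorem exists_mem_closure (hG : IsEssentiallySelfAdjointGraph G) {s : ℝ} (hs : s ≠ 0) (y : E) :
    ∃ p ∈ G.topologicalClosure, p.2 + (Complex.I * s) • p.1 = y := by
  let L : G.topologicalClosure →L[ℂ] E :=
    (ContinuousLinearMap.snd ℂ E E + (Complex.I * s) • ContinuousLinearMap.fst ℂ E E).comp
      G.topologicalClosure.subtypeL
  have hL : ∀ p : G.topologicalClosure, L p = p.1.2 + (Complex.I * s) • p.1.1 := fun p => rfl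
  have hcomp : CompleteSpace G.topologicalClosure :=
    (Submodule.isClosed_topologicalClosure _).completeSpace_coe
  have hanti : AntilipschitzWith (Real.toNNReal (max 1 |s|⁻¹)) L := by
    refine AddMonoidHomClass.antilipschitz_of_bound L fun p => ?_
    rw [Real.coe_toNNReal _ (by positivity), hL]
    have h1 := hG.norm_fst_le s p.2
    have h2 := hG.norm_snd_le s p.2
    have hs' : 0 < |s| := abs_pos.2 hs
    change ‖(p : E × E)‖ ≤ _
    rw [Prod.norm_def]
    refine max_le ?_ ?_
    · have : ‖p.1.1‖ ≤ |s|⁻¹ * ‖p.1.2 + (Complex.I * s) • p.1.1‖ := by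
        rw [inv_mul_eq_div, le_div_iff₀ hs']; linarith
      exact this.trans (mul_le_mul_of_nonneg_right (le_max_right _ _) (norm_nonneg _))
    · exact h2.trans (le_mul_of_one_le_left (norm_nonneg _) (le_max_left _ _))
  have hclosed : IsClosed (Set.range L) := hanti.isClosed_range L.uniformContinuous
  have htop : L.range.topologicalClosure = ⊤ := by
    rw [Submodule.topologicalClosure_eq_top_iff, Submodule.eq_bot_iff]
    intro z hz
    rw [Submodule.mem_orthogonal] at hz
    refine hG.range s hs z fun p hp => ?_
    exact hz _ ⟨⟨p, Submodule.le_topologicalClosure _ hp⟩, rfl⟩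
  have hy : y ∈ closure (Set.range L) := by
    have : y ∈ (L.range.topologicalClosure : Set E) := by rw [htop]; trivial
    exact this
  rw [hclosed.closure_eq] at hy
  obtain ⟨p, hp⟩ := hy
  exact ⟨p.1, p.2, hp⟩

/-- The resolvent `(A + is)⁻¹` of the closure of the operator. -/
theorem exists_resolvent (hG : IsEssentiallySelfAdjointGraph G) :
    ∃ Res : ℝ → E →L[ℂ] E, ∀ s : ℝ, s ≠ 0 →
      (∀ y, (Res s y, y - (Complex.I * s) • Res s y) ∈ G.topologicalClosure) ∧
      (∀ y, ‖Res s y‖ ≤ |s|⁻¹ * ‖y‖) ∧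
      ∀ p ∈ G.topologicalClosure, Res s (p.2 + (Complex.I * s) • p.1) = p.1 := by
  have : ∀ s : ℝ, ∃ T : E →L[ℂ] E, s ≠ 0 →
      (∀ y, (T y, y - (Complex.I * s) • T y) ∈ G.topologicalClosure) ∧
      (∀ y, ‖T y‖ ≤ |s|⁻¹ * ‖y‖) ∧
      ∀ p ∈ G.topologicalClosure, T (p.2 + (Complex.I * s) • p.1) = p.1 := by
    intro s
    by_cases hs : s = 0
    · exact ⟨0, fun h => absurd hs h⟩
    have hs' : 0 < |s| := abs_pos.2 hs
    choose f hf1 hf2 using hG.exists_mem_closure hs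
    have key : ∀ p ∈ G.topologicalClosure, (f (p.2 + (Complex.I * s) • p.1)).1 = p.1 :=
      fun p hp => hG.eq_of_add_eq hs (hf1 _) hp (hf2 _)
    let Tl : E →ₗ[ℂ] E :=
      { toFun := fun y => (f y).1
        map_add' := fun x y => by
          refine (hG.eq_of_add_eq hs (hf1 _) (Submodule.add_mem _ (hf1 x) (hf1 y)) ?_).trans rfl
          rw [hf2, Prod.fst_add, Prod.snd_add, smul_add]
          nth_rewrite 1 [← hf2 x, ← hf2 y]; abel
        map_smul' := fun c x => by
          refine (hG.eq_of_add_eq hs (hf1 _) (Submodule.smul_mem _ c (hf1 x)) ?_).trans rfl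
          rw [hf2, Prod.smul_fst, Prod.smul_snd, smul_comm _ c, ← smul_add, hf2] }
    have hbd : ∀ y, ‖Tl y‖ ≤ |s|⁻¹ * ‖y‖ := by
      intro y
      have := hG.norm_fst_le s (hf1 y)
      rw [hf2] at this
      rw [inv_mul_eq_div, le_div_iff₀ hs', mul_comm]
      exact this
    refine ⟨Tl.mkContinuous _ hbd, fun _ => ⟨fun y => ?_, hbd, key⟩⟩
    have h3 : y - (Complex.I * s) • (f y).1 = (f y).2 := by
      nth_rewrite 1 [← hf2 y]; abel
    change ((f y).1, y - (Complex.I * s) • (f y).1) ∈ _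
    rw [h3]
    exact hf1 y
  choose T hT using this
  exact ⟨T, hT⟩

end IsEssentiallySelfAdjointGraph

end Stone

section Stone

variable {E : Type u} [NormedAddCommGroup E] [InnerProductSpace ℂ E]

/-- If two unitary groups are generated by the same graph and the first one leaves the graph of the
closure invariant, they are equal. -/
theorem IsUnitaryGroupGeneratedBy.unique [CompleteSpace E] {G : Submodule ℂ (E × E)}
    {U V : ℝ → E →L[ℂ] E} (hU : IsUnitaryGroupGeneratedBy G U)
    (hV : IsUnitaryGroupGeneratedBy G V) (hG : IsEssentiallySelfAdjointGraph G)
    (hinv : ∀ (t : ℝ), ∀ p ∈ G.topologicalClosure, (U t p.1, U t p.2) ∈ G.topologicalClosure) :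
    V = U := by
  have hV' : ∀ x, Continuous fun t => V (-t) x := fun x => (hV.continuous x).comp continuous_neg
  -- `s ↦ V(-s) U(s) x` is constant for `x` in the domain, as `U(s) x` stays in the domain
  have key : ∀ p ∈ G, ∀ t, V t p.1 = U t p.1 := by
    intro p hp t
    have hd : ∀ s, HasDerivAt (fun r => V (-r) (U r p.1)) 0 s := by
      intro s
      have h1 := hU.hasDerivAt_of_mem hp s
      have h2 := hV.hasDerivAt_of_mem_closure
        (hinv s p (Submodule.le_topologicalClosure _ hp)) (-s)
      have h3 := HasDerivAt.scomp s h2 (hasDerivAt_neg s)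
      have h4 := HasDerivAt.strong_apply (U := fun r => V (-r)) hV'
        (fun r x => hV.norm_le _ x) (y := fun r => U r p.1) h3 h1
      convert h4 using 1
      simp
    have := is_const_of_deriv_eq_zero (fun s => (hd s).differentiableAt)
      (fun s => (hd s).deriv) t 0
    simp only [neg_zero, hV.zero, hU.zero, one_apply_eq_self] at this
    have h5 := congrArg (V t) this
    rw [hV.apply_neg] at h5
    exact h5.symm
  funext t
  ext y
  rw [← sub_eq_zero, ← hV.neg_apply (-t) (V t y - U t y)]
  have : V (-t) (V t y - U t y) = 0 := by
    refine hG.dense _ fun p hp => ?_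
    have h1 : V t p.1 = U t p.1 := key p hp t
    rw [map_sub, hV.neg_apply, inner_sub_right]
    have h2 : ⟪p.1, V (-t) (U t y)⟫_ℂ = ⟪V t p.1, U t y⟫_ℂ := (hV.inner_left t _ _).symm
    rw [h2, h1, hU.inner_map_map, sub_self]
  rw [this, map_zero]

/-- The bounded Yosida approximations: commuting skew-adjoint operators `B n` which converge to
`-iA` on the domain of the closure of the operator `A`, together with one resolvent of `A`
commuting with all of them. -/
theorem IsEssentiallySelfAdjointGraph.exists_yosida [CompleteSpace E] {G : Submodule ℂ (E × E)}
    (hG : IsEssentiallySelfAdjointGraph G) :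
    ∃ (B : ℕ → E →L[ℂ] E) (T : E →L[ℂ] E),
      (∀ n, star (B n) = -B n) ∧ (∀ m n, Commute (B m) (B n)) ∧ (∀ n, Commute T (B n)) ∧
      (∀ y, (T y, y - Complex.I • T y) ∈ G.topologicalClosure) ∧
      (∀ p ∈ G.topologicalClosure, T (p.2 + Complex.I • p.1) = p.1) ∧
      ∀ p ∈ G.topologicalClosure,
        Tendsto (fun n => B n p.1) atTop (𝓝 (-(Complex.I • p.2))) := by
  obtain ⟨Res, hRes⟩ := hG.exists_resolvent
  -- the first resolvent identity
  have hres_id : ∀ s t : ℝ, s ≠ 0 → t ≠ 0 → ∀ y,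
      Res t y - Res s y = (Complex.I * (s - t : ℂ)) • Res s (Res t y) := by
    intro s t hs ht y
    have h1 := (hRes s hs).2.2 _ ((hRes t ht).1 y)
    have h2 : y - (Complex.I * t) • Res t y + (Complex.I * s) • Res t y =
        y + (Complex.I * (s - t : ℂ)) • Res t y := by
      rw [mul_sub, sub_smul]; abel
    simp only [h2, map_add, map_smul] at h1
    exact sub_eq_iff_eq_add'.2 h1.symm
  have hcomm : ∀ s t : ℝ, s ≠ 0 → t ≠ 0 → Commute (Res s) (Res t) := by
    intro s t hs ht
    by_cases hst : s = t
    · rw [hst]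
    ext y
    simp only [mul_apply_eq_comp]
    have h1 := hres_id s t hs ht y
    have h2 := hres_id t s ht hs y
    have h3 : (Complex.I * (s - t : ℂ)) • Res s (Res t y) =
        (Complex.I * (s - t : ℂ)) • Res t (Res s y) := by
      rw [← h1, ← neg_sub, h2, ← neg_smul, ← mul_neg, neg_sub]
    have h4 : (Complex.I * (s - t : ℂ)) ≠ 0 := by
      refine mul_ne_zero Complex.I_ne_zero (sub_ne_zero.2 ?_)
      exact_mod_cast hst
    exact smul_right_injective E h4 h3
  have hadj : ∀ s : ℝ, s ≠ 0 → star (Res s) = Res (-s) := by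
    intro s hs
    rw [ContinuousLinearMap.star_eq_adjoint]
    symm
    rw [ContinuousLinearMap.eq_adjoint_iff]
    intro x y
    have h := hG.symm_closure _ ((hRes (-s) (neg_ne_zero.2 hs)).1 x) _ ((hRes s hs).1 y)
    simp only [inner_sub_left, inner_sub_right, inner_smul_left, inner_smul_right] at h
    simp only [Complex.ofReal_neg, mul_neg, map_neg, map_mul, Complex.conj_I, Complex.conj_ofReal]
      at h
    linear_combination -h
  let N : ℕ → ℝ := fun n => (n : ℝ) + 1
  have hN : ∀ n, N n ≠ 0 := fun n => by positivity
  have hN' : ∀ n, -N n ≠ 0 := fun n => neg_ne_zero.2 (hN n)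
  -- In the functional calculus `B n = -i A N² / (A² + N²)` and `Jn n = N² / (A² + N²)`, written in
  -- terms of the resolvents `(A ± iN)⁻¹`; thus `B n = -i (Jn n) A` on the domain of `A`.
  let B : ℕ → E →L[ℂ] E := fun n => (-(Complex.I * ((N n : ℂ) ^ 2 / 2))) • (Res (N n) + Res (-N n))
  let Jn : ℕ → E →L[ℂ] E := fun n => (Complex.I * ((N n : ℂ) / 2)) • (Res (N n) - Res (-N n))
  have hRp : ∀ n, ∀ p ∈ G.topologicalClosure,
      (Complex.I * N n) • Res (N n) p.1 = p.1 - Res (N n) p.2 ∧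
      (Complex.I * N n) • Res (-N n) p.1 = Res (-N n) p.2 - p.1 := by
    intro n p hp
    have h1 := (hRes _ (hN n)).2.2 p hp
    have h2 := (hRes _ (hN' n)).2.2 p hp
    simp only [map_add, map_smul, Complex.ofReal_neg, mul_neg, neg_smul, map_neg] at h1 h2
    constructor
    · nth_rewrite 2 [← h1]; abel
    · nth_rewrite 2 [← h2]; abel
  have hBJ : ∀ n, ∀ p ∈ G.topologicalClosure, B n p.1 = -(Complex.I • Jn n p.2) := by
    intro n p hp
    obtain ⟨h1, h2⟩ := hRp n p hp
    have e1 : B n p.1 = (-((N n : ℂ) / 2)) •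
        ((Complex.I * N n) • Res (N n) p.1 + (Complex.I * N n) • Res (-N n) p.1) := by
      change (-(Complex.I * ((N n : ℂ) ^ 2 / 2))) • (Res (N n) p.1 + Res (-N n) p.1) = _
      rw [← smul_add, smul_smul]; congr 1; ring
    have e2 : -(Complex.I • Jn n p.2) = ((N n : ℂ) / 2) • (Res (N n) p.2 - Res (-N n) p.2) := by
      change -(Complex.I • ((Complex.I * ((N n : ℂ) / 2)) • (Res (N n) p.2 - Res (-N n) p.2))) = _
      rw [smul_smul, ← neg_smul]; congr 1; linear_combination -((N n : ℂ) / 2) * Complex.I_mul_I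
    rw [e1, e2, h1, h2, neg_smul, ← smul_neg]; congr 1; abel
  have hJ1 : ∀ n x, ‖Jn n x‖ ≤ ‖x‖ := by
    intro n x
    have hpos : 0 < N n := by positivity
    have h1 := (hRes _ (hN n)).2.1 x
    have h2 := (hRes _ (hN' n)).2.1 x
    rw [abs_neg] at h2
    rw [abs_of_pos hpos] at h1 h2
    change ‖(Complex.I * ((N n : ℂ) / 2)) • (Res (N n) x - Res (-N n) x)‖ ≤ _
    rw [norm_smul]
    have h3 : ‖(Complex.I * ((N n : ℂ) / 2))‖ = N n / 2 := by
      simp [abs_of_pos hpos]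
    rw [h3]
    calc N n / 2 * ‖Res (N n) x - Res (-N n) x‖
        ≤ N n / 2 * ((N n)⁻¹ * ‖x‖ + (N n)⁻¹ * ‖x‖) := by
          gcongr; exact (norm_sub_le _ _).trans (add_le_add h1 h2)
      _ = ‖x‖ := by field_simp; ring
  have hinvlim : Tendsto (fun n => (N n)⁻¹) atTop (𝓝 0) :=
    (tendsto_one_div_add_atTop_nhds_zero_nat (𝕜 := ℝ)).congr fun n => by simp [N]
  -- `Jn n` tends strongly to the identity: at the rate `1 / N` on the domain, and then everywhere
  -- since the `Jn n` are contractions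
  have hJ2 : ∀ p ∈ G.topologicalClosure, Tendsto (fun n => Jn n p.1) atTop (𝓝 p.1) := by
    intro p hp
    rw [tendsto_iff_norm_sub_tendsto_zero]
    refine squeeze_zero (fun _ => norm_nonneg _) (fun n => ?_)
      (by simpa using hinvlim.mul_const ‖p.2‖)
    have hpos : 0 < N n := by positivity
    have h1 := (hRes _ (hN n)).2.1 p.2
    have h2 := (hRes _ (hN' n)).2.1 p.2
    rw [abs_neg] at h2
    rw [abs_of_pos hpos] at h1 h2
    obtain ⟨h3, h4⟩ := hRp n p hp
    have e1 : Jn n p.1 = (1 / 2 : ℂ) •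
        ((Complex.I * N n) • Res (N n) p.1 - (Complex.I * N n) • Res (-N n) p.1) := by
      change (Complex.I * ((N n : ℂ) / 2)) • (Res (N n) p.1 - Res (-N n) p.1) = _
      rw [← smul_sub, smul_smul]; congr 1; ring
    have e2 : Jn n p.1 - p.1 = (-(1 / 2) : ℂ) • (Res (N n) p.2 + Res (-N n) p.2) := by
      rw [e1, h3, h4]; module
    rw [e2, norm_smul]
    calc ‖(-(1 / 2) : ℂ)‖ * ‖Res (N n) p.2 + Res (-N n) p.2‖
        ≤ ‖(-(1 / 2) : ℂ)‖ * ((N n)⁻¹ * ‖p.2‖ + (N n)⁻¹ * ‖p.2‖) := by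
          gcongr; exact (norm_add_le _ _).trans (add_le_add h1 h2)
      _ = (N n)⁻¹ * ‖p.2‖ := by norm_num; ring
  have hdense := hG.dense_domain
  have hJ3 : ∀ x, Tendsto (fun n => Jn n x) atTop (𝓝 x) := by
    intro x
    rw [Metric.tendsto_atTop]
    intro ε hε
    obtain ⟨_, ⟨p, hp, rfl⟩, hpx⟩ := hdense.exists_dist_lt x (show 0 < ε / 3 by positivity)
    obtain ⟨n0, hn0⟩ := Metric.tendsto_atTop.1 (hJ2 p (Submodule.le_topologicalClosure _ hp))
      (ε / 3) (by positivity)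
    refine ⟨n0, fun n hn => ?_⟩
    have h1 : dist (Jn n x) (Jn n p.1) ≤ dist x p.1 := by
      rw [dist_eq_norm, dist_eq_norm, ← map_sub]; exact hJ1 n _
    calc dist (Jn n x) x ≤ dist (Jn n x) (Jn n p.1) + dist (Jn n p.1) p.1 + dist p.1 x :=
          dist_triangle4 _ _ _ _
      _ < ε / 3 + ε / 3 + ε / 3 := by
          rw [dist_comm p.1 x]
          exact add_lt_add (add_lt_add (h1.trans_lt hpx) (hn0 n hn)) hpx
      _ = ε := by ring
  have hcomm' : ∀ s n, s ≠ 0 → Commute (Res s) (B n) := fun s n hs =>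
    ((hcomm s _ hs (hN n)).add_right (hcomm s _ hs (hN' n))).smul_right _
  refine ⟨B, Res 1, fun n => ?_, fun m n => ?_, fun n => hcomm' 1 n one_ne_zero, fun y => ?_,
    fun p hp => ?_, fun p hp => ?_⟩
  · change star ((-(Complex.I * ((N n : ℂ) ^ 2 / 2))) • (Res (N n) + Res (-N n))) =
      -((-(Complex.I * ((N n : ℂ) ^ 2 / 2))) • (Res (N n) + Res (-N n)))
    rw [star_smul, star_add, hadj _ (hN n), hadj _ (hN' n), neg_neg, add_comm, ← neg_smul]
    congr 1
    simp
  · exact ((hcomm' _ n (hN m)).add_left (hcomm' _ n (hN' m))).smul_left _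
  · simpa using (hRes 1 one_ne_zero).1 y
  · simpa using (hRes 1 one_ne_zero).2.2 p hp
  · exact (((hJ3 p.2).const_smul Complex.I).neg).congr fun n => (hBJ n p hp).symm

/-- **Stone's theorem**: an essentially self-adjoint operator generates a unitary group, which
leaves the graph of the closure of the operator invariant. -/
theorem IsEssentiallySelfAdjointGraph.exists_group [CompleteSpace E] {G : Submodule ℂ (E × E)}
    (hG : IsEssentiallySelfAdjointGraph G) :
    ∃ U : ℝ → E →L[ℂ] E, IsUnitaryGroupGeneratedBy G U ∧
      ∀ (t : ℝ), ∀ p ∈ G.topologicalClosure, (U t p.1, U t p.2) ∈ G.topologicalClosure := by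
  let _ : NormedAlgebra ℚ (E →L[ℂ] E) := NormedAlgebra.restrictScalars ℚ ℝ _
  obtain ⟨B, T, hskew, hcomm, hT, hT1, hT2, hlim⟩ := hG.exists_yosida
  let Un : ℕ → ℝ → E →L[ℂ] E := fun n t => NormedSpace.exp (t • B n)
  have hdense := hG.dense_domain
  have hiso : ∀ n t x, ‖Un n t x‖ = ‖x‖ := fun n t x => norm_exp_smul_apply (hskew n) t x
  -- By Duhamel's estimate the approximating groups converge on the domain, hence everywhere because
  -- they are isometric.
  have hcauchy : ∀ t x, CauchySeq fun n => Un n t x := by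
    intro t x
    rw [Metric.cauchySeq_iff]
    intro ε hε
    obtain ⟨_, ⟨p, hp, rfl⟩, hpx⟩ := hdense.exists_dist_lt x (show 0 < ε / 3 by positivity)
    have hc := (hlim p (Submodule.le_topologicalClosure _ hp)).cauchySeq
    obtain ⟨n0, hn0⟩ := Metric.cauchySeq_iff.1 hc (ε / (3 * (|t| + 1))) (by positivity)
    refine ⟨n0, fun m hm n hn => ?_⟩
    have h1 : ∀ k, dist (Un k t x) (Un k t p.1) = dist x p.1 := by
      intro k
      rw [dist_eq_norm, dist_eq_norm, ← map_sub, hiso]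
    have h2 : dist (Un m t p.1) (Un n t p.1) ≤ dist (B m p.1) (B n p.1) * |t| := by
      rw [dist_eq_norm, dist_eq_norm]
      exact norm_exp_smul_sub_exp_smul_le (hskew m) (hskew n) (hcomm m n) t _
    have h3 : dist (B m p.1) (B n p.1) * |t| ≤ ε / 3 := by
      calc dist (B m p.1) (B n p.1) * |t| ≤ ε / (3 * (|t| + 1)) * (|t| + 1) := by
            gcongr
            · exact (hn0 m hm n hn).le
            · linarith
        _ = ε / 3 := by field_simp
    calc dist (Un m t x) (Un n t x)
        ≤ dist (Un m t x) (Un m t p.1) + dist (Un m t p.1) (Un n t p.1) +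
          dist (Un n t p.1) (Un n t x) := dist_triangle4 _ _ _ _
      _ < ε / 3 + ε / 3 + ε / 3 := by
          rw [dist_comm (Un n t p.1), h1, h1]
          exact add_lt_add (add_lt_add_of_lt_of_le hpx (h2.trans h3)) hpx
      _ = ε := by ring
  choose L hL using fun t x => cauchySeq_tendsto_of_complete (hcauchy t x)
  let U : ℝ → E →L[ℂ] E := fun t =>
    LinearMap.mkContinuous
      { toFun := L t
        map_add' := fun x y => tendsto_nhds_unique (hL t (x + y))
          (by simpa using (hL t x).add (hL t y))
        map_smul' := fun c x => tendsto_nhds_unique (hL t (c • x))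
          (by simpa using (hL t x).const_smul c) } 1 (fun x => by
        rw [one_mul]
        exact le_of_tendsto (hL t x).norm (Eventually.of_forall fun n => (hiso n t x).le))
  have hU : ∀ t x, Tendsto (fun n => Un n t x) atTop (𝓝 (U t x)) := hL
  have hUiso : ∀ t x, ‖U t x‖ = ‖x‖ := fun t x =>
    tendsto_nhds_unique (hU t x).norm (by simp [hiso])
  -- on the domain the limit is Lipschitz continuous in time, which gives strong continuity
  have hlip : ∀ p ∈ G, ∀ s t, ‖U t p.1 - U s p.1‖ ≤ ‖p.2‖ * |t - s| := by
    intro p hp s t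
    have h1 := ((hU t p.1).sub (hU s p.1)).norm
    have h2 := ((hlim p (Submodule.le_topologicalClosure _ hp)).norm).mul_const |t - s|
    rw [norm_neg, norm_smul, Complex.norm_I, one_mul] at h2
    refine le_of_tendsto_of_tendsto' h1 h2 fun n => ?_
    have h3 : Un n t = Un n s * NormedSpace.exp ((t - s) • B n) := by
      rw [← NormedSpace.exp_add_of_commute, ← add_smul, add_sub_cancel]
      exact ((Commute.refl _).smul_left _).smul_right _
    rw [h3, mul_apply_eq_comp, ← map_sub, hiso]
    exact norm_exp_smul_sub_le (hskew n) _ _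
  have hcont : ∀ x, Continuous fun t => U t x := by
    intro x
    rw [Metric.continuous_iff]
    intro s ε hε
    obtain ⟨_, ⟨p, hp, rfl⟩, hpx⟩ := hdense.exists_dist_lt x (show 0 < ε / 3 by positivity)
    refine ⟨ε / (3 * (‖p.2‖ + 1)), by positivity, fun t ht => ?_⟩
    have h1 : ∀ r, dist (U r x) (U r p.1) = dist x p.1 := by
      intro r
      rw [dist_eq_norm, dist_eq_norm, ← map_sub, hUiso]
    have h2 : dist (U t p.1) (U s p.1) ≤ ε / 3 := by
      rw [dist_eq_norm]
      rw [Real.dist_eq] at ht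
      calc ‖U t p.1 - U s p.1‖ ≤ ‖p.2‖ * |t - s| := hlip p hp s t
        _ ≤ (‖p.2‖ + 1) * (ε / (3 * (‖p.2‖ + 1))) := by
            gcongr
            linarith
        _ = ε / 3 := by field_simp
    calc dist (U t x) (U s x)
        ≤ dist (U t x) (U t p.1) + dist (U t p.1) (U s p.1) + dist (U s p.1) (U s x) :=
          dist_triangle4 _ _ _ _
      _ < ε / 3 + ε / 3 + ε / 3 := by
          rw [dist_comm (U s p.1), h1, h1]
          exact add_lt_add (add_lt_add_of_lt_of_le hpx h2) hpx
      _ = ε := by ring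
  have hUcomm : ∀ t x, U t (T x) = T (U t x) := by
    intro t x
    refine tendsto_nhds_unique (hU t (T x)) ?_
    have h1 := (T.continuous.tendsto _).comp (hU t x)
    refine h1.congr fun n => ?_
    have h2 : Commute T (Un n t) := ((hT n).smul_right t).exp_right
    exact DFunLike.congr_fun h2.eq x
  refine ⟨U, ⟨?_, ?_, hUiso, hcont, ?_⟩, ?_⟩
  · ext x
    refine tendsto_nhds_unique (hU 0 x) ?_
    simp [Un, NormedSpace.exp_zero]
  · intro s t
    ext x
    refine tendsto_nhds_unique (hU (s + t) x) ?_
    have h1 : Tendsto (fun n => Un n s (Un n t x - U t x)) atTop (𝓝 0) := by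
      rw [tendsto_zero_iff_norm_tendsto_zero]
      simp only [hiso]
      exact tendsto_iff_norm_sub_tendsto_zero.1 (hU t x)
    have h2 := h1.add (hU s (U t x))
    rw [zero_add] at h2
    refine h2.congr fun n => ?_
    have h3 : Un n (s + t) = Un n s * Un n t := by
      simp only [Un]
      rw [← NormedSpace.exp_add_of_commute, add_smul]
      exact ((Commute.refl _).smul_left _).smul_right _
    rw [h3, mul_apply_eq_comp, map_sub, sub_add_cancel]
  · intro p hp
    -- pass to the limit in the integrated equation of the approximating groups
    have hint : ∀ t, U t p.1 - p.1 = ∫ s in (0 : ℝ)..t, -(Complex.I • U s p.2) := by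
      intro t
      have hbp := hlim p (Submodule.le_topologicalClosure _ hp)
      obtain ⟨M, hM⟩ := hbp.norm.bddAbove_range
      have hM' : ∀ n, ‖B n p.1‖ ≤ M := fun n => hM ⟨n, rfl⟩
      have h1 : Tendsto (fun n => ∫ s in (0 : ℝ)..t, Un n s (B n p.1)) atTop
          (𝓝 (∫ s in (0 : ℝ)..t, -(Complex.I • U s p.2))) := by
        refine intervalIntegral.tendsto_integral_filter_of_dominated_convergence (fun _ => M)
          ?_ ?_ ?_ ?_
        · refine Eventually.of_forall fun n => Continuous.aestronglyMeasurable ?_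
          exact continuous_iff_continuousAt.2 fun s =>
            (hasDerivAt_exp_smul_apply (B n) (B n p.1) s).continuousAt
        · refine Eventually.of_forall fun n => ae_of_all _ fun s _ => ?_
          rw [hiso]; exact hM' n
        · exact intervalIntegrable_const
        · refine ae_of_all _ fun s _ => ?_
          have h2 : Tendsto (fun n => Un n s (B n p.1 - -(Complex.I • p.2))) atTop (𝓝 0) := by
            rw [tendsto_zero_iff_norm_tendsto_zero]
            simp only [hiso]
            exact tendsto_iff_norm_sub_tendsto_zero.1 hbp
          have h3 := h2.add (hU s (-(Complex.I • p.2)))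
          simpa using h3
      refine tendsto_nhds_unique ((hU t p.1).sub_const p.1) (h1.congr fun n => ?_)
      rw [intervalIntegral.integral_eq_sub_of_hasDerivAt
        (fun s _ => hasDerivAt_exp_smul_apply (B n) p.1 s)]
      · simp [Un, NormedSpace.exp_zero]
      · refine Continuous.intervalIntegrable ?_ _ _
        exact continuous_iff_continuousAt.2 fun s =>
          (hasDerivAt_exp_smul_apply (B n) (B n p.1) s).continuousAt
    have h1 : (fun s => U s p.1) = fun s => p.1 + ∫ r in (0 : ℝ)..s, -(Complex.I • U r p.2) := by
      funext s
      rw [← hint s]; abel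
    rw [h1]
    have hc : Continuous fun r => -(Complex.I • U r p.2) := by
      have := hcont p.2; fun_prop
    have h0 : U 0 p.2 = p.2 := by
      refine tendsto_nhds_unique (hU 0 _) ?_
      simp [Un, NormedSpace.exp_zero]
    have := (intervalIntegral.integral_hasDerivAt_right (hc.intervalIntegrable 0 0)
      (hc.stronglyMeasurableAtFilter _ _) hc.continuousAt).const_add p.1
    rwa [h0] at this
  · intro t p hp
    -- `U t` commutes with the resolvent `T`, whose range is the domain of the closure
    have h1 := hT1 (U t (p.2 + Complex.I • p.1))
    rw [← hUcomm, hT2 p hp] at h1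
    simpa using h1

theorem IsEssentiallySelfAdjointGraph.existsUnique [CompleteSpace E] {G : Submodule ℂ (E × E)}
    (hG : IsEssentiallySelfAdjointGraph G) :
    ∃! U : ℝ → E →L[ℂ] E, IsUnitaryGroupGeneratedBy G U := by
  obtain ⟨U, hU, hinv⟩ := hG.exists_group
  exact ⟨U, hU, fun V hV => hU.unique hV hG hinv⟩

theorem IsEssentiallySelfAdjointGraph.isUnitaryGroup [CompleteSpace E]
    {G : Submodule ℂ (E × E)} (hG : IsEssentiallySelfAdjointGraph G) :
    IsUnitaryGroupGeneratedBy G (unitaryGroup G) := by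
  have h := hG.existsUnique
  have : unitaryGroup G = h.choose := by
    funext t
    simp [unitaryGroup, h]
  rw [this]
  exact h.choose_spec.1

theorem IsEssentiallySelfAdjointGraph.unitaryGroup_mem [CompleteSpace E]
    {G : Submodule ℂ (E × E)} (hG : IsEssentiallySelfAdjointGraph G) (t : ℝ) {p : E × E}
    (hp : p ∈ G.topologicalClosure) :
    (unitaryGroup G t p.1, unitaryGroup G t p.2) ∈ G.topologicalClosure := by
  obtain ⟨U, hU, hinv⟩ := hG.exists_group
  rw [hU.unique hG.isUnitaryGroup hG hinv]
  exact hinv t p hp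

/-- A self-adjoint operator has an essentially self-adjoint graph. -/
theorem IsSelfAdjoint.isEssentiallySelfAdjointGraph [CompleteSpace E] {A : E →ₗ.[ℂ] E}
    (hA : IsSelfAdjoint A) : IsEssentiallySelfAdjointGraph A.graph := by
  have hd := hA.dense_domain
  have hgr : A.graph.adjoint = A.graph := by
    rw [← LinearPMap.adjoint_graph_eq_graph_adjoint hd, LinearPMap.isSelfAdjoint_def.1 hA]
  have hsymm : ∀ p ∈ A.graph, ∀ q ∈ A.graph, ⟪p.2, q.1⟫_ℂ = ⟪p.1, q.2⟫_ℂ := by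
    intro p hp q hq
    rw [← hgr] at hq
    exact sub_eq_zero.1 ((Submodule.mem_adjoint_iff _ _).1 hq p.1 p.2 hp)
  refine ⟨hsymm, fun y hy => ?_, fun s hs y hy => ?_⟩
  · refine hd.eq_zero_of_inner_right ℂ fun x hx => ?_
    exact hy _ (A.mem_graph ⟨x, hx⟩)
  · have hmem : (y, (Complex.I * s) • y) ∈ A.graph := by
      rw [← hgr, Submodule.mem_adjoint_iff]
      intro a b hab
      have := hy _ hab
      rw [inner_add_left, inner_smul_left] at this
      rw [inner_smul_right]
      simp only [map_mul, Complex.conj_I, Complex.conj_ofReal] at this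
      linear_combination this
    have h1 := hsymm _ hmem _ hmem
    rw [inner_smul_left, inner_smul_right] at h1
    simp only [map_mul, Complex.conj_I, Complex.conj_ofReal] at h1
    have h2 : (2 * Complex.I * s) * ⟪y, y⟫_ℂ = 0 := by linear_combination -h1
    have h3 : (2 * Complex.I * s : ℂ) ≠ 0 := by simp [hs]
    exact inner_self_eq_zero.1 ((mul_eq_zero.1 h2).resolve_left h3)

end Stone

/-! ### Symmetric tensors -/

section SymmetricTensors

variable {R : Type u} [NormedAddCommGroup R] [InnerProductSpace ℂ R]

theorem inner_elemTensor : ∀ (n : ℕ) (f g : Fin n → R),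
    ⟪elemTensor n f, elemTensor n g⟫_ℂ = ∏ i, ⟪f i, g i⟫_ℂ
  | 0, f, g => by
    change ⟪(EuclideanSpace.single PUnit.unit (1 : ℂ) : EuclideanSpace ℂ PUnit.{u + 1}),
      EuclideanSpace.single PUnit.unit (1 : ℂ)⟫_ℂ = _
    simp
  | n + 1, f, g => by
    rw [Fin.prod_univ_succ]
    change ⟪(f 0) ⊗ₜ[ℂ] (elemTensor n (Fin.tail f)), (g 0) ⊗ₜ[ℂ] (elemTensor n (Fin.tail g))⟫_ℂ = _
    rw [TensorProduct.inner_tmul, inner_elemTensor n]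
    rfl

theorem norm_elemTensor (n : ℕ) (f : Fin n → R) : ‖elemTensor n f‖ = ∏ i, ‖f i‖ := by
  have h : ‖elemTensor n f‖ ^ 2 = (∏ i, ‖f i‖) ^ 2 := by
    have h1 := inner_elemTensor n f f
    simp only [inner_self_eq_norm_sq_to_K] at h1
    rw [← Finset.prod_pow]
    exact_mod_cast h1
  exact (sq_eq_sq₀ (norm_nonneg _) (Finset.prod_nonneg fun i _ => norm_nonneg _)).1 h

/-- The symmetrized elementary tensor in the algebraic tensor power. -/
noncomputable def algSymTensor (n : ℕ) (f : Fin n → R) : (algTensorPower R n).carrier :=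
  ((n.factorial : ℂ)⁻¹) • ∑ σ : Equiv.Perm (Fin n), elemTensor n fun i => f (σ i)

theorem symTensor_eq_coe (n : ℕ) (f : Fin n → R) :
    symTensor R n f = (algSymTensor n f : HilbertTensorPower R n) := by
  simp only [symTensor, LinearMap.compMultilinearMap_apply, smul_apply,
    sum_apply, MultilinearMap.domDomCongr_apply, algSymTensor]
  rfl

theorem algSymTensor_perm (n : ℕ) (f : Fin n → R) (ρ : Equiv.Perm (Fin n)) :
    algSymTensor n (fun i => f (ρ i)) = algSymTensor n f := by
  unfold algSymTensor
  congr 1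
  exact Fintype.sum_equiv (Equiv.mulLeft ρ) _ _ fun σ => rfl

theorem inner_algSymTensor_elemTensor_perm (n : ℕ) (f g : Fin n → R) (ρ : Equiv.Perm (Fin n)) :
    ⟪algSymTensor n f, elemTensor n fun i => g (ρ i)⟫_ℂ = ⟪algSymTensor n f, elemTensor n g⟫_ℂ := by
  unfold algSymTensor
  simp only [inner_smul_left, sum_inner, inner_elemTensor]
  congr 1
  refine Fintype.sum_equiv (Equiv.mulRight ρ⁻¹) _ _ fun σ => ?_
  exact Fintype.prod_equiv ρ _ _ fun i => by simp

theorem inner_algSymTensor_algSymTensor (n : ℕ) (f g : Fin n → R) :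
    ⟪algSymTensor n f, algSymTensor n g⟫_ℂ = ⟪algSymTensor n f, elemTensor n g⟫_ℂ := by
  conv_lhs => rw [algSymTensor.eq_def n g]
  rw [inner_smul_right, inner_sum]
  simp only [inner_algSymTensor_elemTensor_perm]
  rw [Finset.sum_const, Finset.card_univ, Fintype.card_perm, Fintype.card_fin, nsmul_eq_mul,
    ← mul_assoc, inv_mul_cancel₀ (by exact_mod_cast n.factorial_ne_zero), one_mul]

theorem norm_algSymTensor_le (n : ℕ) (f : Fin n → R) : ‖algSymTensor n f‖ ≤ ∏ i, ‖f i‖ := by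
  have h : ‖algSymTensor n f‖ * ‖algSymTensor n f‖ ≤ ‖algSymTensor n f‖ * ∏ i, ‖f i‖ := by
    have h1 : ‖⟪algSymTensor n f, algSymTensor n f⟫_ℂ‖ =
      ‖algSymTensor n f‖ * ‖algSymTensor n f‖ := by
      rw [inner_self_eq_norm_sq_to_K]
      simp [sq]
    rw [← h1, inner_algSymTensor_algSymTensor, ← norm_elemTensor]
    exact norm_inner_le_norm _ _
  rcases (norm_nonneg (algSymTensor n f)).eq_or_lt with h0 | h0
  · rw [← h0]; exact Finset.prod_nonneg fun i _ => norm_nonneg _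
  · exact le_of_mul_le_mul_left h h0

theorem norm_partialInner_le {𝓚 : Type v} [NormedAddCommGroup 𝓚] [InnerProductSpace ℂ 𝓚]
    {X : Type w} [NormedAddCommGroup X] [InnerProductSpace ℂ X] (u : 𝓚) (z : 𝓚 ⊗[ℂ] X) :
    ‖partialInner X u z‖ ≤ ‖u‖ * ‖z‖ := by
  have h : ‖partialInner X u z‖ = ‖(innerSL ℂ u).rTensor X z‖ :=
    (TensorProduct.lidIsometry ℂ X).norm_map _
  rw [h]
  refine ((innerSL ℂ u).rTensor X).le_of_opNorm_le ?_ z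
  exact (ContinuousLinearMap.norm_rTensor_le _ _).trans (innerSL_apply_norm ℂ u).le

/-- The contraction `⟨g| ⊗ 1` of the first tensor factor. -/
noncomputable def contractFirst (n : ℕ) (g : R) :
    (algTensorPower R (n + 1)).carrier →L[ℂ] (algTensorPower R n).carrier :=
  partialInner (algTensorPower R n).carrier g

theorem contractFirst_elemTensor (n : ℕ) (g : R) (f : Fin (n + 1) → R) :
    contractFirst n g (elemTensor (n + 1) f) = ⟪g, f 0⟫_ℂ • elemTensor n (Fin.tail f) :=
  partialInner_tmul g (f 0) _

theorem inner_contractFirst (n : ℕ) (g : R) (f : Fin n → R)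
    (z : (algTensorPower R (n + 1)).carrier) :
    ⟪contractFirst n g z, elemTensor n f⟫_ℂ = ⟪z, elemTensor (n + 1) (Fin.cons g f)⟫_ℂ := by
  change R ⊗[ℂ] (algTensorPower R n).carrier at z
  change ⟪partialInner (algTensorPower R n).carrier g z, elemTensor n f⟫_ℂ =
    ⟪z, g ⊗ₜ[ℂ] (elemTensor n f)⟫_ℂ
  induction z with
  | zero => simp
  | add x y hx hy => rw [map_add, inner_add_left, inner_add_left, hx, hy]
  | tmul k x =>
    rw [partialInner_tmul, inner_smul_left, TensorProduct.inner_tmul, inner_conj_symm]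

/-- Skipping the entry `p` is, up to a permutation, the same as moving it to the front. -/
theorem exists_perm_succAbove (n : ℕ) (p : Fin (n + 1)) :
    ∃ ρ : Equiv.Perm (Fin n), ∀ i, Equiv.swap 0 p i.succ = p.succAbove (ρ i) := by
  have h : ∀ i : Fin n, ∃ j : Fin n, p.succAbove j = Equiv.swap 0 p i.succ := by
    intro i
    refine Fin.exists_succAbove_eq ?_
    intro hi
    have : i.succ = 0 := by
      apply (Equiv.swap 0 p).injective
      rw [hi, Equiv.swap_apply_left]
    exact Fin.succ_ne_zero i this
  choose r hr using h
  have hinj : Function.Injective r := by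
    intro i j hij
    have h1 := hr i
    rw [hij, hr j] at h1
    exact (Fin.succ_injective n ((Equiv.swap 0 p).injective h1)).symm
  exact ⟨Equiv.ofBijective r (Finite.injective_iff_bijective.1 hinj), fun i => (hr i).symm⟩

/-- The contraction of a symmetrized tensor is the average over the contracted entry. -/
theorem contractFirst_algSymTensor (n : ℕ) (g : R) (f : Fin (n + 1) → R) :
    contractFirst n g (algSymTensor (n + 1) f) =
      ((n : ℂ) + 1)⁻¹ • ∑ j, ⟪g, f j⟫_ℂ • algSymTensor n fun i => f (j.succAbove i) := by
  have hsum : ∑ σ : Equiv.Perm (Fin (n + 1)), contractFirst n g (elemTensor (n + 1) fun i => f (σ i))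
      = ∑ j, ⟪g, f j⟫_ℂ • ∑ τ : Equiv.Perm (Fin n), elemTensor n fun i => f (j.succAbove (τ i)) := by
    -- split the permutations according to the image of `0`
    rw [← (Equiv.Perm.decomposeFin (n := n)).symm.sum_comp, Fintype.sum_prod_type]
    refine Finset.sum_congr rfl fun p _ => ?_
    rw [Finset.smul_sum]
    obtain ⟨ρ, hρ⟩ := exists_perm_succAbove n p
    refine Fintype.sum_equiv (Equiv.mulLeft ρ) _ _ fun τ => ?_
    rw [contractFirst_elemTensor]
    congr 1
    · simp
    · congr 1
      funext i
      change f (Equiv.Perm.decomposeFin.symm (p, τ) i.succ) = _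
      rw [Equiv.Perm.decomposeFin_symm_apply_succ, hρ]
      rfl
  have h1 : contractFirst n g (algSymTensor (n + 1) f) = (((n + 1).factorial : ℂ)⁻¹) •
      ∑ σ : Equiv.Perm (Fin (n + 1)), contractFirst n g (elemTensor (n + 1) fun i => f (σ i)) := by
    rw [algSymTensor, map_smul, map_sum]
  rw [h1, hsum, Finset.smul_sum, Finset.smul_sum]
  refine Finset.sum_congr rfl fun j _ => ?_
  rw [algSymTensor, smul_smul, smul_smul, smul_smul, Nat.factorial_succ]
  congr 1
  push_cast
  rw [mul_inv]
  ring

end SymmetricTensors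

/-! ### Creation and annihilation operators on Fock space -/

section FockOperators

variable {R : Type u} [NormedAddCommGroup R] [InnerProductSpace ℂ R]

/-- The symmetrized elementary tensor as an element of the `n`-particle space. -/
noncomputable def symParticle (n : ℕ) (f : Fin n → R) : nParticleSpace R n :=
  ⟨symTensor R n f, Submodule.le_topologicalClosure _ (Submodule.subset_span ⟨f, rfl⟩)⟩

theorem symVec_eq_single (n : ℕ) (f : Fin n → R) :
    symVec R n f = lp.single 2 n (symParticle n f) := rfl

theorem norm_symVec_le (n : ℕ) (f : Fin n → R) : ‖symVec R n f‖ ≤ ∏ i, ‖f i‖ := by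
  rw [symVec_eq_single, lp.norm_single (by norm_num)]
  change ‖symTensor R n f‖ ≤ _
  rw [symTensor_eq_coe, UniformSpace.Completion.norm_coe]
  exact norm_algSymTensor_le n f

/-- `symVec` as a continuous multilinear map. -/
noncomputable def symVecL (R : Type u) [NormedAddCommGroup R] [InnerProductSpace ℂ R] (n : ℕ) :
    ContinuousMultilinearMap ℂ (fun _ : Fin n => R) (FockSpace R) :=
  (symVec R n).mkContinuous 1 fun f => by rw [one_mul]; exact norm_symVec_le n f

theorem continuous_symVec (n : ℕ) : Continuous fun f : Fin n → R => symVec R n f :=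
  (symVecL R n).cont

theorem symVec_perm (n : ℕ) (f : Fin n → R) (ρ : Equiv.Perm (Fin n)) :
    symVec R n (fun i => f (ρ i)) = symVec R n f := by
  rw [symVec_eq_single, symVec_eq_single]
  congr 1
  apply Subtype.ext
  change symTensor R n _ = symTensor R n f
  rw [symTensor_eq_coe, symTensor_eq_coe, algSymTensor_perm]

theorem inner_symVec_same (n : ℕ) (f g : Fin n → R) :
    ⟪symVec R n f, symVec R n g⟫_ℂ = ⟪algSymTensor n f, algSymTensor n g⟫_ℂ := by
  rw [symVec_eq_single, symVec_eq_single, lp.inner_single_left, lp.single_apply_self]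
  change ⟪symTensor R n f, symTensor R n g⟫_ℂ = _
  rw [symTensor_eq_coe, symTensor_eq_coe, UniformSpace.Completion.inner_coe]

theorem inner_symVec_ne {m n : ℕ} (h : m ≠ n) (f : Fin m → R) (g : Fin n → R) :
    ⟪symVec R m f, symVec R n g⟫_ℂ = 0 := by
  rw [symVec_eq_single, symVec_eq_single, lp.inner_single_left, lp.single_apply_ne _ _ _ h,
    inner_zero_right]

/-- Vectors orthogonal to all symmetrized tensors with entries in a dense set vanish. -/
theorem eq_zero_of_inner_symVec {D : Set R} (hD : Dense D) {x : FockSpace R}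
    (h : ∀ (n : ℕ) (f : Fin n → R), (∀ i, f i ∈ D) → ⟪symVec R n f, x⟫_ℂ = 0) : x = 0 := by
  -- by continuity in the entries the dense set may be replaced by the whole space
  have h1 : ∀ (n : ℕ) (f : Fin n → R), ⟪symVec R n f, x⟫_ℂ = 0 := by
    intro n f
    have hcl : IsClosed {f : Fin n → R | ⟪symVec R n f, x⟫_ℂ = 0} :=
      isClosed_eq ((continuous_symVec n).inner continuous_const) continuous_const
    have hd : Dense (Set.pi Set.univ fun _ : Fin n => D) := dense_pi _ fun _ _ => hD
    have hsub : (Set.pi Set.univ fun _ : Fin n => D) ⊆ {f : Fin n → R | ⟪symVec R n f, x⟫_ℂ = 0} :=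
      fun f hf => h n f fun i => hf i trivial
    have := closure_minimal hsub hcl
    rw [hd.closure_eq] at this
    exact this trivial
  apply lp.ext
  funext n
  have h2 : ∀ y ∈ (nParticleSpace R n : Set (HilbertTensorPower R n)),
      ⟪y, (x n : HilbertTensorPower R n)⟫_ℂ = 0 := by
    have hcl : IsClosed {y : HilbertTensorPower R n | ⟪y, (x n : HilbertTensorPower R n)⟫_ℂ = 0} :=
      isClosed_eq (by fun_prop) (by fun_prop)
    refine closure_minimal ?_ hcl
    intro y hy
    refine Submodule.span_induction (p := fun y _ => ⟪y, (x n : HilbertTensorPower R n)⟫_ℂ = 0)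
      ?_ ?_ ?_ ?_ hy
    · rintro _ ⟨f, rfl⟩
      have := h1 n f
      rw [symVec_eq_single, lp.inner_single_left] at this
      exact this
    · simp
    · intro a b _ _ ha hb
      rw [inner_add_left, ha, hb, add_zero]
    · intro c a _ ha
      rw [inner_smul_left, ha, mul_zero]
  apply Subtype.ext
  exact inner_self_eq_zero.1 (h2 _ (x n).2)

theorem dense_span_symVec :
    Dense (Submodule.span ℂ {x : FockSpace R | ∃ (n : ℕ) (f : Fin n → R), x = symVec R n f} :
      Set (FockSpace R)) := by
  rw [Submodule.dense_iff_topologicalClosure_eq_top, Submodule.topologicalClosure_eq_top_iff,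
    Submodule.eq_bot_iff]
  intro x hx
  rw [Submodule.mem_orthogonal] at hx
  exact eq_zero_of_inner_symVec dense_univ fun n f _ => hx _ (Submodule.subset_span ⟨n, f, rfl⟩)

/-- Bounded operators on Fock space which agree on symmetrized tensors are equal. -/
theorem FockSpace.clm_ext {X : Type*} [NormedAddCommGroup X] [NormedSpace ℂ X]
    {A B : FockSpace R →L[ℂ] X}
    (h : ∀ (n : ℕ) (f : Fin n → R), A (symVec R n f) = B (symVec R n f)) : A = B := by
  refine ContinuousLinearMap.ext_on (dense_span_symVec (R := R)) ?_
  rintro _ ⟨n, f, rfl⟩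
  exact h n f

/-- `⟨g| ⊗ 1` as an operator from the `n + 1`-particle space to the `n`-particle space. -/
noncomputable def contractParticle (n : ℕ) (g : R) :
    nParticleSpace R (n + 1) →L[ℂ] nParticleSpace R n :=
  ((contractFirst n g).completion.comp (nParticleSpace R (n + 1)).subtypeL).codRestrict
    (nParticleSpace R n) (by
      rintro ⟨z, hz⟩
      let L : HilbertTensorPower R (n + 1) →L[ℂ] HilbertTensorPower R n :=
        (contractFirst n g).completion
      have hcl : IsClosed (L ⁻¹' (nParticleSpace R n : Set (HilbertTensorPower R n))) :=
        (Submodule.isClosed_topologicalClosure _).preimage L.continuous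
      have hle : nParticleSpace R (n + 1) ≤ (nParticleSpace R n).comap L.toLinearMap := by
        refine Submodule.topologicalClosure_minimal _ (Submodule.span_le.2 ?_) hcl
        rintro _ ⟨f, rfl⟩
        change (contractFirst n g).completion (symTensor R (n + 1) f) ∈ nParticleSpace R n
        rw [symTensor_eq_coe, ContinuousLinearMap.completion_apply_coe, contractFirst_algSymTensor]
        rw [← UniformSpace.Completion.coe_toComplL (𝕜 := ℂ), map_smul, map_sum]
        refine Submodule.smul_mem _ _ (Submodule.sum_mem _ fun j _ => ?_)
        rw [map_smul]
        refine Submodule.smul_mem _ _ ?_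
        rw [UniformSpace.Completion.coe_toComplL, ← symTensor_eq_coe]
        exact Submodule.le_topologicalClosure _ (Submodule.subset_span ⟨_, rfl⟩)
      exact hle hz)

theorem contractParticle_symParticle (n : ℕ) (g : R) (f : Fin (n + 1) → R) :
    contractParticle n g (symParticle (n + 1) f) =
      ((n : ℂ) + 1)⁻¹ • ∑ j, ⟪g, f j⟫_ℂ • symParticle n fun i => f (j.succAbove i) := by
  apply Subtype.ext
  change (contractFirst n g).completion (symTensor R (n + 1) f) = _
  rw [symTensor_eq_coe, ContinuousLinearMap.completion_apply_coe, contractFirst_algSymTensor,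
    ← UniformSpace.Completion.coe_toComplL (𝕜 := ℂ), map_smul, map_sum, Submodule.coe_smul,
    Submodule.coe_sum]
  congr 1
  refine Finset.sum_congr rfl fun j _ => ?_
  rw [map_smul, Submodule.coe_smul, UniformSpace.Completion.coe_toComplL, ← symTensor_eq_coe]
  rfl

theorem norm_contractParticle_le (n : ℕ) (g : R) (x : nParticleSpace R (n + 1)) :
    ‖contractParticle n g x‖ ≤ ‖g‖ * ‖x‖ := by
  change ‖(contractFirst n g).completion (x : HilbertTensorPower R (n + 1))‖ ≤
    ‖g‖ * ‖(x : HilbertTensorPower R (n + 1))‖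
  generalize (x : HilbertTensorPower R (n + 1)) = z
  induction z using UniformSpace.Completion.induction_on with
  | hp => exact isClosed_le (by fun_prop) (by fun_prop)
  | ih a =>
    rw [ContinuousLinearMap.completion_apply_coe, UniformSpace.Completion.norm_coe,
      UniformSpace.Completion.norm_coe]
    exact norm_partialInner_le g a

/-- The annihilation operator `a(g)` restricted to the `n`-particle space (and zero on the other
sectors), as a bounded operator on Fock space; it maps into the `n - 1`-particle space. -/
noncomputable def ann : ℕ → R → FockSpace R →L[ℂ] FockSpace R
  | 0, _ => 0
  | n + 1, g => (Real.sqrt (n + 1) : ℂ) •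
      (lp.singleContinuousLinearMap ℂ (fun n : ℕ => nParticleSpace R n) 2 n ∘L
        contractParticle n g ∘L lp.evalCLM ℂ (fun n : ℕ => nParticleSpace R n) 2 (n + 1))

/-- The creation operator `a*(g)` from the `n - 1`-particle space to the `n`-particle space (zero
on the other sectors): the adjoint of `ann n g`. -/
noncomputable def cre (n : ℕ) (g : R) : FockSpace R →L[ℂ] FockSpace R :=
  ContinuousLinearMap.adjoint (ann n g)

/-- The projection onto the `n`-particle space. -/
noncomputable def numProj (R : Type u) [NormedAddCommGroup R] [InnerProductSpace ℂ R] (n : ℕ) :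
    FockSpace R →L[ℂ] FockSpace R :=
  lp.singleContinuousLinearMap ℂ (fun n : ℕ => nParticleSpace R n) 2 n ∘L
    lp.evalCLM ℂ (fun n : ℕ => nParticleSpace R n) 2 n

theorem ann_zero (g : R) : ann 0 g = 0 := rfl

theorem numProj_apply (n : ℕ) (x : FockSpace R) : numProj R n x = lp.single 2 n (x n) := rfl

theorem ann_succ_apply (n : ℕ) (g : R) (x : FockSpace R) :
    ann (n + 1) g x = (Real.sqrt (n + 1) : ℂ) • lp.single 2 n (contractParticle n g (x (n + 1))) :=
  rfl

theorem numProj_symVec_self (n : ℕ) (f : Fin n → R) :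
    numProj R n (symVec R n f) = symVec R n f := by
  rw [numProj_apply, symVec_eq_single, lp.single_apply_self]

theorem numProj_symVec_ne {m n : ℕ} (h : n ≠ m) (f : Fin m → R) :
    numProj R n (symVec R m f) = 0 := by
  rw [numProj_apply, symVec_eq_single, lp.single_apply_ne _ _ _ h, lp.single_zero]

theorem ann_succ_symVec (n : ℕ) (g : R) (f : Fin (n + 1) → R) :
    ann (n + 1) g (symVec R (n + 1) f) = ((Real.sqrt (n + 1) : ℂ) / (n + 1)) •
      ∑ j, ⟪g, f j⟫_ℂ • symVec R n fun i => f (j.succAbove i) := by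
  rw [ann_succ_apply, symVec_eq_single, lp.single_apply_self, contractParticle_symParticle]
  change (Real.sqrt (n + 1) : ℂ) •
    lp.singleContinuousLinearMap ℂ (fun n : ℕ => nParticleSpace R n) 2 n _ = _
  rw [map_smul, map_sum, smul_smul, div_eq_mul_inv]
  congr 1
  refine Finset.sum_congr rfl fun j _ => ?_
  rw [map_smul]
  rfl

theorem ann_symVec_ne {m n : ℕ} (h : n ≠ m) (g : R) (f : Fin m → R) :
    ann n g (symVec R m f) = 0 := by
  cases n with
  | zero => simp [ann_zero]
  | succ n =>
    rw [ann_succ_apply, symVec_eq_single, lp.single_apply_ne _ _ _ h, map_zero, lp.single_zero,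
      smul_zero]

theorem inner_cre_right (n : ℕ) (g : R) (x y : FockSpace R) :
    ⟪x, cre n g y⟫_ℂ = ⟪ann n g x, y⟫_ℂ :=
  ContinuousLinearMap.adjoint_inner_right _ _ _

theorem adjoint_cre (n : ℕ) (g : R) : ContinuousLinearMap.adjoint (cre n g) = ann n g :=
  ContinuousLinearMap.adjoint_adjoint _

/-- Vectors of Fock space are determined by their inner products with symmetrized tensors. -/
theorem FockSpace.ext_inner {x y : FockSpace R}
    (h : ∀ (n : ℕ) (f : Fin n → R), ⟪symVec R n f, x⟫_ℂ = ⟪symVec R n f, y⟫_ℂ) : x = y := by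
  rw [← sub_eq_zero]
  refine eq_zero_of_inner_symVec dense_univ fun n f _ => ?_
  rw [inner_sub_right, h, sub_self]

theorem inner_symVec_succ_cons (n : ℕ) (h : Fin (n + 1) → R) (g : R) (f : Fin n → R) :
    ⟪symVec R (n + 1) h, symVec R (n + 1) (Fin.cons g f)⟫_ℂ =
      ⟪((n : ℂ) + 1)⁻¹ • ∑ j, ⟪g, h j⟫_ℂ • symVec R n (fun i => h (j.succAbove i)),
        symVec R n f⟫_ℂ := by
  rw [inner_symVec_same, inner_algSymTensor_algSymTensor, ← inner_contractFirst,
    contractFirst_algSymTensor, inner_smul_left, inner_smul_left, sum_inner, sum_inner]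
  congr 1
  refine Finset.sum_congr rfl fun j _ => ?_
  rw [inner_smul_left, inner_smul_left, inner_symVec_same, inner_algSymTensor_algSymTensor]

/-- Creation operators are defined as adjoints; on symmetrized tensors they add an entry. -/
theorem cre_succ_symVec (n : ℕ) (g : R) (f : Fin n → R) :
    cre (n + 1) g (symVec R n f) =
      (Real.sqrt (n + 1) : ℂ) • symVec R (n + 1) (Fin.cons g f : Fin (n + 1) → R) := by
  refine FockSpace.ext_inner fun m h => ?_
  rw [inner_cre_right, inner_smul_right]
  by_cases hm : m = n + 1
  · subst hm
    rw [ann_succ_symVec, inner_symVec_succ_cons, div_eq_mul_inv, ← smul_smul, inner_smul_left,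
      Complex.conj_ofReal]
  · rw [ann_symVec_ne (Ne.symm hm), inner_zero_left, inner_symVec_ne hm, mul_zero]

theorem cre_symVec_ne {m n : ℕ} (h : n ≠ m + 1) (g : R) (f : Fin m → R) :
    cre n g (symVec R m f) = 0 := by
  refine FockSpace.ext_inner fun k y => ?_
  rw [inner_cre_right, inner_zero_right]
  by_cases hk : n = k
  · subst hk
    cases n with
    | zero => simp [ann_zero]
    | succ n =>
      rw [ann_succ_symVec, inner_smul_left, sum_inner]
      simp only [inner_smul_left]
      rw [Finset.sum_eq_zero, mul_zero]
      intro j _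
      rw [inner_symVec_ne (by omega), mul_zero]
  · rw [ann_symVec_ne hk, inner_zero_left]

theorem norm_ann_apply_le (n : ℕ) (g : R) (x : FockSpace R) :
    ‖ann n g x‖ ≤ Real.sqrt n * ‖g‖ * ‖numProj R n x‖ := by
  cases n with
  | zero => simp [ann_zero]
  | succ n =>
    rw [ann_succ_apply, numProj_apply, norm_smul, lp.norm_single (by norm_num),
      lp.norm_single (by norm_num), mul_assoc]
    have h1 : ‖((Real.sqrt (n + 1) : ℝ) : ℂ)‖ = Real.sqrt ((n + 1 : ℕ) : ℝ) := by
      rw [Complex.norm_real, Real.norm_of_nonneg (Real.sqrt_nonneg _)]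
      push_cast; rfl
    rw [h1]
    exact mul_le_mul_of_nonneg_left (norm_contractParticle_le n g _) (Real.sqrt_nonneg _)

theorem numProj_comp_self (n : ℕ) : numProj R n ∘L numProj R n = numProj R n := by
  refine FockSpace.clm_ext fun m f => ?_
  by_cases h : n = m
  · subst h; simp [numProj_symVec_self]
  · simp [numProj_symVec_ne h]

theorem numProj_comp_ne {m n : ℕ} (h : m ≠ n) : numProj R m ∘L numProj R n = 0 := by
  refine FockSpace.clm_ext fun k f => ?_
  by_cases hk : n = k
  · subst hk; simp [numProj_symVec_self, numProj_symVec_ne h]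
  · simp [numProj_symVec_ne hk]

theorem adjoint_numProj (n : ℕ) : ContinuousLinearMap.adjoint (numProj R n) = numProj R n := by
  symm
  rw [ContinuousLinearMap.eq_adjoint_iff]
  intro x y
  rw [numProj_apply, numProj_apply, lp.inner_single_left, lp.inner_single_right]

theorem ann_comp_numProj (n : ℕ) (g : R) : ann n g ∘L numProj R n = ann n g := by
  refine FockSpace.clm_ext fun m f => ?_
  by_cases h : n = m
  · subst h; simp [numProj_symVec_self]
  · simp [numProj_symVec_ne h, ann_symVec_ne h]

theorem numProj_comp_ann (n : ℕ) (g : R) : numProj R n ∘L ann (n + 1) g = ann (n + 1) g := by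
  refine FockSpace.clm_ext fun m f => ?_
  by_cases h : n + 1 = m
  · subst h
    rw [ContinuousLinearMap.comp_apply, ann_succ_symVec, map_smul, map_sum]
    simp [numProj_symVec_self]
  · simp [ann_symVec_ne h]

theorem norm_ann_le (n : ℕ) (g : R) : ‖ann n g‖ ≤ Real.sqrt n * ‖g‖ := by
  refine ContinuousLinearMap.opNorm_le_bound _ (by positivity) fun y => ?_
  refine (norm_ann_apply_le _ _ _).trans ?_
  refine mul_le_mul_of_nonneg_left ?_ (by positivity)
  rw [numProj_apply, lp.norm_single (by norm_num)]
  exact lp.norm_apply_le_norm (by norm_num) y _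

/-- The canonical commutation relation, sector by sector. -/
theorem ann_comp_cre (n : ℕ) (g f : R) :
    ann (n + 1) g ∘L cre (n + 1) f = cre n f ∘L ann n g + ⟪g, f⟫_ℂ • numProj R n := by
  refine FockSpace.clm_ext fun m h => ?_
  simp only [ContinuousLinearMap.comp_apply, add_apply, smul_apply]
  by_cases hm : n = m
  · subst hm
    rw [cre_succ_symVec, map_smul, ann_succ_symVec, numProj_symVec_self, Fin.sum_univ_succ,
      smul_smul]
    have h0 : (Real.sqrt (n + 1) : ℂ) * ((Real.sqrt (n + 1) : ℂ) / (n + 1)) = 1 := by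
      have h1 : ((Real.sqrt (n + 1) : ℂ)) * (Real.sqrt (n + 1) : ℂ) = n + 1 := by
        rw [← Complex.ofReal_mul, Real.mul_self_sqrt (by positivity)]; push_cast; rfl
      rw [← mul_div_assoc, h1, div_self]
      exact_mod_cast Nat.succ_ne_zero n
    rw [h0, one_smul, add_comm]
    congr 1
    cases n with
    | zero => simp [ann_zero]
    | succ n =>
      rw [ann_succ_symVec, map_smul, map_sum, Finset.smul_sum]
      refine Finset.sum_congr rfl fun j _ => ?_
      rw [map_smul, cre_succ_symVec, smul_comm ⟪g, h j⟫_ℂ (Real.sqrt (n + 1) : ℂ), smul_smul]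
      have h1 : ((Real.sqrt (n + 1) : ℂ) / (n + 1)) * (Real.sqrt (n + 1) : ℂ) = 1 := by
        have h1 : ((Real.sqrt (n + 1) : ℂ)) * (Real.sqrt (n + 1) : ℂ) = n + 1 := by
          rw [← Complex.ofReal_mul, Real.mul_self_sqrt (by positivity)]; push_cast; rfl
        rw [div_mul_eq_mul_div, h1, div_self]
        exact_mod_cast Nat.succ_ne_zero n
      rw [h1, one_smul]
      congr 1
      congr 1
      funext i
      refine Fin.cases ?_ (fun i => ?_) i
      · simp
      · simp
  · rw [cre_symVec_ne (by omega), ann_symVec_ne hm, numProj_symVec_ne hm]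
    simp

/-- The order of the entries of a symmetrized tensor is irrelevant. -/
theorem cre_comp_cre (n : ℕ) (g f : R) :
    cre (n + 1) g ∘L cre n f = cre (n + 1) f ∘L cre n g := by
  refine FockSpace.clm_ext fun m h => ?_
  simp only [ContinuousLinearMap.comp_apply]
  by_cases hm : n = m + 1
  · subst hm
    rw [cre_succ_symVec, cre_succ_symVec, map_smul, map_smul, cre_succ_symVec, cre_succ_symVec]
    congr 2
    rw [← symVec_perm _ _ (Equiv.swap 0 1)]
    congr 1
    funext i
    refine Fin.cases ?_ (fun i => Fin.cases ?_ (fun i => ?_) i) i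
    · simp
    · have : Equiv.swap (0 : Fin (m + 2)) 1 (Fin.succ 0) = 0 := by
        rw [Fin.succ_zero_eq_one]; exact Equiv.swap_apply_right _ _
      rw [this]; simp
    · have : Equiv.swap (0 : Fin (m + 2)) 1 i.succ.succ = i.succ.succ := by
        refine Equiv.swap_apply_of_ne_of_ne (Fin.succ_ne_zero _) ?_
        rw [← Fin.succ_zero_eq_one]
        exact fun h => Fin.succ_ne_zero _ (Fin.succ_injective _ h)
      rw [this]; simp
  · rw [cre_symVec_ne hm, cre_symVec_ne hm]; simp

theorem ann_comp_ann (n : ℕ) (g f : R) :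
    ann n g ∘L ann (n + 1) f = ann n f ∘L ann (n + 1) g := by
  have := congrArg ContinuousLinearMap.adjoint (cre_comp_cre n f g)
  rwa [ContinuousLinearMap.adjoint_comp, ContinuousLinearMap.adjoint_comp, adjoint_cre, adjoint_cre,
    adjoint_cre, adjoint_cre] at this

/-- An isometry of the one-particle space acts isometrically on symmetrized tensors. -/
theorem inner_symVec_map (n : ℕ) (u : R → R) (hu : ∀ x y, ⟪u x, u y⟫_ℂ = ⟪x, y⟫_ℂ)
    (f g : Fin n → R) :
    ⟪symVec R n (fun i => u (f i)), symVec R n (fun i => u (g i))⟫_ℂ =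
      ⟪symVec R n f, symVec R n g⟫_ℂ := by
  simp only [inner_symVec_same, inner_algSymTensor_algSymTensor]
  simp only [algSymTensor, inner_smul_left, sum_inner, inner_elemTensor, hu]

end FockOperators

/-! ### The abstract structure of Fock space -/

/-- The structure of the bosonic Fock space over `R` on which the dynamics rests, on an arbitrary
Hilbert space `F`: the symmetrized tensors `sym n f`, the projections `num n` onto the `n`-particle
sectors, and the annihilation operators `ann n g` from the `n`-particle to the `n - 1`-particle
sector, with the canonical commutation relations. The creation operators are the adjoints of the
`ann n g`. -/
structure FockModel (R : Type u) [NormedAddCommGroup R] [InnerProductSpace ℂ R]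
    (F : Type v) [NormedAddCommGroup F] [InnerProductSpace ℂ F] [CompleteSpace F] where
  sym : ∀ n : ℕ, ContinuousMultilinearMap ℂ (fun _ : Fin n => R) F
  num : ℕ → F →L[ℂ] F
  ann : ℕ → R → F →L[ℂ] F
  eq_zero : ∀ {D : Set R}, Dense D → ∀ {x : F},
    (∀ (n : ℕ) (f : Fin n → R), (∀ i, f i ∈ D) → ⟪sym n f, x⟫_ℂ = 0) → x = 0
  inner_sym_map : ∀ (n : ℕ) (u : R → R), (∀ x y, ⟪u x, u y⟫_ℂ = ⟪x, y⟫_ℂ) → ∀ f g : Fin n → R,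
    ⟪sym n (fun i => u (f i)), sym n (fun i => u (g i))⟫_ℂ = ⟪sym n f, sym n g⟫_ℂ
  inner_sym_ne : ∀ {m n : ℕ}, m ≠ n → ∀ (f : Fin m → R) (g : Fin n → R),
    ⟪sym m f, sym n g⟫_ℂ = 0
  norm_sym_zero : ∀ f : Fin 0 → R, ‖sym 0 f‖ = 1
  num_sym_self : ∀ (n : ℕ) (f : Fin n → R), num n (sym n f) = sym n f
  num_sym_ne : ∀ {m n : ℕ}, n ≠ m → ∀ f : Fin m → R, num n (sym m f) = 0
  adjoint_num : ∀ n, ContinuousLinearMap.adjoint (num n) = num n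
  num_comp_self : ∀ n, num n ∘L num n = num n
  num_comp_ne : ∀ {m n : ℕ}, m ≠ n → num m ∘L num n = 0
  ann_zero : ∀ g, ann 0 g = 0
  norm_ann_le : ∀ n g, ‖ann n g‖ ≤ Real.sqrt n * ‖g‖
  ann_sym_ne : ∀ {m n : ℕ}, n ≠ m → ∀ (g : R) (f : Fin m → R), ann n g (sym m f) = 0
  ann_succ_sym : ∀ (n : ℕ) (g : R) (f : Fin (n + 1) → R),
    ann (n + 1) g (sym (n + 1) f) = ((Real.sqrt (n + 1) : ℂ) / (n + 1)) •
      ∑ j, ⟪g, f j⟫_ℂ • sym n fun i => f (j.succAbove i)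
  cre_succ_sym : ∀ (n : ℕ) (g : R) (f : Fin n → R),
    ContinuousLinearMap.adjoint (ann (n + 1) g) (sym n f) =
      (Real.sqrt (n + 1) : ℂ) • sym (n + 1) (Fin.cons g f : Fin (n + 1) → R)
  ann_comp_num : ∀ n g, ann n g ∘L num n = ann n g
  num_comp_ann : ∀ n g, num n ∘L ann (n + 1) g = ann (n + 1) g
  ann_comp_cre : ∀ n g f, ann (n + 1) g ∘L ContinuousLinearMap.adjoint (ann (n + 1) f) =
    ContinuousLinearMap.adjoint (ann n f) ∘L ann n g + ⟪g, f⟫_ℂ • num n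
  ann_comp_ann : ∀ n g f, ann n g ∘L ann (n + 1) f = ann n f ∘L ann (n + 1) g

/-- The bosonic Fock space with its symmetrized tensors and its annihilation operators. -/
noncomputable def fockModel (R : Type u) [NormedAddCommGroup R] [InnerProductSpace ℂ R] :
    FockModel R (FockSpace R) where
  sym := symVecL R
  num := numProj R
  ann := ann
  eq_zero hD _ h := eq_zero_of_inner_symVec hD h
  inner_sym_map := inner_symVec_map
  inner_sym_ne h := inner_symVec_ne h
  norm_sym_zero f := by
    have h : ⟪symVec R 0 f, symVec R 0 f⟫_ℂ = 1 := by
      rw [inner_symVec_same, inner_algSymTensor_algSymTensor, algSymTensor]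
      simp [norm_elemTensor]
    rw [inner_self_eq_norm_sq_to_K] at h
    have h2 : ‖symVec R 0 f‖ ^ 2 = 1 := by
      apply Complex.ofReal_injective
      push_cast
      exact h
    exact (pow_eq_one_iff_of_nonneg (norm_nonneg _) two_ne_zero).1 h2
  num_sym_self := numProj_symVec_self
  num_sym_ne h := numProj_symVec_ne h
  adjoint_num := adjoint_numProj
  num_comp_self := numProj_comp_self
  num_comp_ne h := numProj_comp_ne h
  ann_zero := ann_zero
  norm_ann_le := norm_ann_le
  ann_sym_ne h := ann_symVec_ne h
  ann_succ_sym := ann_succ_symVec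
  cre_succ_sym := cre_succ_symVec
  ann_comp_num := ann_comp_numProj
  num_comp_ann := numProj_comp_ann
  ann_comp_cre := ann_comp_cre
  ann_comp_ann := ann_comp_ann

/-! ### Operators on the coupled space -/

section CoupledSpace

/-- Bessel's inequality for a family of pairwise orthogonal projections. -/
theorem sum_norm_sq_projection_le {H : Type*} [NormedAddCommGroup H] [InnerProductSpace ℂ H]
    {P : ℕ → H →L[ℂ] H} (hself : ∀ n x y, ⟪P n x, y⟫_ℂ = ⟪x, P n y⟫_ℂ)
    (hidem : ∀ n x, P n (P n x) = P n x) (hne : ∀ {m n : ℕ}, m ≠ n → ∀ x, P m (P n x) = 0)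
    (N : ℕ) (x : H) : ∑ n ∈ Finset.range N, ‖P n x‖ ^ 2 ≤ ‖x‖ ^ 2 := by
  set q := ∑ n ∈ Finset.range N, P n x with hq
  have h1 : ∀ n ∈ Finset.range N, P n q = P n x := by
    intro n hn
    rw [hq, map_sum, Finset.sum_eq_single_of_mem n hn, hidem]
    intro m _ hm
    exact hne hm.symm x
  have h2 : ⟪q, q⟫_ℂ = ⟪q, x⟫_ℂ := by
    conv_lhs => rw [hq, sum_inner]
    conv_rhs => rw [hq, sum_inner]
    refine Finset.sum_congr rfl fun n hn => ?_
    rw [hself, h1 n hn, hself]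
  have h3 : ⟪q, q⟫_ℂ = ((∑ n ∈ Finset.range N, ‖P n x‖ ^ 2 : ℝ) : ℂ) := by
    conv_lhs => rw [hq, sum_inner]
    push_cast
    refine Finset.sum_congr rfl fun n hn => ?_
    have h0 : ⟪P n x, P n x⟫_ℂ = ⟪x, P n x⟫_ℂ := by rw [hself, hidem]
    rw [← hq, hself, h1 n hn, ← h0, inner_self_eq_norm_sq_to_K]
    rfl
  have h4 : ‖q‖ ^ 2 = ∑ n ∈ Finset.range N, ‖P n x‖ ^ 2 := by
    apply Complex.ofReal_injective
    rw [← h3, inner_self_eq_norm_sq_to_K]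
    norm_num
  rw [← h4]
  have h5 : ‖q‖ ^ 2 ≤ ‖q‖ * ‖x‖ := by
    have := norm_inner_le_norm (𝕜 := ℂ) q x
    rw [← h2, inner_self_eq_norm_sq_to_K] at this
    simpa using this
  nlinarith [norm_nonneg q, norm_nonneg x, sq_nonneg (‖q‖ - ‖x‖)]

theorem adjoint_apply_tmul {𝓚 : Type v} [NormedAddCommGroup 𝓚] [InnerProductSpace ℂ 𝓚]
    [FiniteDimensional ℂ 𝓚] [CompleteSpace 𝓚]
    {R : Type u} [NormedAddCommGroup R] [InnerProductSpace ℂ R] [CompleteSpace R]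
    {A : Type*} [Fintype A] {E : A → 𝓚 →L[ℂ] 𝓚} {v : A → R}
    {V : 𝓚 →L[ℂ] 𝓚 ⊗[ℂ] R} (hV : ∀ k, V k = ∑ α, E α k ⊗ₜ[ℂ] v α) (k : 𝓚) (f : R) :
    ContinuousLinearMap.adjoint V (k ⊗ₜ[ℂ] f) =
      ∑ α, ⟪v α, f⟫_ℂ • ContinuousLinearMap.adjoint (E α) k := by
  refine ext_inner_left ℂ fun l => ?_
  rw [ContinuousLinearMap.adjoint_inner_right, hV, sum_inner, inner_sum]
  refine Finset.sum_congr rfl fun α _ => ?_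
  rw [TensorProduct.inner_tmul, inner_smul_right, ContinuousLinearMap.adjoint_inner_right, mul_comm]

end CoupledSpace

/-- The creation operator `a*(g)` from the `n - 1`-particle to the `n`-particle sector. -/
noncomputable def FockModel.cre {R : Type u} [NormedAddCommGroup R] [InnerProductSpace ℂ R]
    {F : Type w} [NormedAddCommGroup F] [InnerProductSpace ℂ F] [CompleteSpace F]
    (M : FockModel R F) (n : ℕ) (g : R) : F →L[ℂ] F := ContinuousLinearMap.adjoint (M.ann n g)

/-- A Fock space `F` over `R` together with a Hilbert space `H` which plays the role of `𝓚 ⊗ F`;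
`op B C` is the operator `B ⊗ C`. Working with an arbitrary such `H` keeps the several algebraic
structures on the type `𝓚 ⊗ F` out of the analysis. -/
structure CoupledModel (𝓚 : Type v) [NormedAddCommGroup 𝓚] [InnerProductSpace ℂ 𝓚] [CompleteSpace 𝓚]
    (R : Type u) [NormedAddCommGroup R] [InnerProductSpace ℂ R]
    (F : Type w) [NormedAddCommGroup F] [InnerProductSpace ℂ F] [CompleteSpace F]
    (H : Type*) [NormedAddCommGroup H] [InnerProductSpace ℂ H] [CompleteSpace H]
    extends FockModel R F where
  tmul : 𝓚 →L[ℂ] F →L[ℂ] H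
  op : (𝓚 →L[ℂ] 𝓚) → (F →L[ℂ] F) → H →L[ℂ] H
  inner_tmul : ∀ k x l y, ⟪tmul k x, tmul l y⟫_ℂ = ⟪k, l⟫_ℂ * ⟪x, y⟫_ℂ
  eq_zero_of_inner_tmul : ∀ y, (∀ k x, ⟪tmul k x, y⟫_ℂ = 0) → y = 0
  op_tmul : ∀ B C k x, op B C (tmul k x) = tmul (B k) (C x)
  norm_op_le : ∀ B C, ‖op B C‖ ≤ ‖B‖ * ‖C‖

/-- The coupled system on `𝓚 ⊗ F`. -/
noncomputable def FockModel.coupled {R : Type u} [NormedAddCommGroup R] [InnerProductSpace ℂ R]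
    {F : Type w} [NormedAddCommGroup F] [InnerProductSpace ℂ F] [CompleteSpace F]
    (M : FockModel R F) (𝓚 : Type v) [NormedAddCommGroup 𝓚] [InnerProductSpace ℂ 𝓚]
    [CompleteSpace 𝓚] [FiniteDimensional ℂ 𝓚] : CoupledModel 𝓚 R F (𝓚 ⊗[ℂ] F) where
  toFockModel := M
  tmul := TensorProduct.mkL ℂ 𝓚 F
  op B C := TensorProduct.mapL B C
  inner_tmul k x l y := TensorProduct.inner_tmul _ _ _ _ _
  eq_zero_of_inner_tmul y h := by
    rw [TensorProduct.ext_iff_inner_left (𝕜 := ℂ)]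
    intro k x
    rw [inner_zero_right]
    exact h k x
  op_tmul B C k x := rfl
  norm_op_le B C := TensorProduct.norm_mapL_le B C

namespace CoupledModel

variable {𝓚 : Type v} [NormedAddCommGroup 𝓚] [InnerProductSpace ℂ 𝓚] [CompleteSpace 𝓚]
variable {R : Type u} [NormedAddCommGroup R] [InnerProductSpace ℂ R]
variable {F : Type w} [NormedAddCommGroup F] [InnerProductSpace ℂ F] [CompleteSpace F]
variable {H : Type*} [NormedAddCommGroup H] [InnerProductSpace ℂ H] [CompleteSpace H]
variable (M : CoupledModel 𝓚 R F H)

theorem num_comp_cre (n : ℕ) (g : R) : M.num n ∘L M.cre n g = M.cre n g := by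
  have := congrArg ContinuousLinearMap.adjoint (M.ann_comp_num n g)
  rwa [ContinuousLinearMap.adjoint_comp, M.adjoint_num] at this

theorem cre_comp_num (n : ℕ) (g : R) : M.cre (n + 1) g ∘L M.num n = M.cre (n + 1) g := by
  have := congrArg ContinuousLinearMap.adjoint (M.num_comp_ann n g)
  rwa [ContinuousLinearMap.adjoint_comp, M.adjoint_num] at this

/-- The vector `k ⊗ Symⁿ (f₁ ⊗ ⋯ ⊗ fₙ)`. -/
noncomputable def vec (n : ℕ) (k : 𝓚) (f : Fin n → R) : H := M.tmul k (M.sym n f)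

theorem eq_zero_of_inner_vec {D : Set R} (hD : Dense D) {y : H}
    (h : ∀ (n : ℕ) (k : 𝓚) (f : Fin n → R), (∀ i, f i ∈ D) → ⟪M.vec n k f, y⟫_ℂ = 0) :
    y = 0 := by
  refine M.eq_zero_of_inner_tmul y fun k x => ?_
  have h1 : ContinuousLinearMap.adjoint (M.tmul k) y = 0 := by
    refine M.eq_zero hD fun n f hf => ?_
    rw [ContinuousLinearMap.adjoint_inner_right]
    exact h n k f hf
  rw [← ContinuousLinearMap.adjoint_inner_right, h1, inner_zero_right]

theorem clm_ext_of_dense {D : Set R} (hD : Dense D) {X : Type*} [NormedAddCommGroup X]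
    [NormedSpace ℂ X] {S T : H →L[ℂ] X}
    (h : ∀ (n : ℕ) (k : 𝓚) (f : Fin n → R), (∀ i, f i ∈ D) →
      S (M.vec n k f) = T (M.vec n k f)) : S = T := by
  have hd : Dense (Submodule.span ℂ {x : H | ∃ (n : ℕ) (k : 𝓚) (f : Fin n → R),
      (∀ i, f i ∈ D) ∧ x = M.vec n k f} : Set H) := by
    rw [Submodule.dense_iff_topologicalClosure_eq_top, Submodule.topologicalClosure_eq_top_iff,
      Submodule.eq_bot_iff]
    intro x hx
    rw [Submodule.mem_orthogonal] at hx
    exact M.eq_zero_of_inner_vec hD fun n k f hf =>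
      hx _ (Submodule.subset_span ⟨n, k, f, hf, rfl⟩)
  refine ContinuousLinearMap.ext_on hd ?_
  rintro _ ⟨n, k, f, hf, rfl⟩
  exact h n k f hf

theorem clm_ext {X : Type*} [NormedAddCommGroup X] [NormedSpace ℂ X] {S T : H →L[ℂ] X}
    (h : ∀ k x, S (M.tmul k x) = T (M.tmul k x)) : S = T :=
  M.clm_ext_of_dense dense_univ fun n k f _ => h k (M.sym n f)

theorem op_op (B B' : 𝓚 →L[ℂ] 𝓚) (C C' : F →L[ℂ] F) (x : H) :
    M.op B C (M.op B' C' x) = M.op (B ∘L B') (C ∘L C') x := by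
  suffices h : M.op B C ∘L M.op B' C' = M.op (B ∘L B') (C ∘L C') from
    congrArg (fun L : H →L[ℂ] H => L x) h
  refine M.clm_ext fun k x => ?_
  simp [M.op_tmul]

theorem op_add_right (B : 𝓚 →L[ℂ] 𝓚) (C C' : F →L[ℂ] F) : M.op B (C + C') = M.op B C + M.op B C' :=
  M.clm_ext fun k x => by simp [M.op_tmul]

theorem op_smul_right (B : 𝓚 →L[ℂ] 𝓚) (c : ℂ) (C : F →L[ℂ] F) :
    M.op B (c • C) = c • M.op B C :=
  M.clm_ext fun k x => by simp [M.op_tmul]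

theorem op_zero_right (B : 𝓚 →L[ℂ] 𝓚) : M.op B 0 = 0 :=
  M.clm_ext fun k x => by simp [M.op_tmul]

theorem adjoint_op (B : 𝓚 →L[ℂ] 𝓚) (C : F →L[ℂ] F) :
    ContinuousLinearMap.adjoint (M.op B C) =
      M.op (ContinuousLinearMap.adjoint B) (ContinuousLinearMap.adjoint C) := by
  refine M.clm_ext fun k x => ?_
  rw [← sub_eq_zero]
  refine M.eq_zero_of_inner_tmul _ fun l y => ?_
  rw [inner_sub_right, ContinuousLinearMap.adjoint_inner_right, M.op_tmul, M.op_tmul, M.inner_tmul,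
    M.inner_tmul, ContinuousLinearMap.adjoint_inner_right, ContinuousLinearMap.adjoint_inner_right,
    sub_self]

/-- The projection onto the vectors with exactly `n` particles. -/
noncomputable def sectorProj (n : ℕ) : H →L[ℂ] H := M.op 1 (M.num n)

theorem sectorProj_vec_self (n : ℕ) (k : 𝓚) (f : Fin n → R) :
    M.sectorProj n (M.vec n k f) = M.vec n k f := by
  rw [sectorProj, vec, M.op_tmul, M.num_sym_self]; rfl

theorem sectorProj_vec_ne {m n : ℕ} (h : n ≠ m) (k : 𝓚) (f : Fin m → R) :
    M.sectorProj n (M.vec m k f) = 0 := by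
  rw [sectorProj, vec, M.op_tmul, M.num_sym_ne h, map_zero]

theorem sectorProj_apply_self (n : ℕ) (x : H) :
    M.sectorProj n (M.sectorProj n x) = M.sectorProj n x := by
  rw [sectorProj, M.op_op, M.num_comp_self]; rfl

theorem sectorProj_apply_ne {m n : ℕ} (h : m ≠ n) (x : H) :
    M.sectorProj m (M.sectorProj n x) = 0 := by
  rw [sectorProj, sectorProj, M.op_op, M.num_comp_ne h, M.op_zero_right]; rfl

theorem inner_sectorProj (n : ℕ) (x y : H) :
    ⟪M.sectorProj n x, y⟫_ℂ = ⟪x, M.sectorProj n y⟫_ℂ := by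
  rw [← ContinuousLinearMap.adjoint_inner_right, sectorProj, M.adjoint_op, M.adjoint_num]
  congr 3
  exact star_one (𝓚 →L[ℂ] 𝓚)

theorem sum_norm_sq_sectorProj_le (N : ℕ) (x : H) :
    ∑ n ∈ Finset.range N, ‖M.sectorProj n x‖ ^ 2 ≤ ‖x‖ ^ 2 :=
  sum_norm_sq_projection_le M.inner_sectorProj M.sectorProj_apply_self
    (fun h x => M.sectorProj_apply_ne h x) N x

theorem norm_sectorProj_le (n : ℕ) (x : H) : ‖M.sectorProj n x‖ ≤ ‖x‖ := by
  refine le_of_sq_le_sq ?_ (norm_nonneg _)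
  refine le_trans ?_ (M.sum_norm_sq_sectorProj_le (n + 1) x)
  exact Finset.single_le_sum (f := fun n => ‖M.sectorProj n x‖ ^ 2) (fun _ _ => sq_nonneg _)
    (Finset.self_mem_range_succ n)

theorem eq_zero_of_sectorProj {y : H} (h : ∀ n, M.sectorProj n y = 0) :
    y = 0 := by
  refine M.eq_zero_of_inner_vec dense_univ fun n k f _ => ?_
  rw [← M.sectorProj_vec_self, M.inner_sectorProj, h, inner_zero_right]

variable {A : Type*} [Fintype A]

/-- The part of `a(V)`, for `V k = ∑ α, E α k ⊗ v α`, which maps the `n`-particle sector to the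
`n - 1`-particle sector. -/
noncomputable def fieldAnn (E : A → 𝓚 →L[ℂ] 𝓚) (v : A → R) (n : ℕ) : H →L[ℂ] H :=
  ∑ α, M.op (ContinuousLinearMap.adjoint (E α)) (M.ann n (v α))

/-- The part of `a*(V)`, for `V k = ∑ α, E α k ⊗ v α`, which maps the `n - 1`-particle sector to
the `n`-particle sector. -/
noncomputable def fieldCre (E : A → 𝓚 →L[ℂ] 𝓚) (v : A → R) (n : ℕ) : H →L[ℂ] H :=
  ∑ α, M.op (E α) (M.cre n (v α))

theorem fieldAnn_zero (E : A → 𝓚 →L[ℂ] 𝓚) (v : A → R) : M.fieldAnn E v 0 = 0 := by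
  simp [fieldAnn, M.ann_zero, M.op_zero_right]

theorem fieldCre_zero (E : A → 𝓚 →L[ℂ] 𝓚) (v : A → R) : M.fieldCre E v 0 = 0 := by
  simp [fieldCre, FockModel.cre, M.ann_zero, M.op_zero_right]

theorem fieldAnn_sectorProj (E : A → 𝓚 →L[ℂ] 𝓚) (v : A → R) (n : ℕ) (x : H) :
    M.fieldAnn E v n (M.sectorProj n x) = M.fieldAnn E v n x := by
  simp only [fieldAnn, sum_apply, sectorProj, M.op_op, M.ann_comp_num]
  rfl

theorem sectorProj_fieldAnn (E : A → 𝓚 →L[ℂ] 𝓚) (v : A → R) (n : ℕ) (x : H) :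
    M.sectorProj n (M.fieldAnn E v (n + 1) x) = M.fieldAnn E v (n + 1) x := by
  simp only [fieldAnn, sum_apply, sectorProj, map_sum, M.op_op, M.num_comp_ann]
  rfl

theorem fieldCre_sectorProj (E : A → 𝓚 →L[ℂ] 𝓚) (v : A → R) (n : ℕ) (x : H) :
    M.fieldCre E v (n + 1) (M.sectorProj n x) = M.fieldCre E v (n + 1) x := by
  simp only [fieldCre, sum_apply, sectorProj, M.op_op, M.cre_comp_num]
  rfl

theorem sectorProj_fieldCre (E : A → 𝓚 →L[ℂ] 𝓚) (v : A → R) (n : ℕ) (x : H) :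
    M.sectorProj n (M.fieldCre E v n x) = M.fieldCre E v n x := by
  simp only [fieldCre, sum_apply, sectorProj, map_sum, M.op_op, M.num_comp_cre]
  rfl

theorem norm_fieldAnn_le (E : A → 𝓚 →L[ℂ] 𝓚) (v : A → R) (n : ℕ) :
    ‖M.fieldAnn E v n‖ ≤ (∑ α, ‖E α‖ * ‖v α‖) * Real.sqrt n := by
  rw [Finset.sum_mul, fieldAnn]
  refine (norm_sum_le _ _).trans (Finset.sum_le_sum fun α _ => ?_)
  refine (M.norm_op_le _ _).trans ?_
  rw [LinearIsometryEquiv.norm_map, mul_assoc, mul_comm ‖v α‖]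
  exact mul_le_mul_of_nonneg_left (M.norm_ann_le n _) (norm_nonneg _)

theorem adjoint_fieldAnn (E : A → 𝓚 →L[ℂ] 𝓚) (v : A → R) (n : ℕ) :
    ContinuousLinearMap.adjoint (M.fieldAnn E v n) = M.fieldCre E v n := by
  rw [fieldAnn, fieldCre, map_sum]
  refine Finset.sum_congr rfl fun α _ => ?_
  rw [M.adjoint_op, ContinuousLinearMap.adjoint_adjoint]
  rfl

theorem inner_fieldCre_left (E : A → 𝓚 →L[ℂ] 𝓚) (v : A → R) (n : ℕ) (x y : H) :
    ⟪M.fieldCre E v n x, y⟫_ℂ = ⟪x, M.fieldAnn E v n y⟫_ℂ := by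
  rw [← M.adjoint_fieldAnn, ContinuousLinearMap.adjoint_inner_left]

theorem inner_fieldAnn_left (E : A → 𝓚 →L[ℂ] 𝓚) (v : A → R) (n : ℕ) (x y : H) :
    ⟪M.fieldAnn E v n x, y⟫_ℂ = ⟪x, M.fieldCre E v n y⟫_ℂ := by
  rw [← M.adjoint_fieldAnn, ContinuousLinearMap.adjoint_inner_right]

theorem norm_fieldCre_le (E : A → 𝓚 →L[ℂ] 𝓚) (v : A → R) (n : ℕ) :
    ‖M.fieldCre E v n‖ ≤ (∑ α, ‖E α‖ * ‖v α‖) * Real.sqrt n := by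
  rw [← M.adjoint_fieldAnn, LinearIsometryEquiv.norm_map]
  exact M.norm_fieldAnn_le E v n

theorem inner_fieldCre_sectorProj (E : A → 𝓚 →L[ℂ] 𝓚) (v : A → R) (n m : ℕ) (x y : H) :
    ⟪M.sectorProj n x, M.fieldCre E v n (M.sectorProj m y)⟫_ℂ =
      ⟪M.sectorProj n x, M.fieldCre E v (m + 1) (M.sectorProj m y)⟫_ℂ := by
  by_cases h : n = m + 1
  · rw [h]
  · have h1 : ⟪M.sectorProj n x, M.fieldCre E v (m + 1) (M.sectorProj m y)⟫_ℂ = 0 := by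
      rw [← M.sectorProj_fieldCre E v (m + 1), ← M.inner_sectorProj, M.sectorProj_apply_ne (Ne.symm h),
        inner_zero_left]
    rw [h1]
    cases n with
    | zero => rw [M.fieldCre_zero, zero_apply, inner_zero_right]
    | succ n =>
      rw [← M.fieldCre_sectorProj, M.sectorProj_apply_ne (by omega), map_zero, inner_zero_right]

theorem inner_fieldAnn_sectorProj (E : A → 𝓚 →L[ℂ] 𝓚) (v : A → R) (n m : ℕ) (x y : H) :
    ⟪M.sectorProj n x, M.fieldAnn E v (n + 1) (M.sectorProj m y)⟫_ℂ =
      ⟪M.sectorProj n x, M.fieldAnn E v m (M.sectorProj m y)⟫_ℂ := by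
  rw [← M.inner_fieldCre_left, ← M.inner_fieldCre_left, ← inner_conj_symm,
    ← M.inner_fieldCre_sectorProj, inner_conj_symm]

end CoupledModel

/-! ### Essential self-adjointness of the free Hamiltonian -/

section Derivatives

/-- For an essentially self-adjoint operator the adjoint is the closure. -/
theorem IsEssentiallySelfAdjointGraph.mem_closure_of_adjoint {H : Type*} [NormedAddCommGroup H]
    [InnerProductSpace ℂ H] [CompleteSpace H] {G : Submodule ℂ (H × H)}
    (hG : IsEssentiallySelfAdjointGraph G) {y w : H} (h : ∀ p ∈ G, ⟪p.2, y⟫_ℂ = ⟪p.1, w⟫_ℂ) :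
    (y, w) ∈ G.topologicalClosure := by
  obtain ⟨q, hq, hqe⟩ := hG.exists_mem_closure one_ne_zero (w + Complex.I • y)
  have he : w - q.2 = -(Complex.I • (y - q.1)) := by
    rw [Complex.ofReal_one, mul_one] at hqe
    rw [smul_sub, sub_eq_iff_eq_add, neg_sub, eq_comm]
    rw [← sub_eq_zero] at hqe ⊢
    rw [← hqe]; abel
  -- `y - q.1` lies in the kernel of the adjoint of `A - i`, which is trivial
  have hd : y - q.1 = 0 := by
    refine hG.range (-1) (by norm_num) _ fun p hp => ?_
    have h1 := hG.symm_closure p (subset_closure hp) q hq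
    have h2 : ⟪p.2, y - q.1⟫_ℂ = ⟪p.1, w - q.2⟫_ℂ := by
      rw [inner_sub_right, inner_sub_right, h p hp, h1]
    rw [inner_add_left, h2, he, inner_smul_left, inner_neg_right, inner_smul_right]
    simp
  have hw : w = q.2 := by
    rw [hd, smul_zero, neg_zero] at he
    exact sub_eq_zero.1 he
  rw [sub_eq_zero.1 hd, hw]
  exact hq

/-- The product rule for a complex bilinear map along real curves. -/
theorem HasDerivAt.clm_bilinear {X Y Z : Type*} [NormedAddCommGroup X] [NormedSpace ℂ X]
    [NormedAddCommGroup Y] [NormedSpace ℂ Y] [NormedAddCommGroup Z] [NormedSpace ℂ Z]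
    (B : X →L[ℂ] Y →L[ℂ] Z) {a : ℝ → X} {b : ℝ → Y} {a' : X} {b' : Y} {t : ℝ}
    (ha : HasDerivAt a a' t) (hb : HasDerivAt b b' t) :
    HasDerivAt (fun s => B (a s) (b s)) (B a' (b t) + B (a t) b') t := by
  have h := (B.bilinearRestrictScalars ℝ).hasFDerivAt_of_bilinear ha.hasFDerivAt hb.hasFDerivAt
  have h2 := h.hasDerivAt
  rw [add_comm]
  refine HasDerivAt.congr_deriv (f := fun s => B (a s) (b s)) h2 ?_
  refine congrArg₂ (fun x y : Z => x + y) ?_ ?_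
  · exact congrArg (B (a t)) (one_smul ℝ b')
  · exact congrArg (fun x => B x (b t)) (one_smul ℝ a')

theorem HasDerivAt.multilinear {n : ℕ} {X Z : Type*} [NormedAddCommGroup X] [NormedSpace ℂ X]
    [NormedAddCommGroup Z] [NormedSpace ℂ Z] (B : ContinuousMultilinearMap ℂ (fun _ : Fin n => X) Z)
    {f : Fin n → ℝ → X} {f' : Fin n → X} {t : ℝ} (hf : ∀ i, HasDerivAt (f i) (f' i) t) :
    HasDerivAt (fun s => B fun i => f i s)
      (∑ j, B (Function.update (fun i => f i t) j (f' j))) t := by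
  have h := HasFDerivAt.multilinear_comp (f := B.restrictScalars ℝ)
    (g := fun i s => f i s) (fun i => (hf i).hasFDerivAt)
  have h2 := h.hasDerivAt
  simpa using h2

theorem inner_hasDerivAt_const {X : Type*} [NormedAddCommGroup X] [InnerProductSpace ℂ X]
    {a : ℝ → X} {a' : X} {t : ℝ} (ha : HasDerivAt a a' t) (y : X) :
    HasDerivAt (fun s => ⟪a s, y⟫_ℂ) ⟪a', y⟫_ℂ t := by
  simpa using ha.inner ℂ (hasDerivAt_const t y)

theorem inner_eq_of_mem_span {H : Type*} [NormedAddCommGroup H]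
    [InnerProductSpace ℂ H] {S : Set (H × H)} {y w : H} (h : ∀ p ∈ S, ⟪p.2, y⟫_ℂ = ⟪p.1, w⟫_ℂ) :
    ∀ p ∈ Submodule.span ℂ S, ⟪p.2, y⟫_ℂ = ⟪p.1, w⟫_ℂ := by
  intro p hp
  induction hp using Submodule.span_induction with
  | mem p hp => exact h p hp
  | zero => simp
  | add p q _ _ h1 h2 => rw [Prod.snd_add, Prod.fst_add, inner_add_left, inner_add_left, h1, h2]
  | smul c p _ h1 => rw [Prod.smul_snd, Prod.smul_fst, inner_smul_left, inner_smul_left, h1]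

end Derivatives

section SystemGroup

variable {𝓚 : Type v} [NormedAddCommGroup 𝓚] [InnerProductSpace ℂ 𝓚] [CompleteSpace 𝓚]
variable {R : Type u} [NormedAddCommGroup R] [InnerProductSpace ℂ R] [CompleteSpace R]

/-- `e^{-itK}` for a bounded operator `K`. -/
noncomputable def systemGroup (K : 𝓚 →L[ℂ] 𝓚) (t : ℝ) : 𝓚 →L[ℂ] 𝓚 :=
  NormedSpace.exp ((-(Complex.I * t)) • K)

theorem systemGroup_eq (K : 𝓚 →L[ℂ] 𝓚) (t : ℝ) :
    systemGroup K t = NormedSpace.exp (t • (-(Complex.I • K))) := by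
  rw [systemGroup]
  congr 1
  rw [smul_neg, neg_smul, mul_comm, mul_smul, Complex.coe_smul]

theorem isUnitaryGroupGeneratedBy_systemGroup {K : 𝓚 →L[ℂ] 𝓚} (hK : IsSelfAdjoint K) :
    IsUnitaryGroupGeneratedBy (LinearMap.graph (K : 𝓚 →ₗ[ℂ] 𝓚)) (systemGroup K) where
  zero := by simp [systemGroup, NormedSpace.exp_zero]
  add s t := by
    let _ : NormedAlgebra ℚ (𝓚 →L[ℂ] 𝓚) := NormedAlgebra.restrictScalars ℚ ℝ _
    rw [systemGroup_eq, systemGroup_eq, systemGroup_eq, add_smul, NormedSpace.exp_add_of_commute]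
    exact ((Commute.refl _).smul_left _).smul_right _
  norm_map t x := by
    rw [systemGroup_eq, norm_exp_smul_apply]
    rw [star_neg, star_smul, hK.star_eq]; simp
  continuous x := by
    refine continuous_iff_continuousAt.2 fun t => ?_
    simp only [systemGroup_eq]
    exact (hasDerivAt_exp_smul_apply _ x t).continuousAt
  hasDerivAt := by
    rintro ⟨x, y⟩ h
    have hy : y = K x := h
    subst hy
    simp only [systemGroup_eq]
    simpa [NormedSpace.exp_zero] using hasDerivAt_exp_smul_apply (-(Complex.I • K)) x 0

theorem systemGroup_comm (K : 𝓚 →L[ℂ] 𝓚) (t : ℝ) (k : 𝓚) :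
    K (systemGroup K t k) = systemGroup K t (K k) := by
  have h : Commute K (systemGroup K t) := ((Commute.refl K).smul_right _).exp_right
  exact congrArg (fun L : 𝓚 →L[ℂ] 𝓚 => L k) h

theorem hasDerivAt_systemGroup {K : 𝓚 →L[ℂ] 𝓚} (hK : IsSelfAdjoint K) (k : 𝓚) (t : ℝ) :
    HasDerivAt (fun s => systemGroup K s k) (-(Complex.I • K (systemGroup K t k))) t := by
  rw [systemGroup_comm]
  exact (isUnitaryGroupGeneratedBy_systemGroup hK).hasDerivAt_of_mem (p := (k, K k)) rfl t

/-- The unitary group preserves the domain of its generator and commutes with the generator. -/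
theorem IsSelfAdjoint.unitaryGroup_mem_domain {HR : R →ₗ.[ℂ] R} (hHR : IsSelfAdjoint HR) (t : ℝ)
    (f : HR.domain) : ∃ h : unitaryGroup HR.graph t f ∈ HR.domain,
      HR ⟨unitaryGroup HR.graph t f, h⟩ = unitaryGroup HR.graph t (HR f) := by
  have hcl : HR.graph.topologicalClosure = HR.graph :=
    IsClosed.submodule_topologicalClosure_eq hHR.isClosed
  have h := hHR.isEssentiallySelfAdjointGraph.unitaryGroup_mem t
    (p := ((f : R), HR f)) (by rw [hcl]; exact LinearPMap.mem_graph _ f)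
  rw [hcl, LinearPMap.mem_graph_iff] at h
  obtain ⟨y, h1, h2⟩ := h
  simp only at h1 h2
  have hm : unitaryGroup HR.graph t f ∈ HR.domain := h1 ▸ y.2
  refine ⟨hm, ?_⟩
  rw [← h2]
  congr 1
  exact Subtype.ext h1.symm

theorem IsSelfAdjoint.isUnitaryGroup {HR : R →ₗ.[ℂ] R} (hHR : IsSelfAdjoint HR) :
    IsUnitaryGroupGeneratedBy HR.graph (unitaryGroup HR.graph) :=
  hHR.isEssentiallySelfAdjointGraph.isUnitaryGroup

end SystemGroup

namespace CoupledModel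

variable {𝓚 : Type v} [NormedAddCommGroup 𝓚] [InnerProductSpace ℂ 𝓚] [CompleteSpace 𝓚]
variable {R : Type u} [NormedAddCommGroup R] [InnerProductSpace ℂ R]
variable {F : Type w} [NormedAddCommGroup F] [InnerProductSpace ℂ F] [CompleteSpace F]
variable {H : Type*} [NormedAddCommGroup H] [InnerProductSpace ℂ H] [CompleteSpace H]
variable (M : CoupledModel 𝓚 R F H)

/-- `H₀ = K + dΓ(H_R)` on the vector `k ⊗ Symⁿ (f₁ ⊗ ⋯ ⊗ fₙ)`. -/
noncomputable def freeVector (K : 𝓚 →L[ℂ] 𝓚) (HR : R →ₗ.[ℂ] R) (n : ℕ) (k : 𝓚)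
    (f : Fin n → HR.domain) : H :=
  M.vec n (K k) (fun i => (f i : R)) +
    ∑ j : Fin n, M.vec n k (Function.update (fun i => (f i : R)) j (HR (f j)))

variable {A : Type*} [Fintype A]

/-- `H_λ` on the vector `k ⊗ Symⁿ (f₁ ⊗ ⋯ ⊗ fₙ)`. -/
noncomputable def coupledVector (K : 𝓚 →L[ℂ] 𝓚) (HR : R →ₗ.[ℂ] R) (E : A → 𝓚 →L[ℂ] 𝓚) (v : A → R)
    (lam : ℝ) (n : ℕ) (k : 𝓚) (f : Fin n → HR.domain) : H :=
  M.freeVector K HR n k f + (lam : ℂ) • (M.fieldAnn E v n (M.vec n k fun i => (f i : R)) +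
    M.fieldCre E v (n + 1) (M.vec n k fun i => (f i : R)))

/-- The graph of `H_λ = K + dΓ(H_R) + λ (a(V) + a*(V))`, `V k = ∑ α, E α k ⊗ v α`, on the span of
the vectors `k ⊗ Symⁿ (f₁ ⊗ ⋯ ⊗ fₙ)` with all `fᵢ` in the domain of `H_R`. -/
noncomputable def coupledGraph (K : 𝓚 →L[ℂ] 𝓚) (HR : R →ₗ.[ℂ] R) (E : A → 𝓚 →L[ℂ] 𝓚) (v : A → R)
    (lam : ℝ) : Submodule ℂ (H × H) :=
  Submodule.span ℂ {p | ∃ (n : ℕ) (k : 𝓚) (f : Fin n → HR.domain),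
    p = (M.vec n k (fun i => (f i : R)), M.coupledVector K HR E v lam n k f)}

theorem mem_coupledGraph (K : 𝓚 →L[ℂ] 𝓚) (HR : R →ₗ.[ℂ] R) (E : A → 𝓚 →L[ℂ] 𝓚) (v : A → R)
    (lam : ℝ) (n : ℕ) (k : 𝓚) (f : Fin n → HR.domain) :
    (M.vec n k (fun i => (f i : R)), M.coupledVector K HR E v lam n k f) ∈
      M.coupledGraph K HR E v lam :=
  Submodule.subset_span ⟨n, k, f, rfl⟩

variable [CompleteSpace R]

/-- The free evolution of `k ⊗ Symⁿ (f₁ ⊗ ⋯ ⊗ fₙ)`. -/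
noncomputable def freeFlow (K : 𝓚 →L[ℂ] 𝓚) (HR : R →ₗ.[ℂ] R) (n : ℕ) (k : 𝓚)
    (f : Fin n → R) (t : ℝ) : H :=
  M.vec n (systemGroup K t k) fun i => unitaryGroup HR.graph t (f i)

theorem freeFlow_zero {K : 𝓚 →L[ℂ] 𝓚} (hK : IsSelfAdjoint K) {HR : R →ₗ.[ℂ] R}
    (hHR : IsSelfAdjoint HR) (n : ℕ) (k : 𝓚) (f : Fin n → R) :
    M.freeFlow K HR n k f 0 = M.vec n k f := by
  simp [freeFlow, (isUnitaryGroupGeneratedBy_systemGroup hK).zero, hHR.isUnitaryGroup.zero]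

theorem hasDerivAt_freeFlow {K : 𝓚 →L[ℂ] 𝓚} (hK : IsSelfAdjoint K) {HR : R →ₗ.[ℂ] R}
    (hHR : IsSelfAdjoint HR) (n : ℕ) (k : 𝓚) (f : Fin n → HR.domain) (t : ℝ) :
    ∃ f' : Fin n → HR.domain, (∀ i, (f' i : R) = unitaryGroup HR.graph t (f i)) ∧
      HasDerivAt (M.freeFlow K HR n k fun i => (f i : R))
        (-(Complex.I • M.freeVector K HR n (systemGroup K t k) f')) t := by
  choose hm heq using fun i => hHR.unitaryGroup_mem_domain t (f i)
  refine ⟨fun i => ⟨_, hm i⟩, fun i => rfl, ?_⟩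
  have h1 := hasDerivAt_systemGroup hK k t
  have h2 := HasDerivAt.multilinear (M.sym n) (f := fun i s => unitaryGroup HR.graph s (f i))
    (fun i => hHR.isUnitaryGroup.hasDerivAt_of_mem (p := ((f i : R), HR (f i)))
      (LinearPMap.mem_graph _ (f i)) t)
  have h3 := HasDerivAt.clm_bilinear M.tmul h1 h2
  refine HasDerivAt.congr_deriv (f := M.freeFlow K HR n k fun i => (f i : R)) h3 ?_
  rw [freeVector, smul_add, neg_add, Finset.smul_sum, ← Finset.sum_neg_distrib]
  refine congrArg₂ (fun x y : H => x + y) ?_ ?_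
  · rw [map_neg, map_smul]; rfl
  · rw [map_sum]
    refine Finset.sum_congr rfl fun j _ => ?_
    rw [heq, ← neg_smul, ← neg_smul, vec, ContinuousMultilinearMap.map_update_smul, map_smul]

theorem inner_freeFlow {K : 𝓚 →L[ℂ] 𝓚} (hK : IsSelfAdjoint K) {HR : R →ₗ.[ℂ] R}
    (hHR : IsSelfAdjoint HR) (n m : ℕ) (k l : 𝓚) (f : Fin n → R) (g : Fin m → R) (t : ℝ) :
    ⟪M.freeFlow K HR n k f t, M.freeFlow K HR m l g t⟫_ℂ =
      ⟪M.vec n k f, M.vec m l g⟫_ℂ := by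
  rw [freeFlow, freeFlow, vec, vec, vec, vec, M.inner_tmul, M.inner_tmul,
    (isUnitaryGroupGeneratedBy_systemGroup hK).inner_map_map]
  by_cases h : n = m
  · subst h
    rw [M.inner_sym_map n _ (hHR.isUnitaryGroup.inner_map_map t)]
  · rw [M.inner_sym_ne h, M.inner_sym_ne h]

theorem hasDerivAt_freeFlow_zero {K : 𝓚 →L[ℂ] 𝓚} (hK : IsSelfAdjoint K) {HR : R →ₗ.[ℂ] R}
    (hHR : IsSelfAdjoint HR) (n : ℕ) (k : 𝓚) (f : Fin n → HR.domain) :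
    HasDerivAt (M.freeFlow K HR n k fun i => (f i : R))
      (-(Complex.I • M.freeVector K HR n k f)) 0 := by
  obtain ⟨f', hf', hd⟩ := M.hasDerivAt_freeFlow hK hHR n k f 0
  have h1 : f' = f := funext fun i => Subtype.ext (by rw [hf', hHR.isUnitaryGroup.zero]; rfl)
  rw [(isUnitaryGroupGeneratedBy_systemGroup hK).zero, h1] at hd
  exact hd

/-- Symmetry of `H₀`: differentiate the inner products of two freely evolving vectors. -/
theorem inner_freeVector_left {K : 𝓚 →L[ℂ] 𝓚} (hK : IsSelfAdjoint K) {HR : R →ₗ.[ℂ] R}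
    (hHR : IsSelfAdjoint HR) (n m : ℕ) (k l : 𝓚) (f : Fin n → HR.domain) (g : Fin m → HR.domain) :
    ⟪M.freeVector K HR n k f, M.vec m l fun i => (g i : R)⟫_ℂ =
      ⟪M.vec n k fun i => (f i : R), M.freeVector K HR m l g⟫_ℂ := by
  have h1 := (M.hasDerivAt_freeFlow_zero hK hHR n k f).inner ℂ
    (M.hasDerivAt_freeFlow_zero hK hHR m l g)
  simp only [M.inner_freeFlow hK hHR] at h1
  have h2 := h1.unique (hasDerivAt_const _ _)
  rw [M.freeFlow_zero hK hHR, M.freeFlow_zero hK hHR, inner_neg_left, inner_neg_right,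
    inner_smul_left, inner_smul_right, Complex.conj_I] at h2
  have h3 := mul_left_cancel₀ Complex.I_ne_zero (by linear_combination h2 :
    Complex.I * ⟪M.freeVector K HR n k f, M.vec m l fun i => (g i : R)⟫_ℂ =
      Complex.I * ⟪M.vec n k fun i => (f i : R), M.freeVector K HR m l g⟫_ℂ)
  exact h3

theorem inner_coupledVector_left {K : 𝓚 →L[ℂ] 𝓚} (hK : IsSelfAdjoint K) {HR : R →ₗ.[ℂ] R}
    (hHR : IsSelfAdjoint HR) (E : A → 𝓚 →L[ℂ] 𝓚) (v : A → R) (lam : ℝ)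
    (n m : ℕ) (k l : 𝓚) (f : Fin n → HR.domain) (g : Fin m → HR.domain) :
    ⟪M.coupledVector K HR E v lam n k f, M.vec m l fun i => (g i : R)⟫_ℂ =
      ⟪M.vec n k fun i => (f i : R), M.coupledVector K HR E v lam m l g⟫_ℂ := by
  rw [coupledVector, coupledVector, inner_add_left, inner_add_right,
    M.inner_freeVector_left hK hHR, inner_smul_left, inner_smul_right, Complex.conj_ofReal,
    inner_add_left, inner_add_right, M.inner_fieldAnn_left, M.inner_fieldCre_left]
  rw [← M.sectorProj_vec_self n k, ← M.sectorProj_vec_self m l, M.inner_fieldCre_sectorProj,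
    M.inner_fieldAnn_sectorProj]
  ring

theorem coupledGraph_symm {K : 𝓚 →L[ℂ] 𝓚} (hK : IsSelfAdjoint K) {HR : R →ₗ.[ℂ] R}
    (hHR : IsSelfAdjoint HR) (E : A → 𝓚 →L[ℂ] 𝓚) (v : A → R) (lam : ℝ) :
    ∀ p ∈ M.coupledGraph K HR E v lam, ∀ q ∈ M.coupledGraph K HR E v lam,
      ⟪p.2, q.1⟫_ℂ = ⟪p.1, q.2⟫_ℂ := by
  intro p hp q hq
  refine inner_eq_of_mem_span ?_ p hp
  rintro _ ⟨n, k, f, rfl⟩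
  rw [← inner_conj_symm, ← inner_conj_symm (M.vec _ _ _)]
  congr 1
  refine (inner_eq_of_mem_span ?_ q hq).symm
  rintro _ ⟨m, l, g, rfl⟩
  exact M.inner_coupledVector_left hK hHR E v lam m n l k g f

theorem coupledGraph_dense (K : 𝓚 →L[ℂ] 𝓚) {HR : R →ₗ.[ℂ] R}
    (hHR : IsSelfAdjoint HR) (E : A → 𝓚 →L[ℂ] 𝓚) (v : A → R) (lam : ℝ) {y : H}
    (h : ∀ p ∈ M.coupledGraph K HR E v lam, ⟪p.1, y⟫_ℂ = 0) : y = 0 :=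
  M.eq_zero_of_inner_vec hHR.dense_domain fun n k f hf =>
    h _ (M.mem_coupledGraph K HR E v lam n k fun i => ⟨f i, hf i⟩)

/-- Along the free evolution `x` of a generator, `⟨x(t), y⟩` satisfies `g' = -s g` when `y` is
orthogonal to the range of `H₀ + is`; as it is bounded for all times, it vanishes. -/
theorem eq_zero_of_inner_freeVector {K : 𝓚 →L[ℂ] 𝓚} (hK : IsSelfAdjoint K) {HR : R →ₗ.[ℂ] R}
    (hHR : IsSelfAdjoint HR) {s : ℝ} (hs : s ≠ 0) {y : H}
    (h : ∀ (n : ℕ) (k : 𝓚) (f : Fin n → HR.domain),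
      ⟪M.freeVector K HR n k f + (Complex.I * s) • M.vec n k (fun i => (f i : R)), y⟫_ℂ = 0) :
    y = 0 := by
  refine M.eq_zero_of_inner_vec hHR.dense_domain fun n k f hf => ?_
  set f₀ : Fin n → HR.domain := fun i => ⟨f i, hf i⟩
  set g : ℝ → ℂ := fun t => ⟪M.freeFlow K HR n k f t, y⟫_ℂ with hg
  have hg' : ∀ t, HasDerivAt g (-(s : ℂ) * g t) t := by
    intro t
    obtain ⟨f', hf', hd⟩ := M.hasDerivAt_freeFlow hK hHR n k f₀ t
    refine (inner_hasDerivAt_const hd y).congr_deriv ?_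
    have h1 := h n (systemGroup K t k) f'
    have h2 : M.freeFlow K HR n k f t = M.vec n (systemGroup K t k) fun i => (f' i : R) := by
      rw [freeFlow]; simp only [hf']; rfl
    rw [inner_add_left, ← h2, inner_smul_left, map_mul, Complex.conj_I, Complex.conj_ofReal] at h1
    rw [inner_neg_left, inner_smul_left, Complex.conj_I]
    simp only [hg]
    linear_combination Complex.I * h1 + (s : ℂ) * ⟪M.freeFlow K HR n k f t, y⟫_ℂ * Complex.I_mul_I
  -- `g t = e^{-st} g 0`, which is bounded for all real `t` only if `g 0 = 0`
  have hconst : ∀ t : ℝ, Complex.exp (s * t) * g t = g 0 := by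
    intro t
    have hd : ∀ t : ℝ, HasDerivAt (fun t : ℝ => Complex.exp (s * t) * g t) 0 t := by
      intro t
      have h1 : HasDerivAt (fun t : ℝ => Complex.exp ((s : ℂ) * t)) (Complex.exp (s * t) * s) t := by
        have h0 : HasDerivAt (fun t : ℝ => (s : ℂ) * t) s t := by
          simpa using (Complex.ofRealCLM.hasDerivAt (x := t)).const_mul (s : ℂ)
        exact h0.cexp
      refine (h1.mul (hg' t)).congr_deriv ?_
      ring
    have := is_const_of_deriv_eq_zero (fun t => (hd t).differentiableAt) (fun t => (hd t).deriv) t 0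
    simpa using this
  have hbound : ∀ t : ℝ, ‖g 0‖ ≤ Real.exp (s * t) * (‖M.vec n k f‖ * ‖y‖) := by
    intro t
    rw [← hconst t, norm_mul, ← Complex.ofReal_mul, Complex.norm_exp_ofReal]
    refine mul_le_mul_of_nonneg_left ?_ (Real.exp_pos _).le
    refine (norm_inner_le_norm _ _).trans (le_of_eq ?_)
    congr 1
    have := M.inner_freeFlow hK hHR n n k k f f t
    rw [inner_self_eq_norm_sq_to_K, inner_self_eq_norm_sq_to_K] at this
    have h3 : ‖M.freeFlow K HR n k f t‖ ^ 2 = ‖M.vec n k f‖ ^ 2 := by exact_mod_cast this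
    exact (pow_left_inj₀ (norm_nonneg _) (norm_nonneg _) two_ne_zero).1 h3
  have hlim : Tendsto (fun r : ℝ => Real.exp (s * (r / s)) * (‖M.vec n k f‖ * ‖y‖)) atBot (𝓝 0) := by
    have h1 : (fun r : ℝ => Real.exp (s * (r / s)) * (‖M.vec n k f‖ * ‖y‖)) =
        fun r => Real.exp r * (‖M.vec n k f‖ * ‖y‖) := by
      funext r; rw [mul_div_cancel₀ _ hs]
    rw [h1]
    simpa using Real.tendsto_exp_atBot.mul_const (‖M.vec n k f‖ * ‖y‖)
  have hg0 : ‖g 0‖ ≤ 0 := ge_of_tendsto' hlim fun r => hbound (r / s)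
  have h5 : g 0 = 0 := norm_le_zero_iff.1 hg0
  rw [hg] at h5
  simpa only [M.freeFlow_zero hK hHR] using h5

/-- `H₀` is essentially self-adjoint on the span of the product vectors, since this span is
invariant under the free evolution. -/
theorem isEssentiallySelfAdjointGraph_free {K : 𝓚 →L[ℂ] 𝓚} (hK : IsSelfAdjoint K)
    {HR : R →ₗ.[ℂ] R} (hHR : IsSelfAdjoint HR) (E : A → 𝓚 →L[ℂ] 𝓚) (v : A → R) :
    IsEssentiallySelfAdjointGraph (M.coupledGraph K HR E v 0) where
  symm := M.coupledGraph_symm hK hHR E v 0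
  dense _ h := M.coupledGraph_dense K hHR E v 0 h
  range s hs y h := M.eq_zero_of_inner_freeVector hK hHR hs fun n k f => by
    have := h _ (M.mem_coupledGraph K HR E v 0 n k f)
    simpa [coupledVector] using this

end CoupledModel

/-! ### Essential self-adjointness of the coupled Hamiltonian -/

section Carleman

/-- Carleman's argument: a square summable sequence whose partial square sums are bounded by
`C √n aₙ₋₁ aₙ` vanishes, since `∑ 1 / n` diverges. -/
theorem eq_zero_of_sum_sq_le {a : ℕ → ℝ} {B C : ℝ} (ha : ∀ n, 0 ≤ a n)
    (hsum : ∀ N, ∑ n ∈ Finset.range N, a n ^ 2 ≤ B)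
    (h : ∀ n, ∑ i ∈ Finset.range (n + 1), a i ^ 2 ≤ C * Real.sqrt (n + 1) * (a n * a (n + 1)))
    (m : ℕ) : a m = 0 := by
  by_contra hm
  have hpos : 0 < a m ^ 2 := by have := (ha m).lt_of_ne' hm; positivity
  have hs : Summable fun n => a n ^ 2 :=
    summable_of_sum_range_le (fun n => sq_nonneg _) hsum
  have hs' : Summable fun n => a (n + 1) ^ 2 := (summable_nat_add_iff 1).2 hs
  have hlow : ∀ n, m ≤ n → a m ^ 2 ≤ ∑ i ∈ Finset.range (n + 1), a i ^ 2 := fun n hn =>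
    Finset.single_le_sum (f := fun i => a i ^ 2) (fun _ _ => sq_nonneg _) (by simpa using by omega)
  have hC : 0 < C := by
    by_contra hC
    have h1 := (hlow m le_rfl).trans (h m)
    have h2 : 0 ≤ Real.sqrt (m + 1) * (a m * a (m + 1)) :=
      mul_nonneg (Real.sqrt_nonneg _) (mul_nonneg (ha _) (ha _))
    nlinarith
  have hle : ∀ n, m ≤ n → 1 / ((n + 1 : ℕ) : ℝ) ≤ C / a m ^ 2 * (a n ^ 2 + a (n + 1) ^ 2) := by
    intro n hn
    have h1 := (hlow n hn).trans (h n)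
    set r := Real.sqrt (n + 1) with hr
    have hr1 : 1 ≤ r := by
      rw [hr]; exact Real.one_le_sqrt.2 (by linarith [(Nat.cast_nonneg n : (0 : ℝ) ≤ n)])
    have hrr : r * r = n + 1 := Real.mul_self_sqrt (by positivity)
    have h2 : a n * a (n + 1) ≤ a n ^ 2 + a (n + 1) ^ 2 := by
      nlinarith [sq_nonneg (a n - a (n + 1)), sq_nonneg (a n), sq_nonneg (a (n + 1))]
    have h3 : a m ^ 2 ≤ C * r * (a n ^ 2 + a (n + 1) ^ 2) :=
      h1.trans (mul_le_mul_of_nonneg_left h2 (by positivity))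
    push_cast
    rw [← hrr, div_mul_eq_mul_div, div_le_div_iff₀ (by positivity) hpos]
    have h4 : 0 ≤ C * r * (a n ^ 2 + a (n + 1) ^ 2) := by positivity
    nlinarith
  have hsummable : Summable fun n : ℕ => 1 / ((n + 1 : ℕ) : ℝ) := by
    rw [← summable_nat_add_iff m]
    refine Summable.of_nonneg_of_le (fun n => by positivity) (fun n => hle (n + m) (by omega)) ?_
    exact (summable_nat_add_iff m).2 ((hs.add hs').mul_left _)
  exact Real.not_summable_one_div_natCast
    ((summable_nat_add_iff (f := fun n : ℕ => 1 / (n : ℝ)) 1).1 hsummable)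

end Carleman

namespace CoupledModel

variable {𝓚 : Type v} [NormedAddCommGroup 𝓚] [InnerProductSpace ℂ 𝓚] [CompleteSpace 𝓚]
variable {R : Type u} [NormedAddCommGroup R] [InnerProductSpace ℂ R] [CompleteSpace R]
variable {F : Type w} [NormedAddCommGroup F] [InnerProductSpace ℂ F] [CompleteSpace F]
variable {H : Type*} [NormedAddCommGroup H] [InnerProductSpace ℂ H] [CompleteSpace H]
variable (M : CoupledModel 𝓚 R F H)
variable {A : Type*} [Fintype A]

/-- If `y` is orthogonal to the range of `H_λ + is`, its `n`-particle part is in the domain of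
the closure of `H₀`; the symmetry of `H₀` then yields this balance equation between the
sectors. -/
theorem norm_sq_sectorProj_eq {K : 𝓚 →L[ℂ] 𝓚} (hK : IsSelfAdjoint K) {HR : R →ₗ.[ℂ] R}
    (hHR : IsSelfAdjoint HR) (E : A → 𝓚 →L[ℂ] 𝓚) (v : A → R) (lam s : ℝ) {y : H}
    (h : ∀ p ∈ M.coupledGraph K HR E v lam, ⟪p.2 + (Complex.I * s) • p.1, y⟫_ℂ = 0) (n : ℕ) :
    s * ‖M.sectorProj n y‖ ^ 2 =
      lam * ((⟪y, M.fieldAnn E v (n + 1) y⟫_ℂ).im - (⟪y, M.fieldAnn E v n y⟫_ℂ).im) := by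
  set φ := M.fieldCre E v n y + M.fieldAnn E v (n + 1) y with hφ
  have hφP : M.sectorProj n φ = φ := by
    rw [hφ, map_add, M.sectorProj_fieldCre, M.sectorProj_fieldAnn]
  have hmem := (M.isEssentiallySelfAdjointGraph_free hK hHR E v).mem_closure_of_adjoint
    (y := M.sectorProj n y)
    (w := -((lam : ℂ) • φ) + (Complex.I * s) • M.sectorProj n y) (by
      refine inner_eq_of_mem_span ?_
      rintro _ ⟨m, k, f, rfl⟩
      have hfree : M.coupledVector K HR E v 0 m k f = M.freeVector K HR m k f := by
        simp [coupledVector]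
      have hsec : M.sectorProj m (M.freeVector K HR m k f) = M.freeVector K HR m k f := by
        simp only [freeVector, map_add, map_sum, M.sectorProj_vec_self]
      simp only [hfree]
      by_cases hmn : m = n
      · subst hmn
        have h1 := h _ (M.mem_coupledGraph K HR E v lam m k f)
        simp only [coupledVector] at h1
        rw [inner_add_left, inner_add_left, inner_smul_left, inner_add_left, inner_smul_left,
          M.inner_fieldAnn_left, M.inner_fieldCre_left, map_mul, Complex.conj_I,
          Complex.conj_ofReal, Complex.conj_ofReal] at h1
        rw [inner_add_right, inner_neg_right, inner_smul_right, inner_smul_right,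
          ← M.inner_sectorProj, hsec, ← M.inner_sectorProj, M.sectorProj_vec_self, hφ,
          inner_add_right]
        linear_combination h1
      · have h0 : ∀ z, ⟪M.vec m k (fun i => (f i : R)), M.sectorProj n z⟫_ℂ = 0 := fun z => by
          rw [← M.inner_sectorProj, M.sectorProj_vec_ne (Ne.symm hmn), inner_zero_left]
        rw [← hφP, inner_add_right, inner_neg_right, inner_smul_right, inner_smul_right, h0, h0,
          ← hsec, ← M.inner_sectorProj, M.sectorProj_apply_ne (Ne.symm hmn), inner_zero_left]
        simp)
  have hsym := (M.isEssentiallySelfAdjointGraph_free hK hHR E v).symm_closure _ hmem _ hmem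
  simp only at hsym
  have him : (⟪M.sectorProj n y, -((lam : ℂ) • φ) + (Complex.I * s) • M.sectorProj n y⟫_ℂ).im = 0 := by
    have h2 := congrArg Complex.im hsym
    rw [← inner_conj_symm, Complex.conj_im] at h2
    linarith
  rw [inner_add_right, inner_neg_right, inner_smul_right, inner_smul_right,
    inner_self_eq_norm_sq_to_K, M.inner_sectorProj, hφP, hφ, inner_add_right,
    ← M.inner_fieldAnn_left] at him
  have h4 : (⟪M.fieldAnn E v n y, y⟫_ℂ).im = -(⟪y, M.fieldAnn E v n y⟫_ℂ).im := by
    rw [← inner_conj_symm, Complex.conj_im]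
  have h3 : ((‖M.sectorProj n y‖ : ℂ) ^ 2) = ((‖M.sectorProj n y‖ ^ 2 : ℝ) : ℂ) := by push_cast; rfl
  simp only [Complex.coe_algebraMap, h3] at him
  simp [-Complex.ofReal_pow] at him
  rw [h4] at him
  linarith

/-- `H_λ` is essentially self-adjoint. For `y` orthogonal to the range of `H_λ + is`, summing the
balance equations over the sectors up to `n` leaves only the boundary term `⟨y, a(V) y⟩` between the
sectors `n` and `n + 1`, which is of order `√n`; Carleman's argument then gives `y = 0`. -/
theorem isEssentiallySelfAdjointGraph_coupled {K : 𝓚 →L[ℂ] 𝓚} (hK : IsSelfAdjoint K)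
    {HR : R →ₗ.[ℂ] R} (hHR : IsSelfAdjoint HR) (E : A → 𝓚 →L[ℂ] 𝓚) (v : A → R) (lam : ℝ) :
    IsEssentiallySelfAdjointGraph (M.coupledGraph K HR E v lam) where
  symm := M.coupledGraph_symm hK hHR E v lam
  dense _ h := M.coupledGraph_dense K hHR E v lam h
  range s hs y h := by
    refine M.eq_zero_of_sectorProj fun n => norm_eq_zero.1 ?_
    set c := ∑ α, ‖E α‖ * ‖v α‖ with hc
    refine eq_zero_of_sum_sq_le (a := fun n => ‖M.sectorProj n y‖) (B := ‖y‖ ^ 2)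
      (C := |s|⁻¹ * |lam| * c)
      (fun _ => norm_nonneg _) (fun N => M.sum_norm_sq_sectorProj_le N y) (fun n => ?_) n
    have htel : s * ∑ i ∈ Finset.range (n + 1), ‖M.sectorProj i y‖ ^ 2 =
        lam * (⟪y, M.fieldAnn E v (n + 1) y⟫_ℂ).im := by
      rw [Finset.mul_sum]
      simp only [M.norm_sq_sectorProj_eq hK hHR E v lam s h]
      rw [← Finset.mul_sum, Finset.sum_range_sub (fun i => (⟪y, M.fieldAnn E v i y⟫_ℂ).im),
        M.fieldAnn_zero]
      simp
    have hd : |(⟪y, M.fieldAnn E v (n + 1) y⟫_ℂ).im| ≤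
        c * Real.sqrt (n + 1) * (‖M.sectorProj n y‖ * ‖M.sectorProj (n + 1) y‖) := by
      refine (Complex.abs_im_le_norm _).trans ?_
      rw [← M.sectorProj_fieldAnn, ← M.inner_sectorProj, ← M.fieldAnn_sectorProj]
      refine (norm_inner_le_norm _ _).trans ?_
      have h1 := (M.fieldAnn E v (n + 1)).le_of_opNorm_le (M.norm_fieldAnn_le E v (n + 1))
        (M.sectorProj (n + 1) y)
      push_cast at h1
      calc _ ≤ ‖M.sectorProj n y‖ * (c * Real.sqrt (n + 1) * ‖M.sectorProj (n + 1) y‖) :=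
            mul_le_mul_of_nonneg_left h1 (norm_nonneg _)
        _ = _ := by ring
    have hs' : 0 < |s| := abs_pos.2 hs
    have h5 : |s| * ∑ i ∈ Finset.range (n + 1), ‖M.sectorProj i y‖ ^ 2 =
        |lam| * |(⟪y, M.fieldAnn E v (n + 1) y⟫_ℂ).im| := by
      rw [← abs_mul, ← htel, abs_mul]
      congr 1
      exact (abs_of_nonneg (Finset.sum_nonneg fun _ _ => sq_nonneg _)).symm
    rw [mul_assoc, mul_assoc, mul_assoc, le_inv_mul_iff₀ hs', h5]
    calc _ ≤ |lam| * (c * Real.sqrt (n + 1) * (‖M.sectorProj n y‖ * ‖M.sectorProj (n + 1) y‖)) :=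
          mul_le_mul_of_nonneg_left hd (abs_nonneg _)
      _ = _ := by ring

end CoupledModel

/-! ### The interaction picture -/

section WeakDerivative

/-- A curve with a continuous weak derivative, tested on a separating set of vectors, is
differentiable. -/
theorem hasDerivAt_of_weak {H : Type*} [NormedAddCommGroup H] [InnerProductSpace ℂ H]
    [CompleteSpace H] {S : Set H} (hS : ∀ z : H, (∀ x ∈ S, ⟪x, z⟫_ℂ = 0) → z = 0) {w c : ℝ → H}
    (hc : Continuous c) (h : ∀ x ∈ S, ∀ t, HasDerivAt (fun t => ⟪x, w t⟫_ℂ) ⟪x, c t⟫_ℂ t) (t : ℝ) :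
    HasDerivAt w (c t) t := by
  have hint : ∀ t, HasDerivAt (fun t => ∫ r in (0 : ℝ)..t, c r) (c t) t := fun t =>
    intervalIntegral.integral_hasDerivAt_right (hc.intervalIntegrable _ _)
      (hc.stronglyMeasurableAtFilter _ _) hc.continuousAt
  have heq : ∀ t, w t = w 0 + ∫ r in (0 : ℝ)..t, c r := by
    intro t
    rw [← sub_eq_zero]
    refine hS _ fun x hx => ?_
    have hd : ∀ t, HasDerivAt (fun t => ⟪x, w t - (w 0 + ∫ r in (0 : ℝ)..t, c r)⟫_ℂ) 0 t := by
      intro t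
      have h1 : HasDerivAt (fun t => ⟪x, ∫ r in (0 : ℝ)..t, c r⟫_ℂ) ⟪x, c t⟫_ℂ t := by
        simpa using (hasDerivAt_const t x).inner ℂ (hint t)
      simp only [inner_sub_right, inner_add_right]
      refine ((h x hx t).sub (h1.const_add ⟪x, w 0⟫_ℂ)).congr_deriv ?_
      simp
    have := is_const_of_deriv_eq_zero (fun t => (hd t).differentiableAt) (fun t => (hd t).deriv) t 0
    simpa using this
  rw [funext heq]
  exact (hint t).const_add _

end WeakDerivative

/-- The data of a Pauli-Fierz Hamiltonian: `K`, `H_R` and `V k = ∑ α, E α k ⊗ v α`. -/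
structure Coupling (𝓚 : Type v) [NormedAddCommGroup 𝓚] [InnerProductSpace ℂ 𝓚] [CompleteSpace 𝓚]
    (R : Type u) [NormedAddCommGroup R] [InnerProductSpace ℂ R] [CompleteSpace R]
    (A : Type*) [Fintype A] where
  K : 𝓚 →L[ℂ] 𝓚
  isSelfAdjoint_K : IsSelfAdjoint K
  HR : R →ₗ.[ℂ] R
  isSelfAdjoint_HR : IsSelfAdjoint HR
  E : A → 𝓚 →L[ℂ] 𝓚
  v : A → R

namespace Coupling

variable {𝓚 : Type v} [NormedAddCommGroup 𝓚] [InnerProductSpace ℂ 𝓚] [CompleteSpace 𝓚]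
variable {R : Type u} [NormedAddCommGroup R] [InnerProductSpace ℂ R] [CompleteSpace R]
variable {A : Type*} [Fintype A]
variable (D : Coupling 𝓚 R A)

theorem isUnitaryGroup_K :
    IsUnitaryGroupGeneratedBy (LinearMap.graph (D.K : 𝓚 →ₗ[ℂ] 𝓚)) (systemGroup D.K) :=
  isUnitaryGroupGeneratedBy_systemGroup D.isSelfAdjoint_K

theorem isUnitaryGroup_HR :
    IsUnitaryGroupGeneratedBy D.HR.graph (unitaryGroup D.HR.graph) :=
  D.isSelfAdjoint_HR.isUnitaryGroup

/-- The Heisenberg evolution `e^{itK} B e^{-itK}`. -/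
noncomputable def heis (t : ℝ) (B : 𝓚 →L[ℂ] 𝓚) : 𝓚 →L[ℂ] 𝓚 :=
  systemGroup D.K (-t) ∘L B ∘L systemGroup D.K t

/-- The system parts of the coupling in the interaction picture. -/
noncomputable def opAt (t : ℝ) (α : A) : 𝓚 →L[ℂ] 𝓚 := D.heis t (D.E α)

/-- The form factors of the coupling in the interaction picture. -/
noncomputable def vecAt (t : ℝ) (α : A) : R := unitaryGroup D.HR.graph (-t) (D.v α)

theorem adjoint_systemGroup (t : ℝ) :
    ContinuousLinearMap.adjoint (systemGroup D.K t) = systemGroup D.K (-t) := by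
  ext x
  refine ext_inner_left ℂ fun y => ?_
  rw [ContinuousLinearMap.adjoint_inner_right, D.isUnitaryGroup_K.inner_left]

theorem adjoint_heis (t : ℝ) (B : 𝓚 →L[ℂ] 𝓚) :
    ContinuousLinearMap.adjoint (D.heis t B) = D.heis t (ContinuousLinearMap.adjoint B) := by
  rw [heis, heis, ContinuousLinearMap.adjoint_comp, ContinuousLinearMap.adjoint_comp,
    D.adjoint_systemGroup, D.adjoint_systemGroup, neg_neg]
  rfl

theorem norm_heis_le (t : ℝ) (B : 𝓚 →L[ℂ] 𝓚) : ‖D.heis t B‖ ≤ ‖B‖ := by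
  refine ContinuousLinearMap.opNorm_le_bound _ (norm_nonneg _) fun x => ?_
  rw [heis, ContinuousLinearMap.comp_apply, ContinuousLinearMap.comp_apply,
    D.isUnitaryGroup_K.norm_map]
  refine (B.le_opNorm _).trans ?_
  rw [D.isUnitaryGroup_K.norm_map]

theorem norm_opAt_le (t : ℝ) (α : A) : ‖D.opAt t α‖ ≤ ‖D.E α‖ := D.norm_heis_le t _

theorem norm_vecAt (t : ℝ) (α : A) : ‖D.vecAt t α‖ = ‖D.v α‖ :=
  D.isUnitaryGroup_HR.norm_map _ _

theorem continuous_vecAt (α : A) : Continuous fun t => D.vecAt t α :=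
  D.isUnitaryGroup_HR.continuous_apply continuous_neg continuous_const

theorem continuous_heis (B : 𝓚 →L[ℂ] 𝓚) : Continuous fun t => D.heis t B := by
  have h : Continuous (systemGroup D.K) := by
    let _ : NormedAlgebra ℚ (𝓚 →L[ℂ] 𝓚) := NormedAlgebra.restrictScalars ℚ ℝ _
    unfold systemGroup
    exact NormedSpace.exp_continuous.comp (by fun_prop)
  exact (h.comp continuous_neg).clm_comp (continuous_const.clm_comp h)

theorem continuous_opAt (α : A) : Continuous fun t => D.opAt t α := D.continuous_heis _

end Coupling

namespace CoupledModel

variable {𝓚 : Type v} [NormedAddCommGroup 𝓚] [InnerProductSpace ℂ 𝓚] [CompleteSpace 𝓚]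
variable {R : Type u} [NormedAddCommGroup R] [InnerProductSpace ℂ R] [CompleteSpace R]
variable {F : Type w} [NormedAddCommGroup F] [InnerProductSpace ℂ F] [CompleteSpace F]
variable {H : Type*} [NormedAddCommGroup H] [InnerProductSpace ℂ H] [CompleteSpace H]
variable (M : CoupledModel 𝓚 R F H)
variable {A : Type*} [Fintype A]
variable (D : Coupling 𝓚 R A)

/-- `e^{-itH_λ}`. -/
noncomputable def group (lam t : ℝ) : H →L[ℂ] H :=
  unitaryGroup (M.coupledGraph D.K D.HR D.E D.v lam) t

theorem isUnitaryGroup (lam : ℝ) : IsUnitaryGroupGeneratedBy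
    (M.coupledGraph D.K D.HR D.E D.v lam) (M.group D lam) :=
  (M.isEssentiallySelfAdjointGraph_coupled D.isSelfAdjoint_K D.isSelfAdjoint_HR
    D.E D.v lam).isUnitaryGroup

/-- The free evolution of a product vector is the product of the evolutions of its factors. -/
theorem group_zero_vec (n : ℕ) (k : 𝓚) (f : Fin n → D.HR.domain) (t : ℝ) :
    M.group D 0 t (M.vec n k fun i => (f i : R)) =
      M.freeFlow D.K D.HR n k (fun i => (f i : R)) t := by
  set x : ℝ → H := M.freeFlow D.K D.HR n k fun i => (f i : R) with hx
  have hU := M.isUnitaryGroup D 0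
  have hU' : ∀ y, Continuous fun s => M.group D 0 (t - s) y := fun y =>
    (hU.continuous y).comp (continuous_const.sub continuous_id)
  -- `s ↦ e^{-i(t-s)H₀} x(s)` is constant along the explicit solution `x`
  have hd : ∀ s, HasDerivAt (fun s => M.group D 0 (t - s) (x s)) 0 s := by
    intro s
    obtain ⟨f', hf', hd⟩ := M.hasDerivAt_freeFlow D.isSelfAdjoint_K D.isSelfAdjoint_HR n k f s
    have h1 := M.mem_coupledGraph D.K D.HR D.E D.v 0 n (systemGroup D.K s k) f'
    have h2 : x s = M.vec n (systemGroup D.K s k) fun i => (f' i : R) := by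
      rw [hx, freeFlow]; simp only [hf']
    have h3 : M.coupledVector D.K D.HR D.E D.v 0 n (systemGroup D.K s k) f' =
        M.freeVector D.K D.HR n (systemGroup D.K s k) f' := by simp [coupledVector]
    rw [h3, ← h2] at h1
    have h4 := HasDerivAt.comp_const_sub t s (hU.hasDerivAt_of_mem h1 (t - s))
    refine (HasDerivAt.strong_apply (U := fun s => M.group D 0 (t - s)) hU'
      (fun s y => hU.norm_le (t - s) y) h4 hd).congr_deriv ?_
    rw [map_neg, map_smul]; simp
  have := is_const_of_deriv_eq_zero (fun t => (hd t).differentiableAt) (fun t => (hd t).deriv) 0 t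
  simp only [sub_zero, sub_self, hU.zero] at this
  rw [hx, M.freeFlow_zero D.isSelfAdjoint_K D.isSelfAdjoint_HR] at this
  exact this

theorem exists_group_zero_vec (n : ℕ) (k : 𝓚) (f : Fin n → D.HR.domain) (t : ℝ) :
    ∃ f' : Fin n → D.HR.domain, (∀ i, (f' i : R) = unitaryGroup D.HR.graph t (f i)) ∧
      M.group D 0 t (M.vec n k fun i => (f i : R)) =
        M.vec n (systemGroup D.K t k) fun i => (f' i : R) := by
  choose hm _ using fun i => D.isSelfAdjoint_HR.unitaryGroup_mem_domain t (f i)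
  exact ⟨fun i => ⟨_, hm i⟩, fun i => rfl, M.group_zero_vec D n k f t⟩

/-- The free evolution implements the Heisenberg evolution of the system operators and the
evolution of the one-particle vectors. -/
theorem group_zero_op_ann (t : ℝ) (B : 𝓚 →L[ℂ] 𝓚) (n : ℕ) (g : R) (x : H) :
    M.op B (M.ann n g) (M.group D 0 t x) =
      M.group D 0 t (M.op (D.heis t B) (M.ann n (unitaryGroup D.HR.graph (-t) g)) x) := by
  suffices h : M.op B (M.ann n g) ∘L M.group D 0 t =
      M.group D 0 t ∘L M.op (D.heis t B) (M.ann n (unitaryGroup D.HR.graph (-t) g)) from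
    congrArg (fun L : H →L[ℂ] H => L x) h
  refine M.clm_ext_of_dense D.isSelfAdjoint_HR.dense_domain fun m k f hf => ?_
  obtain ⟨f', hf', h1⟩ := M.exists_group_zero_vec D m k (fun i => ⟨f i, hf i⟩) t
  simp only [ContinuousLinearMap.comp_apply]
  rw [h1]
  by_cases h : n = m
  · subst h
    cases n with
    | zero => simp only [M.ann_zero, M.op_zero_right, zero_apply, map_zero]
    | succ n =>
      simp only [vec, M.op_tmul, M.ann_succ_sym, map_smul, map_sum]
      congr 1
      refine Finset.sum_congr rfl fun j _ => ?_
      obtain ⟨f'', hf'', h2⟩ := M.exists_group_zero_vec D n (D.heis t B k)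
        (fun i => ⟨f (j.succAbove i), hf _⟩) t
      simp only [vec] at h2
      rw [h2]
      have h3 : systemGroup D.K t (D.heis t B k) = B (systemGroup D.K t k) :=
        D.isUnitaryGroup_K.apply_neg t _
      rw [h3, hf', D.isUnitaryGroup_HR.inner_left, neg_neg]
      simp only [hf', hf'']
  · simp only [vec, M.op_tmul, M.ann_sym_ne h, map_zero]

theorem fieldAnn_group_zero (t : ℝ) (n : ℕ) (x : H) :
    M.fieldAnn D.E D.v n (M.group D 0 t x) =
      M.group D 0 t (M.fieldAnn (D.opAt t) (D.vecAt t) n x) := by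
  simp only [fieldAnn, sum_apply, map_sum, M.group_zero_op_ann, Coupling.opAt, D.adjoint_heis]
  rfl

theorem fieldCre_group_zero (t : ℝ) (n : ℕ) (x : H) :
    M.fieldCre D.E D.v n (M.group D 0 t x) =
      M.group D 0 t (M.fieldCre (D.opAt t) (D.vecAt t) n x) := by
  have hU := M.isUnitaryGroup D 0
  refine ext_inner_left ℂ fun y => ?_
  rw [← M.inner_fieldAnn_left, ← hU.apply_neg t y, M.fieldAnn_group_zero, hU.inner_map_map,
    hU.inner_map_map, M.inner_fieldAnn_left]

/-- The propagator `e^{itH₀} e^{-i(t-s)H_λ} e^{-isH₀}` in the interaction picture. -/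
noncomputable def prop (lam t s : ℝ) : H →L[ℂ] H :=
  M.group D 0 (-t) * M.group D lam (t - s) * M.group D 0 s

theorem prop_apply (lam t s : ℝ) (x : H) :
    M.prop D lam t s x = M.group D 0 (-t) (M.group D lam (t - s) (M.group D 0 s x)) := rfl

theorem norm_prop (lam t s : ℝ) (x : H) : ‖M.prop D lam t s x‖ = ‖x‖ := by
  rw [prop_apply, (M.isUnitaryGroup D 0).norm_map, (M.isUnitaryGroup D lam).norm_map,
    (M.isUnitaryGroup D 0).norm_map]

theorem prop_self (lam t : ℝ) (x : H) : M.prop D lam t t x = x := by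
  rw [prop_apply, sub_self, (M.isUnitaryGroup D lam).zero, one_apply_eq_self,
    (M.isUnitaryGroup D 0).neg_apply]

theorem prop_prop (lam t s r : ℝ) (x : H) :
    M.prop D lam t s (M.prop D lam s r x) = M.prop D lam t r x := by
  rw [prop_apply, prop_apply, (M.isUnitaryGroup D 0).apply_neg, ← mul_apply_eq_comp (M.group D lam _),
    ← (M.isUnitaryGroup D lam).add, prop_apply]
  congr 3
  ring_nf

theorem continuous_prop (lam : ℝ) {α : Type*} [TopologicalSpace α] {t s : α → ℝ} {x : α → H}
    (ht : Continuous t) (hs : Continuous s) (hx : Continuous x) :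
    Continuous fun a => M.prop D lam (t a) (s a) (x a) :=
  (M.isUnitaryGroup D 0).continuous_apply ht.neg ((M.isUnitaryGroup D lam).continuous_apply
    (ht.sub hs) ((M.isUnitaryGroup D 0).continuous_apply hs hx))

/-- The component in the `n`-particle sector of the field operator `a(V) + a*(V)` in the
interaction picture. -/
noncomputable def fieldAt (n : ℕ) (t : ℝ) : H →L[ℂ] H :=
  M.fieldCre (D.opAt t) (D.vecAt t) n + M.fieldAnn (D.opAt t) (D.vecAt t) (n + 1)

theorem fieldAt_apply (n : ℕ) (t : ℝ) (x : H) : M.fieldAt D n t x =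
    M.group D 0 (-t) (M.fieldCre D.E D.v n (M.group D 0 t x) +
      M.fieldAnn D.E D.v (n + 1) (M.group D 0 t x)) := by
  rw [M.fieldAnn_group_zero, M.fieldCre_group_zero, ← map_add, (M.isUnitaryGroup D 0).neg_apply]
  rfl

theorem continuous_fieldAt (n : ℕ) {x : ℝ → H} (hx : Continuous x) :
    Continuous fun t => M.fieldAt D n t (x t) := by
  simp only [fieldAt_apply]
  have h := (M.isUnitaryGroup D 0).continuous_apply continuous_id hx
  exact (M.isUnitaryGroup D 0).continuous_apply continuous_neg
    (((M.fieldCre D.E D.v n).continuous.comp h).add ((M.fieldAnn D.E D.v (n + 1)).continuous.comp h))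

theorem sectorProj_fieldAt (n : ℕ) (t : ℝ) (x : H) :
    M.sectorProj n (M.fieldAt D n t x) = M.fieldAt D n t x := by
  rw [fieldAt, add_apply, map_add, M.sectorProj_fieldCre, M.sectorProj_fieldAnn]

/-- The evolution equation of the propagator, sector by sector. -/
theorem hasDerivAt_sectorProj_prop (lam s : ℝ) (ξ : H) (n : ℕ) (t : ℝ) :
    HasDerivAt (fun t => M.sectorProj n (M.prop D lam t s ξ))
      (-(Complex.I * lam) • M.fieldAt D n t (M.prop D lam t s ξ)) t := by
  have hW : Continuous fun t => M.prop D lam t s ξ :=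
    M.continuous_prop D lam continuous_id continuous_const continuous_const
  refine hasDerivAt_of_weak
    (S := {x | ∃ (m : ℕ) (k : 𝓚) (f : Fin m → D.HR.domain), x = M.vec m k fun i => (f i : R)})
    (c := fun t => -(Complex.I * lam) • M.fieldAt D n t (M.prop D lam t s ξ))
    (fun z hz => M.eq_zero_of_inner_vec D.isSelfAdjoint_HR.dense_domain fun m k f hf =>
      hz _ ⟨m, k, fun i => ⟨f i, hf i⟩, rfl⟩)
    ((M.continuous_fieldAt D n hW).const_smul _) ?_ t
  rintro _ ⟨m, k, f, rfl⟩ t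
  by_cases hmn : m = n
  swap
  · simp only [inner_smul_right]
    rw [← M.sectorProj_fieldAt]
    simp only [← M.inner_sectorProj, M.sectorProj_vec_ne (Ne.symm hmn), inner_zero_left, mul_zero]
    exact hasDerivAt_const _ _
  subst hmn
  have hU0 := M.isUnitaryGroup D 0
  have hU := M.isUnitaryGroup D lam
  -- It suffices to differentiate `⟨vec, W(t,s) ξ⟩ = ⟨e^{-i(s-t)H_λ} x(t), e^{-isH₀} ξ⟩`, where `x`
  -- is the free evolution of a product vector; `x(t)` is again a product vector over the domain, so
  -- both factors may be differentiated and the contributions of `H₀` cancel.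
  set x : ℝ → H := fun t => M.group D 0 t (M.vec m k fun i => (f i : R)) with hx
  have hxd : ∀ t, HasDerivAt x (-(Complex.I • M.group D 0 t (M.freeVector D.K D.HR m k f))) t := by
    intro t
    have h1 := M.mem_coupledGraph D.K D.HR D.E D.v 0 m k f
    have h3 : M.coupledVector D.K D.HR D.E D.v 0 m k f = M.freeVector D.K D.HR m k f := by
      simp [coupledVector]
    rw [h3] at h1
    exact hU0.hasDerivAt_of_mem h1 t
  obtain ⟨f', hf', hxt⟩ := M.exists_group_zero_vec D m k f t
  have hfree : M.group D 0 t (M.freeVector D.K D.HR m k f) =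
      M.freeVector D.K D.HR m (systemGroup D.K t k) f' := by
    obtain ⟨f'', hf'', hd⟩ := M.hasDerivAt_freeFlow D.isSelfAdjoint_K D.isSelfAdjoint_HR m k f t
    have h1 : f'' = f' := funext fun i => Subtype.ext ((hf'' i).trans (hf' i).symm)
    have h2 := (hxd t).unique (hd.congr_of_eventuallyEq
      (Eventually.of_forall fun r => M.group_zero_vec D m k f r))
    rw [h1, neg_inj] at h2
    exact smul_right_injective H Complex.I_ne_zero h2
  have hmem := M.mem_coupledGraph D.K D.HR D.E D.v lam m (systemGroup D.K t k) f'
  rw [← hxt] at hmem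
  have h4 := HasDerivAt.comp_const_sub s t (hU.hasDerivAt_of_mem hmem (s - t))
  have h5 := HasDerivAt.strong_apply (U := fun t => M.group D lam (s - t))
    (fun y => (hU.continuous y).comp (continuous_const.sub continuous_id))
    (fun t y => hU.norm_le (s - t) y) (y := x) (t := t) h4 (hxd t)
  have h6 := inner_hasDerivAt_const h5 (M.group D 0 s ξ)
  have h7 : (fun t => ⟪M.vec m k fun i => (f i : R), M.sectorProj m (M.prop D lam t s ξ)⟫_ℂ) =
      fun t => ⟪M.group D lam (s - t) (x t), M.group D 0 s ξ⟫_ℂ := by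
    funext t
    rw [← M.inner_sectorProj, M.sectorProj_vec_self, hU.inner_left, prop_apply, ← hU0.inner_left, hx,
      neg_sub]
  rw [h7]
  refine h6.congr_deriv ?_
  rw [hfree, map_neg, map_smul, neg_neg, ← sub_eq_add_neg, ← smul_sub, ← map_sub, coupledVector,
    add_sub_cancel_left, inner_smul_left, hU.inner_left, neg_sub, inner_smul_left,
    inner_add_left, ← hxt, M.inner_fieldAnn_left, M.inner_fieldCre_left, inner_smul_right,
    M.fieldAt_apply, ← hU0.inner_left, inner_add_right]
  have h8 : M.group D lam (t - s) (M.group D 0 s ξ) = M.group D 0 t (M.prop D lam t s ξ) := by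
    rw [prop_apply, hU0.apply_neg]
  rw [h8, Complex.conj_I, Complex.conj_ofReal]
  ring

end CoupledModel

/-! ### Uniqueness for nearest-neighbour hierarchies -/

section Hierarchy

/-- The coefficients `√((n + m + 1)! / n!)` in the iterated bounds of a hierarchy. -/
noncomputable def hierarchyBound : ℕ → ℕ → ℝ
  | 0, n => Real.sqrt (n + 1)
  | m + 1, n => Real.sqrt (n + 1) * hierarchyBound m (n + 1)

theorem hierarchyBound_nonneg : ∀ m n, 0 ≤ hierarchyBound m n
  | 0, _ => Real.sqrt_nonneg _
  | m + 1, n => mul_nonneg (Real.sqrt_nonneg _) (hierarchyBound_nonneg m (n + 1))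

theorem hierarchyBound_le_succ : ∀ m n, hierarchyBound m n ≤ hierarchyBound m (n + 1)
  | 0, n => Real.sqrt_le_sqrt (by push_cast; linarith)
  | m + 1, n => mul_le_mul (Real.sqrt_le_sqrt (by push_cast; linarith))
      (hierarchyBound_le_succ m (n + 1)) (hierarchyBound_nonneg _ _) (Real.sqrt_nonneg _)

theorem hierarchyBound_sq : ∀ m n,
    (n.factorial : ℝ) * hierarchyBound m n ^ 2 = ((n + m + 1).factorial : ℝ)
  | 0, n => by
    rw [hierarchyBound, Real.sq_sqrt (by positivity), Nat.add_zero, Nat.factorial_succ]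
    push_cast; ring
  | m + 1, n => by
    have h := hierarchyBound_sq m (n + 1)
    rw [Nat.factorial_succ] at h
    rw [hierarchyBound, mul_pow, Real.sq_sqrt (by positivity),
      show n + (m + 1) + 1 = n + 1 + m + 1 by ring, ← h]
    push_cast; ring

theorem tendsto_hierarchyBound (n : ℕ) (x : ℝ) :
    Tendsto (fun m => x ^ m * hierarchyBound m n / m.factorial) atTop (𝓝 0) := by
  have hsq : ∀ m, (x ^ m * hierarchyBound m n / m.factorial) ^ 2 ≤
      ((n + 1) * 2 ^ (n + 1)) * ((2 * x ^ 2) ^ m / m.factorial) := by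
    intro m
    have hn : (0 : ℝ) < n.factorial := by exact_mod_cast n.factorial_pos
    have hm : (0 : ℝ) < m.factorial := by exact_mod_cast m.factorial_pos
    have h1 : hierarchyBound m n ^ 2 ≤ ((n + 1) * 2 ^ (n + 1)) * 2 ^ m * m.factorial := by
      have h2 := hierarchyBound_sq m n
      -- `(n + 1 + m)! = C(n + 1 + m, m) (n + 1)! m!`, and the binomial coefficient is at most
      -- `2^(n+1+m)`
      have h3 : ((n + m + 1).factorial : ℝ) ≤ 2 ^ (n + m + 1) * ((n + 1) * n.factorial * m.factorial) := by
        have h4 := Nat.add_choose_mul_factorial_mul_factorial (n + 1) m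
        have h5 : (n + 1 + m).choose m ≤ 2 ^ (n + 1 + m) := Nat.choose_le_two_pow _ _
        rw [show n + m + 1 = n + 1 + m by ring, ← h4, Nat.factorial_succ]
        have h6 : (((n + 1 + m).choose m : ℕ) : ℝ) ≤ 2 ^ (n + 1 + m) := by exact_mod_cast h5
        push_cast
        rw [mul_assoc]
        exact mul_le_mul_of_nonneg_right h6 (by positivity)
      rw [← h2] at h3
      have h7 : (n.factorial : ℝ) * hierarchyBound m n ^ 2 ≤
          n.factorial * (((n + 1) * 2 ^ (n + 1)) * 2 ^ m * m.factorial) :=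
        h3.trans (le_of_eq (by ring))
      exact le_of_mul_le_mul_left h7 hn
    rw [div_pow, mul_pow, div_le_iff₀ (by positivity)]
    calc (x ^ m) ^ 2 * hierarchyBound m n ^ 2
        ≤ (x ^ m) ^ 2 * (((n + 1) * 2 ^ (n + 1)) * 2 ^ m * m.factorial) :=
          mul_le_mul_of_nonneg_left h1 (by positivity)
      _ = _ := by field_simp; ring
  have h := (FloorSemiring.tendsto_pow_div_factorial_atTop (2 * x ^ 2)).const_mul
    (((n : ℝ) + 1) * 2 ^ (n + 1))
  rw [mul_zero] at h
  have h2 := squeeze_zero (fun m => sq_nonneg _) hsq h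
  have h3 := h2.sqrt
  simp only [Real.sqrt_sq_eq_abs, Real.sqrt_zero] at h3
  exact tendsto_zero_iff_abs_tendsto_zero _ |>.2 h3

/-- Uniqueness for a nearest-neighbour hierarchy with `√n` coefficients: the `m`-fold iterated
estimate is `O(√((n + m + 1)! / n!) xᵐ / m!)`, which tends to zero. -/
theorem hierarchy_eq_zero {H : Type*} [NormedAddCommGroup H] [NormedSpace ℝ H]
    {z z' : ℕ → ℝ → H} {s b κ C : ℝ} (hκ : 0 ≤ κ) (hC : 0 ≤ C)
    (hd : ∀ n t, HasDerivAt (z n) (z' n t) t) (h0 : ∀ n, z n s = 0)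
    (hbound : ∀ n, ∀ t ∈ Set.Icc s b, ‖z n t‖ ≤ C * Real.sqrt (n + 1))
    (hz : ∀ t, ‖z' 0 t‖ ≤ κ * ‖z 1 t‖)
    (hs : ∀ n t, ‖z' (n + 1) t‖ ≤ κ * Real.sqrt (n + 1 + 1) * (‖z n t‖ + ‖z (n + 2) t‖)) :
    ∀ n, ∀ t ∈ Set.Icc s b, z n t = 0 := by
  -- integrate the differential inequality `m` times
  have key : ∀ m n, ∀ t ∈ Set.Icc s b,
      ‖z n t‖ ≤ C * (2 * κ) ^ m * hierarchyBound m n / m.factorial * (t - s) ^ m := by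
    intro m
    induction m with
    | zero => intro n t ht; simpa [hierarchyBound] using hbound n t ht
    | succ m ih =>
      intro n
      set β := C * (2 * κ) ^ (m + 1) * hierarchyBound (m + 1) n / m.factorial with hβ
      have hderiv : ∀ t ∈ Set.Icc s b, ‖z' n t‖ ≤ β * (t - s) ^ m := by
        intro t ht
        have hts : 0 ≤ t - s := sub_nonneg.2 ht.1
        set γ := C * (2 * κ) ^ m * hierarchyBound m (n + 1) / m.factorial * (t - s) ^ m with hγ
        have hγ0 : 0 ≤ γ := by
          have := hierarchyBound_nonneg m (n + 1); positivity
        have h2 : β * (t - s) ^ m = 2 * κ * Real.sqrt (n + 1) * γ := by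
          rw [hβ, hγ, hierarchyBound, pow_succ]; ring
        rw [h2]
        cases n with
        | zero =>
          refine (hz t).trans ?_
          have h3 := ih 1 t ht
          simp only [Nat.cast_zero, zero_add, Real.sqrt_one]
          have h4 := mul_le_mul_of_nonneg_left h3 hκ
          have h5 : 0 ≤ κ * γ := mul_nonneg hκ hγ0
          linarith
        | succ n =>
          refine (hs n t).trans ?_
          have h3 := ih (n + 2) t ht
          have h4 : ‖z n t‖ ≤ γ := by
            refine (ih n t ht).trans ?_
            rw [hγ]
            have := (hierarchyBound_le_succ m n).trans (hierarchyBound_le_succ m (n + 1))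
            gcongr
          push_cast
          have h5 : 0 ≤ κ * Real.sqrt (n + 1 + 1) := mul_nonneg hκ (Real.sqrt_nonneg _)
          have h6 := mul_le_mul_of_nonneg_left (add_le_add h4 h3) h5
          linarith
      have hB : ∀ t : ℝ, HasDerivAt (fun t => β / (m + 1) * (t - s) ^ (m + 1))
          (β * (t - s) ^ m) t := by
        intro t
        have h1 := (((hasDerivAt_id t).sub_const s).pow (m + 1)).const_mul (β / (m + 1))
        refine h1.congr_deriv ?_
        have : (m : ℝ) + 1 ≠ 0 := by positivity
        simp only [Nat.add_sub_cancel, Nat.cast_add, Nat.cast_one, id]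
        field_simp
      intro t ht
      have h1 := image_norm_le_of_norm_deriv_right_le_deriv_boundary
        (f := z n) (f' := z' n) (a := s) (b := b)
        (fun t _ => (hd n t).continuousAt.continuousWithinAt)
        (fun t _ => (hd n t).hasDerivWithinAt)
        (B := fun t => β / (m + 1) * (t - s) ^ (m + 1)) (B' := fun t => β * (t - s) ^ m)
        (by simp [h0]) (fun t => hB t)
        (fun t ht => hderiv t ⟨ht.1, ht.2.le⟩) ht
      refine h1.trans (le_of_eq ?_)
      rw [hβ, Nat.factorial_succ]
      push_cast
      field_simp
  intro n t ht
  have hlim : Tendsto (fun m : ℕ => C * ((2 * κ * (t - s)) ^ m * hierarchyBound m n / m.factorial))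
      atTop (𝓝 0) := by
    simpa using (tendsto_hierarchyBound n (2 * κ * (t - s))).const_mul C
  have h1 : ‖z n t‖ ≤ 0 := ge_of_tendsto' hlim fun m => (key m n t ht).trans (le_of_eq (by
    rw [mul_pow (2 * κ)]; ring))
  exact norm_le_zero_iff.1 h1

end Hierarchy

/-! ### Annihilation operators along the evolution -/

namespace CoupledModel

variable {𝓚 : Type v} [NormedAddCommGroup 𝓚] [InnerProductSpace ℂ 𝓚] [CompleteSpace 𝓚]
variable {R : Type u} [NormedAddCommGroup R] [InnerProductSpace ℂ R]
variable {F : Type w} [NormedAddCommGroup F] [InnerProductSpace ℂ F] [CompleteSpace F]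
variable {H : Type*} [NormedAddCommGroup H] [InnerProductSpace ℂ H] [CompleteSpace H]
variable (M : CoupledModel 𝓚 R F H)
variable {A : Type*} [Fintype A]

theorem continuous_op_left (C : F →L[ℂ] F) : Continuous fun B : 𝓚 →L[ℂ] 𝓚 => M.op B C := by
  refine (LipschitzWith.of_dist_le_mul (K := ‖C‖₊) fun B B' => ?_).continuous
  have h : M.op B C - M.op B' C = M.op (B - B') C := M.clm_ext fun k x => by simp [M.op_tmul]
  rw [dist_eq_norm, dist_eq_norm, h, mul_comm]
  exact M.norm_op_le _ _

theorem norm_op_one_le (B : 𝓚 →L[ℂ] 𝓚) (x : H) : ‖M.op B 1 x‖ ≤ ‖B‖ * ‖x‖ := by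
  refine (M.op B 1).le_of_opNorm_le ((M.norm_op_le _ _).trans ?_) x
  exact mul_le_of_le_one_right (norm_nonneg _) ContinuousLinearMap.norm_id_le

theorem norm_op_ann_le (n : ℕ) (g : R) (x : H) :
    ‖M.op 1 (M.ann n g) x‖ ≤ Real.sqrt n * ‖g‖ * ‖x‖ := by
  refine (M.op 1 _).le_of_opNorm_le ((M.norm_op_le _ _).trans ?_) x
  exact (mul_le_of_le_one_left (norm_nonneg _) ContinuousLinearMap.norm_id_le).trans
    (M.norm_ann_le n g)

theorem op_ann_sectorProj (n : ℕ) (g : R) (x : H) :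
    M.op 1 (M.ann n g) (M.sectorProj n x) = M.op 1 (M.ann n g) x := by
  rw [sectorProj, M.op_op, M.ann_comp_num]; rfl

theorem op_sectorProj (B : 𝓚 →L[ℂ] 𝓚) (n : ℕ) (x : H) :
    M.op B 1 (M.sectorProj n x) = M.sectorProj n (M.op B 1 x) := by
  rw [sectorProj, M.op_op, M.op_op]; rfl

theorem op_op_ann (B : 𝓚 →L[ℂ] 𝓚) (n : ℕ) (g : R) (x : H) :
    M.op B 1 (M.op 1 (M.ann n g) x) = M.op B (M.ann n g) x := by
  rw [M.op_op]; rfl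

/-- The canonical commutation relations for the fields. -/
theorem op_ann_fieldCre (E : A → 𝓚 →L[ℂ] 𝓚) (v : A → R) (n : ℕ) (g : R) (x : H) :
    M.op 1 (M.ann (n + 1) g) (M.fieldCre E v (n + 1) x) =
      M.fieldCre E v n (M.op 1 (M.ann n g) x) +
        ∑ α, ⟪g, v α⟫_ℂ • M.sectorProj n (M.op (E α) 1 x) := by
  simp only [fieldCre, sum_apply, map_sum, M.op_op, sectorProj]
  rw [← Finset.sum_add_distrib]
  refine Finset.sum_congr rfl fun α _ => ?_
  have h1 : M.ann (n + 1) g ∘L M.cre (n + 1) (v α) =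
      M.cre n (v α) ∘L M.ann n g + ⟪g, v α⟫_ℂ • M.num n := M.ann_comp_cre n g (v α)
  rw [h1, M.op_add_right, M.op_smul_right]
  rfl

theorem op_ann_fieldAnn (E : A → 𝓚 →L[ℂ] 𝓚) (v : A → R) (n : ℕ) (g : R) (x : H) :
    M.op 1 (M.ann n g) (M.fieldAnn E v (n + 1) x) =
      M.fieldAnn E v n (M.op 1 (M.ann (n + 1) g) x) := by
  simp only [fieldAnn, sum_apply, map_sum, M.op_op, M.ann_comp_ann n g]
  rfl

/-- `Y = a(g) X`, sector by sector. -/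
def AnnPair (g : R) (X Y : H) : Prop := ∀ n, M.op 1 (M.ann (n + 1) g) X = M.sectorProj n Y

theorem AnnPair.op {g : R} {X Y : H} (h : M.AnnPair g X Y) (S : 𝓚 →L[ℂ] 𝓚) :
    M.AnnPair g (M.op S 1 X) (M.op S 1 Y) := by
  intro n
  rw [← M.op_sectorProj, ← h n, M.op_op, M.op_op]
  rfl

/-- The embedding `k ↦ k ⊗ Ω`. -/
noncomputable def vac : 𝓚 →L[ℂ] H := M.tmul.flip (M.sym 0 Fin.elim0)

theorem vac_apply (k : 𝓚) : M.vac k = M.vec 0 k Fin.elim0 := rfl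

/-- The adjoint of the embedding `k ↦ k ⊗ Ω`. -/
noncomputable def vacProj : H →L[ℂ] 𝓚 := ContinuousLinearMap.adjoint M.vac

theorem vacProj_vac (k : 𝓚) : M.vacProj (M.vac k) = k := by
  refine ext_inner_left ℂ fun l => ?_
  rw [vacProj, ContinuousLinearMap.adjoint_inner_right, vac_apply, vac_apply, vec, vec,
    M.inner_tmul, inner_self_eq_norm_sq_to_K, M.norm_sym_zero]
  simp

theorem norm_vac (k : 𝓚) : ‖M.vac k‖ = ‖k‖ := by
  have h : ‖M.vac k‖ ^ 2 = ‖k‖ ^ 2 := by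
    have h1 : ⟪M.vac k, M.vac k⟫_ℂ = ⟪k, k⟫_ℂ := by
      rw [← ContinuousLinearMap.adjoint_inner_right]
      exact congrArg _ (M.vacProj_vac k)
    rw [inner_self_eq_norm_sq_to_K, inner_self_eq_norm_sq_to_K] at h1
    exact_mod_cast h1
  exact (pow_left_inj₀ (norm_nonneg _) (norm_nonneg _) two_ne_zero).1 h

theorem norm_vacProj_le (x : H) : ‖M.vacProj x‖ ≤ ‖x‖ := by
  have h : ‖M.vac‖ ≤ 1 := ContinuousLinearMap.opNorm_le_bound _ zero_le_one fun k => by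
    rw [M.norm_vac, one_mul]
  have h2 : ‖M.vacProj‖ ≤ 1 := by rw [vacProj, LinearIsometryEquiv.norm_map]; exact h
  simpa using M.vacProj.le_of_opNorm_le h2 x

theorem vacProj_op (B : 𝓚 →L[ℂ] 𝓚) (x : H) : M.vacProj (M.op B 1 x) = B (M.vacProj x) := by
  refine ext_inner_left ℂ fun l => ?_
  rw [vacProj, ContinuousLinearMap.adjoint_inner_right, ← ContinuousLinearMap.adjoint_inner_left B,
    ContinuousLinearMap.adjoint_inner_right, ← ContinuousLinearMap.adjoint_inner_left, M.adjoint_op,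
    show ContinuousLinearMap.adjoint (1 : F →L[ℂ] F) = 1 from star_one _]
  congr 1
  exact M.op_tmul _ _ _ _

theorem vacProj_sectorProj (x : H) : M.vacProj (M.sectorProj 0 x) = M.vacProj x := by
  refine ext_inner_left ℂ fun l => ?_
  rw [vacProj, ContinuousLinearMap.adjoint_inner_right, ContinuousLinearMap.adjoint_inner_right,
    ← M.inner_sectorProj, vac_apply, M.sectorProj_vec_self]

variable [CompleteSpace R]
variable (D : Coupling 𝓚 R A)

/-- A bound for the field operators in the interaction picture. -/
noncomputable def _root_.Coupling.fieldBound : ℝ := ∑ α, ‖D.E α‖ * ‖D.v α‖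

theorem _root_.Coupling.fieldBound_nonneg : 0 ≤ D.fieldBound :=
  Finset.sum_nonneg fun _ _ => mul_nonneg (norm_nonneg _) (norm_nonneg _)

theorem norm_fieldCreAt_le (n : ℕ) (t : ℝ) (x : H) :
    ‖M.fieldCre (D.opAt t) (D.vecAt t) n x‖ ≤ D.fieldBound * Real.sqrt n * ‖x‖ := by
  refine (M.fieldCre _ _ n).le_of_opNorm_le ((M.norm_fieldCre_le _ _ n).trans ?_) x
  refine mul_le_mul_of_nonneg_right (Finset.sum_le_sum fun α _ => ?_) (Real.sqrt_nonneg _)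
  rw [D.norm_vecAt]
  exact mul_le_mul_of_nonneg_right (D.norm_opAt_le t α) (norm_nonneg _)

theorem norm_fieldAnnAt_le (n : ℕ) (t : ℝ) (x : H) :
    ‖M.fieldAnn (D.opAt t) (D.vecAt t) n x‖ ≤ D.fieldBound * Real.sqrt n * ‖x‖ := by
  refine (M.fieldAnn _ _ n).le_of_opNorm_le ((M.norm_fieldAnn_le _ _ n).trans ?_) x
  refine mul_le_mul_of_nonneg_right (Finset.sum_le_sum fun α _ => ?_) (Real.sqrt_nonneg _)
  rw [D.norm_vecAt]
  exact mul_le_mul_of_nonneg_right (D.norm_opAt_le t α) (norm_nonneg _)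

/-- The integrand of Duhamel's formula for `a(g) W(t, s) X`. -/
noncomputable def source (lam s : ℝ) (g : R) (X : H) (r : ℝ) : H :=
  ∑ α, ⟪g, D.vecAt r α⟫_ℂ • M.prop D lam s r (M.op (D.opAt r α) 1 (M.prop D lam r s X))

theorem continuous_source (lam s : ℝ) (g : R) (X : H) : Continuous (M.source D lam s g X) := by
  unfold source
  refine continuous_finsetSum _ fun α _ => ?_
  refine (continuous_const.inner (D.continuous_vecAt α)).smul ?_
  refine M.continuous_prop D lam continuous_const continuous_id ?_
  exact ((M.continuous_op_left 1).comp (D.continuous_opAt α)).clm_apply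
    (M.continuous_prop D lam continuous_id continuous_const continuous_const)

/-- Duhamel's formula for `a(g) W(t, s) X` in terms of `Y = a(g) X`. -/
noncomputable def duhamel (lam t s : ℝ) (g : R) (X Y : H) : H :=
  M.prop D lam t s (Y + -(Complex.I * lam) • ∫ r in s..t, M.source D lam s g X r)

theorem continuous_duhamel (lam s : ℝ) (g : R) (X Y : H) :
    Continuous fun t => M.duhamel D lam t s g X Y := by
  refine M.continuous_prop D lam continuous_id continuous_const ?_
  refine continuous_const.add (Continuous.const_smul ?_ _)
  exact intervalIntegral.continuous_primitive
    (fun a b => (M.continuous_source D lam s g X).intervalIntegrable a b) s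

/-- Duhamel's expression solves the evolution equation with the inhomogeneity produced by the
commutator of `a(g)` with the field. -/
theorem hasDerivAt_sectorProj_duhamel (lam s : ℝ) (g : R) (X Y : H) (n : ℕ) (t : ℝ) :
    HasDerivAt (fun t => M.sectorProj n (M.duhamel D lam t s g X Y))
      (-(Complex.I * lam) • (M.fieldAt D n t (M.duhamel D lam t s g X Y) +
        ∑ α, ⟪g, D.vecAt t α⟫_ℂ • M.sectorProj n (M.op (D.opAt t α) 1 (M.prop D lam t s X)))) t := by
  have hint : HasDerivAt (fun t => Y + -(Complex.I * lam) • ∫ r in s..t, M.source D lam s g X r)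
      (-(Complex.I * lam) • M.source D lam s g X t) t := by
    have h := M.continuous_source D lam s g X
    exact ((intervalIntegral.integral_hasDerivAt_right (h.intervalIntegrable _ _)
      (h.stronglyMeasurableAtFilter _ _) h.continuousAt).const_smul (-(Complex.I * lam))).const_add Y
  have h := HasDerivAt.strong_apply (U := fun t => M.sectorProj n ∘L M.prop D lam t s) (C := 1)
    (fun x => (M.sectorProj n).continuous.comp
      (M.continuous_prop D lam continuous_id continuous_const continuous_const))
    (fun t x => by
      rw [one_mul, ContinuousLinearMap.comp_apply]
      exact (M.norm_sectorProj_le n _).trans (M.norm_prop D lam t s x).le)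
    (M.hasDerivAt_sectorProj_prop D lam s
      (Y + -(Complex.I * lam) • ∫ r in s..t, M.source D lam s g X r) n t) hint
  refine h.congr_deriv ?_
  rw [smul_add]
  congr 1
  simp only [map_smul, source, map_sum, ContinuousLinearMap.comp_apply, M.prop_prop, M.prop_self]

/-- The annihilation operators can be carried through the evolution. The difference of the two
sides satisfies a homogeneous nearest-neighbour hierarchy over the sectors. -/
theorem AnnPair.prop {lam s t : ℝ} (hst : s ≤ t) {g : R} {X Y : H} (h : M.AnnPair g X Y) :
    M.AnnPair g (M.prop D lam t s X) (M.duhamel D lam t s g X Y) := by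
  set x : ℝ → H := fun t => M.prop D lam t s X with hx
  set y : ℝ → H := fun t => M.duhamel D lam t s g X Y with hy
  set z : ℕ → ℝ → H := fun n t => M.op 1 (M.ann (n + 1) g) (x t) - M.sectorProj n (y t) with hz
  set z' : ℕ → ℝ → H := fun n t => -(Complex.I * lam) •
    (M.fieldCre (D.opAt t) (D.vecAt t) n (M.op 1 (M.ann n g) (x t) - y t) +
      M.fieldAnn (D.opAt t) (D.vecAt t) (n + 1) (z (n + 1) t)) with hz'
  have hd : ∀ n t, HasDerivAt (z n) (z' n t) t := by
    intro n t
    have h1 := (M.hasDerivAt_sectorProj_prop D lam s X (n + 1) t).clm_const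
      (L := M.op 1 (M.ann (n + 1) g))
    simp only [M.op_ann_sectorProj] at h1
    refine (h1.sub (M.hasDerivAt_sectorProj_duhamel D lam s g X Y n t)).congr_deriv ?_
    rw [map_smul, ← smul_sub, hz']
    congr 1
    simp only [fieldAt, add_apply, map_add, M.op_ann_fieldCre, M.op_ann_fieldAnn, hz, map_sub,
      M.fieldAnn_sectorProj]
    abel
  obtain ⟨B, hB⟩ := (isCompact_Icc (a := s) (b := t)).exists_bound_of_continuousOn
    (M.continuous_duhamel D lam s g X Y).continuousOn
  have hB0 : 0 ≤ B := (norm_nonneg _).trans (hB s ⟨le_rfl, hst⟩)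
  have hl : ‖-(Complex.I * (lam : ℂ))‖ = |lam| := by simp
  have hfin := hierarchy_eq_zero (z := z) (z' := z') (s := s) (b := t) (κ := |lam| * D.fieldBound)
    (C := ‖g‖ * ‖X‖ + B) (mul_nonneg (abs_nonneg _) D.fieldBound_nonneg) (by positivity) hd
    (fun n => by
      simp only [hz, hx, hy, M.prop_self, duhamel, intervalIntegral.integral_same, smul_zero,
        add_zero, h n, sub_self])
    (fun n r hr => by
      refine (norm_sub_le _ _).trans ?_
      rw [add_mul]
      refine add_le_add ?_ ?_
      · refine (M.norm_op_ann_le (n + 1) g _).trans (le_of_eq ?_)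
        rw [hx, M.norm_prop]; push_cast; ring
      · refine (M.norm_sectorProj_le n _).trans ((hB r hr).trans ?_)
        exact le_mul_of_one_le_right hB0 (Real.one_le_sqrt.2 (by
          linarith [(Nat.cast_nonneg n : (0 : ℝ) ≤ n)])))
    (fun r => by
      simp only [hz', M.fieldCre_zero, zero_apply, zero_add, norm_smul, hl]
      have h1 := M.norm_fieldAnnAt_le D 1 r (z 1 r)
      rw [Nat.cast_one, Real.sqrt_one, mul_one] at h1
      rw [mul_assoc]
      exact mul_le_mul_of_nonneg_left h1 (abs_nonneg _))
    (fun n r => by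
      have h1 : M.fieldCre (D.opAt r) (D.vecAt r) (n + 1) (M.op 1 (M.ann (n + 1) g) (x r) - y r) =
          M.fieldCre (D.opAt r) (D.vecAt r) (n + 1) (z n r) := by
        simp only [hz, map_sub, M.fieldCre_sectorProj]
      simp only [hz', h1]
      rw [norm_smul, hl, mul_assoc, mul_assoc]
      refine mul_le_mul_of_nonneg_left ?_ (abs_nonneg _)
      have h2 := M.norm_fieldCreAt_le D (n + 1) r (z n r)
      have h3 := M.norm_fieldAnnAt_le D (n + 1 + 1) r (z (n + 1 + 1) r)
      push_cast at h2 h3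
      have h4 : Real.sqrt (n + 1) ≤ Real.sqrt (n + 1 + 1) := Real.sqrt_le_sqrt (by linarith)
      have h5 : D.fieldBound * Real.sqrt (n + 1) * ‖z n r‖ ≤
          D.fieldBound * Real.sqrt (n + 1 + 1) * ‖z n r‖ := by
        have := D.fieldBound_nonneg; gcongr
      refine (norm_add_le _ _).trans ((add_le_add (h2.trans h5) h3).trans (le_of_eq ?_))
      ring)
  intro n
  exact sub_eq_zero.1 (hfin n t ⟨hst, le_rfl⟩)

/-- `X` is a state at time `s`, of norm at most `C`, all of whose annihilations `a(g) X` are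
controlled by the correlations of `g` with the coupling during the time interval `[t₀, s]`. -/
structure IsTame (lam t₀ s C : ℝ) (X : H) : Prop where
  norm_le : ‖X‖ ≤ C
  exists_annPair : ∀ g : R, ∃ Y, M.AnnPair g X Y ∧
    ‖Y‖ ≤ |lam| * (∑ α, ‖D.E α‖ * ∫ r in t₀..s, ‖⟪g, D.vecAt r α⟫_ℂ‖) * C

theorem isTame_vac (lam t₀ : ℝ) (k : 𝓚) : M.IsTame D lam t₀ t₀ ‖k‖ (M.vac k) where
  norm_le := (M.norm_vac k).le
  exists_annPair g := by
    refine ⟨0, fun n => ?_, by simp⟩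
    rw [vac_apply, vec, M.op_tmul, M.ann_sym_ne (by omega), map_zero, map_zero]

theorem IsTame.op {lam t₀ s C : ℝ} {X : H} (h : M.IsTame D lam t₀ s C X) (S : 𝓚 →L[ℂ] 𝓚) :
    M.IsTame D lam t₀ s (‖S‖ * C) (M.op S 1 X) where
  norm_le := (M.norm_op_one_le S X).trans (mul_le_mul_of_nonneg_left h.norm_le (norm_nonneg _))
  exists_annPair g := by
    obtain ⟨Y, h1, h2⟩ := h.exists_annPair g
    refine ⟨_, h1.op M S, (M.norm_op_one_le S Y).trans ?_⟩
    refine (mul_le_mul_of_nonneg_left h2 (norm_nonneg _)).trans (le_of_eq ?_)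
    ring

theorem norm_source_le (lam s : ℝ) (g : R) (X : H) (r : ℝ) :
    ‖M.source D lam s g X r‖ ≤ (∑ α, ‖D.E α‖ * ‖⟪g, D.vecAt r α⟫_ℂ‖) * ‖X‖ := by
  rw [Finset.sum_mul]
  refine (norm_sum_le _ _).trans (Finset.sum_le_sum fun α _ => ?_)
  rw [norm_smul, M.norm_prop]
  have h1 := M.norm_op_one_le (D.opAt r α) (M.prop D lam r s X)
  rw [M.norm_prop] at h1
  have h2 := h1.trans (mul_le_mul_of_nonneg_right (D.norm_opAt_le r α) (norm_nonneg _))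
  refine (mul_le_mul_of_nonneg_left h2 (norm_nonneg _)).trans (le_of_eq ?_)
  ring

theorem continuous_corr (g : R) (α : A) : Continuous fun r => ‖⟪g, D.vecAt r α⟫_ℂ‖ :=
  (continuous_const.inner (D.continuous_vecAt α)).norm

/-- Tame states stay tame under the evolution, by Duhamel's formula for `a(g) W(t, s) X`. -/
theorem IsTame.prop {lam t₀ s t C : ℝ} {X : H} (h : M.IsTame D lam t₀ s C X) (hst : s ≤ t) :
    M.IsTame D lam t₀ t C (M.prop D lam t s X) where
  norm_le := (M.norm_prop D lam t s X).le.trans h.norm_le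
  exists_annPair g := by
    obtain ⟨Y, h1, h2⟩ := h.exists_annPair g
    refine ⟨_, h1.prop M D hst, ?_⟩
    have hC : 0 ≤ C := (norm_nonneg _).trans h.norm_le
    have hl : ‖-(Complex.I * (lam : ℂ))‖ = |lam| := by simp
    rw [duhamel, M.norm_prop]
    refine (norm_add_le _ _).trans ?_
    rw [norm_smul, hl]
    have hii : ∀ (a b : ℝ) α, IntervalIntegrable (fun r => ‖⟪g, D.vecAt r α⟫_ℂ‖) volume a b :=
      fun a b α => (continuous_corr D g α).intervalIntegrable a b
    have h3 : ‖∫ r in s..t, M.source D lam s g X r‖ ≤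
        (∑ α, ‖D.E α‖ * ∫ r in s..t, ‖⟪g, D.vecAt r α⟫_ℂ‖) * C := by
      have h4 : ∫ r in s..t, (∑ α, ‖D.E α‖ * ‖⟪g, D.vecAt r α⟫_ℂ‖) * C =
          (∑ α, ‖D.E α‖ * ∫ r in s..t, ‖⟪g, D.vecAt r α⟫_ℂ‖) * C := by
        rw [intervalIntegral.integral_mul_const, intervalIntegral.integral_finsetSum]
        · simp only [intervalIntegral.integral_const_mul]
        · exact fun α _ => (hii s t α).const_mul _
      rw [← h4]
      refine intervalIntegral.norm_integral_le_of_norm_le hst ?_ ?_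
      · refine Eventually.of_forall fun r _ => (M.norm_source_le D lam s g X r).trans ?_
        exact mul_le_mul_of_nonneg_left h.norm_le
          (Finset.sum_nonneg fun _ _ => mul_nonneg (norm_nonneg _) (norm_nonneg _))
      · refine Continuous.intervalIntegrable ?_ s t
        exact (continuous_finsetSum _ fun α _ =>
          (continuous_corr D g α).const_mul _).mul_const _
    have h5 : (∑ α, ‖D.E α‖ * ∫ r in t₀..t, ‖⟪g, D.vecAt r α⟫_ℂ‖) =
        (∑ α, ‖D.E α‖ * ∫ r in t₀..s, ‖⟪g, D.vecAt r α⟫_ℂ‖) +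
          ∑ α, ‖D.E α‖ * ∫ r in s..t, ‖⟪g, D.vecAt r α⟫_ℂ‖ := by
      rw [← Finset.sum_add_distrib]
      refine Finset.sum_congr rfl fun α _ => ?_
      rw [← mul_add, intervalIntegral.integral_add_adjacent_intervals (hii _ _ α) (hii _ _ α)]
    rw [h5]
    refine (add_le_add h2 (mul_le_mul_of_nonneg_left h3 (abs_nonneg _))).trans (le_of_eq ?_)
    ring

/-- The vacuum component of the evolution. -/
theorem hasDerivAt_vacProj_prop (lam s t : ℝ) (X : H) {Y : A → H}
    (hY : ∀ α, M.AnnPair (D.vecAt t α) (M.prop D lam t s X) (Y α)) :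
    HasDerivAt (fun t => M.vacProj (M.prop D lam t s X))
      (-(Complex.I * lam) •
        ∑ α, ContinuousLinearMap.adjoint (D.opAt t α) (M.vacProj (Y α))) t := by
  have h := (M.hasDerivAt_sectorProj_prop D lam s X 0 t).clm_const (L := M.vacProj)
  simp only [M.vacProj_sectorProj] at h
  refine h.congr_deriv ?_
  rw [map_smul, fieldAt, M.fieldCre_zero, zero_add, zero_add, fieldAnn, sum_apply, map_sum]
  congr 1
  refine Finset.sum_congr rfl fun α _ => ?_
  rw [← M.op_op_ann, M.vacProj_op, show M.op 1 (M.ann 1 _) _ = _ from hY α 0, M.vacProj_sectorProj]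

end CoupledModel

/-! ### Reservoir correlations and the short-time dynamics -/

namespace Coupling

variable {𝓚 : Type v} [NormedAddCommGroup 𝓚] [InnerProductSpace ℂ 𝓚] [CompleteSpace 𝓚]
variable {R : Type u} [NormedAddCommGroup R] [InnerProductSpace ℂ R] [CompleteSpace R]
variable {A : Type*} [Fintype A]
variable (D : Coupling 𝓚 R A)

/-- The correlation function `⟨v_α, e^{-ixH_R} v_β⟩` of the reservoir. -/
noncomputable def corr (α β : A) (x : ℝ) : ℂ := ⟪D.v α, unitaryGroup D.HR.graph x (D.v β)⟫_ℂ

theorem continuous_corr (α β : A) : Continuous (D.corr α β) :=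
  continuous_const.inner (D.isUnitaryGroup_HR.continuous _)

theorem inner_vecAt (t r : ℝ) (α β : A) : ⟪D.vecAt t α, D.vecAt r β⟫_ℂ = D.corr α β (t - r) := by
  rw [vecAt, D.isUnitaryGroup_HR.inner_left, neg_neg, vecAt, ← mul_apply_eq_comp,
    ← D.isUnitaryGroup_HR.add, ← sub_eq_add_neg]
  rfl

/-- The total strength of the reservoir correlations. -/
noncomputable def weight (x : ℝ) : ℝ := ∑ α, ‖D.E α‖ * ∑ β, ‖D.E β‖ * ‖D.corr α β x‖

theorem continuous_weight : Continuous D.weight :=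
  continuous_finsetSum _ fun α _ => (continuous_finsetSum _ fun β _ =>
    (D.continuous_corr α β).norm.const_mul _).const_mul _

theorem weight_nonneg (x : ℝ) : 0 ≤ D.weight x :=
  Finset.sum_nonneg fun _ _ => mul_nonneg (norm_nonneg _)
    (Finset.sum_nonneg fun _ _ => mul_nonneg (norm_nonneg _) (norm_nonneg _))

/-- The integrability assumption on the reservoir correlations. -/
def IntegrableCorr : Prop := ∀ α β, IntegrableOn (D.corr α β) (Set.Ioi 0)

/-- `∫ₓ^∞ weight`. -/
noncomputable def tail (x : ℝ) : ℝ := ∫ y in Set.Ioi x, D.weight y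

/-- `∫₀^∞ weight(y) min(1, δ y) dy`. -/
noncomputable def modulus (δ : ℝ) : ℝ := ∫ y in Set.Ioi (0 : ℝ), D.weight y * min 1 (δ * y)

/-- The memory kernel of the reduced evolution. -/
noncomputable def kernel (t x : ℝ) : 𝓚 →L[ℂ] 𝓚 :=
  ∑ α, ∑ β, D.corr α β x • (ContinuousLinearMap.adjoint (D.opAt t α) ∘L D.opAt (t - x) β)

/-- The generator of the reduced evolution in the interaction picture, before averaging. -/
noncomputable def generatorAt (t : ℝ) : 𝓚 →L[ℂ] 𝓚 := -∫ x in Set.Ioi (0 : ℝ), D.kernel t x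

theorem norm_adjoint_opAt_le (t : ℝ) (α : A) :
    ‖ContinuousLinearMap.adjoint (D.opAt t α)‖ ≤ ‖D.E α‖ := by
  rw [LinearIsometryEquiv.norm_map]; exact D.norm_opAt_le t α

theorem norm_kernel_le (t x : ℝ) : ‖D.kernel t x‖ ≤ D.weight x := by
  refine (norm_sum_le _ _).trans (Finset.sum_le_sum fun α _ => ?_)
  rw [Finset.mul_sum]
  refine (norm_sum_le _ _).trans (Finset.sum_le_sum fun β _ => ?_)
  rw [norm_smul]
  have h := (ContinuousLinearMap.opNorm_comp_le (ContinuousLinearMap.adjoint (D.opAt t α))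
    (D.opAt (t - x) β)).trans (mul_le_mul (D.norm_adjoint_opAt_le t α) (D.norm_opAt_le _ β)
      (norm_nonneg _) (norm_nonneg _))
  exact (mul_le_mul_of_nonneg_left h (norm_nonneg _)).trans (le_of_eq (by ring))

theorem continuous_kernel (t : ℝ) : Continuous (D.kernel t) :=
  continuous_finsetSum _ fun α _ => continuous_finsetSum _ fun β _ =>
    (D.continuous_corr α β).smul (continuous_const.clm_comp
      ((D.continuous_opAt β).comp (continuous_const.sub continuous_id)))

variable {D}

theorem IntegrableCorr.integrableOn_weight (hD : D.IntegrableCorr) :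
    IntegrableOn D.weight (Set.Ioi 0) := by
  unfold weight
  exact integrable_finsetSum _ fun α _ => (integrable_finsetSum _ fun β _ =>
    (hD α β).norm.const_mul _).const_mul _

theorem IntegrableCorr.integrableOn_weight_Ioi (hD : D.IntegrableCorr) {x : ℝ} (hx : 0 ≤ x) :
    IntegrableOn D.weight (Set.Ioi x) :=
  hD.integrableOn_weight.mono_set (Set.Ioi_subset_Ioi hx)

theorem IntegrableCorr.integrableOn_kernel (hD : D.IntegrableCorr) (t : ℝ) :
    IntegrableOn (D.kernel t) (Set.Ioi 0) :=
  hD.integrableOn_weight.mono' (D.continuous_kernel t).aestronglyMeasurable.restrict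
    (Eventually.of_forall fun x => D.norm_kernel_le t x)

theorem tail_nonneg (D : Coupling 𝓚 R A) (x : ℝ) : 0 ≤ D.tail x :=
  integral_nonneg fun _ => D.weight_nonneg _

theorem IntegrableCorr.tail_anti (hD : D.IntegrableCorr) {x y : ℝ} (hx : 0 ≤ x) (hxy : x ≤ y) :
    D.tail y ≤ D.tail x :=
  setIntegral_mono_set (hD.integrableOn_weight_Ioi hx)
    (Eventually.of_forall fun _ => D.weight_nonneg _)
    (Set.Ioi_subset_Ioi hxy).eventuallyLE

theorem IntegrableCorr.integral_weight_le (hD : D.IntegrableCorr) {a b : ℝ} (ha : 0 ≤ a)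
    (hab : a ≤ b) : ∫ x in a..b, D.weight x ≤ D.tail a := by
  rw [intervalIntegral.integral_of_le hab]
  exact setIntegral_mono_set (hD.integrableOn_weight_Ioi ha)
    (Eventually.of_forall fun _ => D.weight_nonneg _) Set.Ioc_subset_Ioi_self.eventuallyLE

theorem IntegrableCorr.integral_weight_sub_le (hD : D.IntegrableCorr) {a b t : ℝ} (hab : a ≤ b)
    (hbt : b ≤ t) : ∫ r in a..b, D.weight (t - r) ≤ D.tail (t - b) := by
  rw [intervalIntegral.integral_comp_sub_left]
  exact hD.integral_weight_le (by linarith) (by linarith)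

theorem IntegrableCorr.tendsto_tail (hD : D.IntegrableCorr) : Tendsto D.tail atTop (𝓝 0) := by
  have h := tendsto_const_nhds.sub (intervalIntegral_tendsto_integral_Ioi 0
    hD.integrableOn_weight tendsto_id) (a := ∫ x in Set.Ioi (0 : ℝ), D.weight x)
  rw [sub_self] at h
  refine h.congr' ?_
  filter_upwards [eventually_ge_atTop 0] with x hx
  rw [id, sub_eq_iff_eq_add, tail, add_comm]
  exact (intervalIntegral.integral_interval_add_Ioi hD.integrableOn_weight
    (hD.integrableOn_weight_Ioi hx)).symm

theorem IntegrableCorr.integrableOn_modulus (hD : D.IntegrableCorr) {δ : ℝ} (hδ : 0 ≤ δ) :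
    IntegrableOn (fun y => D.weight y * min 1 (δ * y)) (Set.Ioi 0) := by
  refine hD.integrableOn_weight.mono' ?_ ?_
  · exact (D.continuous_weight.mul (by fun_prop)).aestronglyMeasurable.restrict
  · refine (ae_restrict_iff' measurableSet_Ioi).2 (Eventually.of_forall fun y hy => ?_)
    have hy0 : 0 ≤ δ * y := mul_nonneg hδ (le_of_lt hy)
    rw [norm_mul, Real.norm_of_nonneg (D.weight_nonneg y),
      Real.norm_of_nonneg (le_min zero_le_one hy0)]
    exact mul_le_of_le_one_right (D.weight_nonneg y) (min_le_left _ _)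

theorem IntegrableCorr.tendsto_modulus (hD : D.IntegrableCorr) :
    Tendsto D.modulus (𝓝[≥] 0) (𝓝 0) := by
  have h := tendsto_integral_filter_of_dominated_convergence (l := 𝓝[≥] (0 : ℝ))
    (μ := volume.restrict (Set.Ioi (0 : ℝ))) (F := fun δ y => D.weight y * min 1 (δ * y))
    (f := fun _ => (0 : ℝ)) D.weight
    (Eventually.of_forall fun δ =>
      (D.continuous_weight.mul (by fun_prop)).aestronglyMeasurable.restrict)
    (by
      filter_upwards [self_mem_nhdsWithin] with δ hδ
      refine (ae_restrict_iff' measurableSet_Ioi).2 (Eventually.of_forall fun y hy => ?_)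
      have hy0 : 0 ≤ δ * y := mul_nonneg hδ (le_of_lt hy)
      rw [norm_mul, Real.norm_of_nonneg (D.weight_nonneg y),
        Real.norm_of_nonneg (le_min zero_le_one hy0)]
      exact mul_le_of_le_one_right (D.weight_nonneg y) (min_le_left _ _))
    hD.integrableOn_weight
    (Eventually.of_forall fun y => by
      have hc : Continuous fun δ : ℝ => D.weight y * min 1 (δ * y) := by fun_prop
      have := (hc.tendsto 0).mono_left (nhdsWithin_le_nhds (s := Set.Ici 0))
      simpa using this)
  rw [integral_zero] at h
  exact h

end Coupling

namespace CoupledModel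

variable {𝓚 : Type v} [NormedAddCommGroup 𝓚] [InnerProductSpace ℂ 𝓚] [CompleteSpace 𝓚]
variable {R : Type u} [NormedAddCommGroup R] [InnerProductSpace ℂ R] [CompleteSpace R]
variable {F : Type w} [NormedAddCommGroup F] [InnerProductSpace ℂ F] [CompleteSpace F]
variable {H : Type*} [NormedAddCommGroup H] [InnerProductSpace ℂ H] [CompleteSpace H]
variable (M : CoupledModel 𝓚 R F H)
variable {A : Type*} [Fintype A]
variable {D : Coupling 𝓚 R A}

theorem weight_integral_eq (D : Coupling 𝓚 R A) (t a b : ℝ) :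
    ∑ α, ‖D.E α‖ * ∑ β, ‖D.E β‖ * ∫ r in a..b, ‖⟪D.vecAt t α, D.vecAt r β⟫_ℂ‖ =
      ∫ r in a..b, D.weight (t - r) := by
  have hc : ∀ α β, Continuous fun r => ‖D.corr α β (t - r)‖ := fun α β =>
    ((D.continuous_corr α β).comp (continuous_const.sub continuous_id)).norm
  simp only [Coupling.weight, D.inner_vecAt]
  rw [intervalIntegral.integral_finsetSum]
  · refine Finset.sum_congr rfl fun α _ => ?_
    rw [intervalIntegral.integral_const_mul, intervalIntegral.integral_finsetSum]
    · simp only [intervalIntegral.integral_const_mul]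
    · exact fun β _ => ((hc α β).const_mul _).intervalIntegrable a b
  · exact fun α _ => ((continuous_finsetSum _ fun β _ =>
      (hc α β).const_mul _).const_mul _).intervalIntegrable a b

/-- If the vectors `Y α` are bounded as in the definition of a tame state, the derivative of the
vacuum component has the size of a correlation integral. -/
theorem norm_sum_adjoint_opAt_le {lam t a b C : ℝ} {Y : A → H}
    (hY : ∀ α, ‖Y α‖ ≤ |lam| * (∑ β, ‖D.E β‖ * ∫ r in a..b, ‖⟪D.vecAt t α, D.vecAt r β⟫_ℂ‖) * C) :
    ‖-(Complex.I * (lam : ℂ)) • ∑ α, ContinuousLinearMap.adjoint (D.opAt t α) (M.vacProj (Y α))‖ ≤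
      lam ^ 2 * C * ∫ r in a..b, D.weight (t - r) := by
  have hl : ‖-(Complex.I * (lam : ℂ))‖ = |lam| := by simp
  rw [norm_smul, hl, ← weight_integral_eq, ← sq_abs, pow_two]
  have h : ‖∑ α, ContinuousLinearMap.adjoint (D.opAt t α) (M.vacProj (Y α))‖ ≤
      ∑ α, ‖D.E α‖ * (|lam| *
        (∑ β, ‖D.E β‖ * ∫ r in a..b, ‖⟪D.vecAt t α, D.vecAt r β⟫_ℂ‖) * C) := by
    refine (norm_sum_le _ _).trans (Finset.sum_le_sum fun α _ => ?_)
    refine (ContinuousLinearMap.le_of_opNorm_le _ (D.norm_adjoint_opAt_le t α) _).trans ?_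
    exact mul_le_mul_of_nonneg_left ((M.norm_vacProj_le _).trans (hY α)) (norm_nonneg _)
  refine (mul_le_mul_of_nonneg_left h (abs_nonneg _)).trans (le_of_eq ?_)
  rw [Finset.mul_sum, Finset.mul_sum]
  refine Finset.sum_congr rfl fun α _ => ?_
  ring

/-- The derivative of the vacuum component of a tame state is of order `λ²`. -/
theorem IsTame.exists_hasDerivAt_vacProj (hD : D.IntegrableCorr) {lam t₀ s t C : ℝ} {X : H}
    (h : M.IsTame D lam t₀ s C X) (h0 : t₀ ≤ s) (hst : s ≤ t) :
    ∃ m', HasDerivAt (fun t => M.vacProj (M.prop D lam t s X)) m' t ∧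
      ‖m'‖ ≤ lam ^ 2 * C * D.tail 0 := by
  choose Y hY1 hY2 using fun α => (h.prop M D hst).exists_annPair (D.vecAt t α)
  refine ⟨_, M.hasDerivAt_vacProj_prop D lam s t X hY1, ?_⟩
  refine (M.norm_sum_adjoint_opAt_le hY2).trans ?_
  have hC : 0 ≤ C := (norm_nonneg _).trans h.norm_le
  refine mul_le_mul_of_nonneg_left ?_ (by positivity)
  simpa using hD.integral_weight_sub_le (h0.trans hst) le_rfl

/-- On the microscopic time scale the vacuum component of a tame state hardly changes. -/
theorem IsTame.norm_vacProj_sub_le (hD : D.IntegrableCorr) {lam t₀ s r t C : ℝ} {X : H}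
    (h : M.IsTame D lam t₀ s C X) (h0 : t₀ ≤ s) (hsr : s ≤ r) (hrt : r ≤ t) :
    ‖M.vacProj (M.prop D lam t s X) - M.vacProj (M.prop D lam r s X)‖ ≤
      C * (D.tail 0 * lam ^ 2 * (t - r)) := by
  choose! m' hm1 hm2 using fun x (hx : s ≤ x) => h.exists_hasDerivAt_vacProj M hD h0 hx
  have := norm_image_sub_le_of_norm_deriv_le_segment'
    (f := fun t => M.vacProj (M.prop D lam t s X)) (f' := m') (a := r) (b := t)
    (C := lam ^ 2 * C * D.tail 0)
    (fun x hx => (hm1 x (hsr.trans hx.1)).hasDerivWithinAt)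
    (fun x hx => hm2 x (hsr.trans hx.1)) t ⟨hrt, le_rfl⟩
  exact this.trans (le_of_eq (by ring))

/-- A state created from a tame state at time `r` evolves for the time `t - r` as if the reservoir
were still in its vacuum, up to an error which is small on the microscopic time scale. -/
theorem IsTame.norm_vacProj_op_sub_le (hD : D.IntegrableCorr) {lam t₀ s r t C : ℝ} {X : H}
    (h : M.IsTame D lam t₀ s C X) (h0 : t₀ ≤ s) (hsr : s ≤ r) (hrt : r ≤ t) (S : 𝓚 →L[ℂ] 𝓚) :
    ‖M.vacProj (M.prop D lam t r (M.op S 1 (M.prop D lam r s X))) -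
        S (M.vacProj (M.prop D lam t s X))‖ ≤
      ‖S‖ * (2 * C * min 1 (D.tail 0 * lam ^ 2 * (t - r))) := by
  have hC : 0 ≤ C := (norm_nonneg _).trans h.norm_le
  have hZ := (h.prop M D hsr).op M D S
  have h1 : M.vacProj (M.op S 1 (M.prop D lam r s X)) = S (M.vacProj (M.prop D lam r s X)) :=
    M.vacProj_op _ _
  have hm : ∀ x, ‖M.vacProj (M.prop D lam x s X)‖ ≤ C := fun x =>
    (M.norm_vacProj_le _).trans ((M.norm_prop D lam x s X).le.trans h.norm_le)
  rcases le_total 1 (D.tail 0 * lam ^ 2 * (t - r)) with hle | hle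
  · rw [min_eq_left hle, mul_one]
    refine (norm_sub_le _ _).trans ?_
    have h2 : ‖M.vacProj (M.prop D lam t r (M.op S 1 (M.prop D lam r s X)))‖ ≤ ‖S‖ * C :=
      (M.norm_vacProj_le _).trans ((M.norm_prop D lam _ _ _).le.trans hZ.norm_le)
    have h3 : ‖S (M.vacProj (M.prop D lam t s X))‖ ≤ ‖S‖ * C :=
      (S.le_opNorm _).trans (mul_le_mul_of_nonneg_left (hm t) (norm_nonneg _))
    linarith
  · rw [min_eq_right hle]
    have h2 := hZ.norm_vacProj_sub_le M hD (h0.trans hsr) le_rfl hrt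
    rw [M.prop_self, h1] at h2
    have h3 := h.norm_vacProj_sub_le M hD h0 hsr hrt
    have h4 : ‖S (M.vacProj (M.prop D lam r s X)) - S (M.vacProj (M.prop D lam t s X))‖ ≤
        ‖S‖ * (C * (D.tail 0 * lam ^ 2 * (t - r))) := by
      rw [← map_sub]
      refine (S.le_opNorm _).trans (mul_le_mul_of_nonneg_left ?_ (norm_nonneg _))
      rw [norm_sub_rev]; exact h3
    refine (norm_sub_le_norm_sub_add_norm_sub _ (S (M.vacProj (M.prop D lam r s X))) _).trans ?_
    linarith

end CoupledModel

/-! ### The reduced evolution equation and its average -/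

namespace CoupledModel

variable {𝓚 : Type v} [NormedAddCommGroup 𝓚] [InnerProductSpace ℂ 𝓚] [CompleteSpace 𝓚]
variable {R : Type u} [NormedAddCommGroup R] [InnerProductSpace ℂ R] [CompleteSpace R]
variable {F : Type w} [NormedAddCommGroup F] [InnerProductSpace ℂ F] [CompleteSpace F]
variable {H : Type*} [NormedAddCommGroup H] [InnerProductSpace ℂ H] [CompleteSpace H]
variable (M : CoupledModel 𝓚 R F H)
variable {A : Type*} [Fintype A]
variable {D : Coupling 𝓚 R A}

theorem kernel_apply (D : Coupling 𝓚 R A) (t x : ℝ) (k : 𝓚) : D.kernel t x k =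
    ∑ α, ∑ β, D.corr α β x • ContinuousLinearMap.adjoint (D.opAt t α) (D.opAt (t - x) β k) := by
  simp only [Coupling.kernel, sum_apply, smul_apply, ContinuousLinearMap.comp_apply]

/-- The part of the memory integral from the time interval `[s, t]`, and the rest. -/
theorem generatorAt_apply (hD : D.IntegrableCorr) {s t : ℝ} (hst : s ≤ t) (k : 𝓚) :
    D.generatorAt t k = -((∫ r in s..t, D.kernel t (t - r) k) +
      ∫ x in Set.Ioi (t - s), D.kernel t x k) := by
  have hK : IntegrableOn (fun x => D.kernel t x k) (Set.Ioi 0) :=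
    ((ContinuousLinearMap.apply ℂ 𝓚 k).integrable_comp (hD.integrableOn_kernel t))
  rw [intervalIntegral.integral_comp_sub_left (fun x => D.kernel t x k), sub_self,
    intervalIntegral.integral_interval_add_Ioi hK
      (hK.mono_set (Set.Ioi_subset_Ioi (sub_nonneg.2 hst))), Coupling.generatorAt]
  rw [neg_apply, ContinuousLinearMap.integral_apply (hD.integrableOn_kernel t)]

/-- The reduced evolution equation: the vacuum component of a tame state follows the generator
`generatorAt`, up to an error which is small except during a microscopic initial time. -/
theorem IsTame.exists_residual (hD : D.IntegrableCorr) {lam t₀ s t C : ℝ} {X : H}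
    (h : M.IsTame D lam t₀ s C X) (h0 : t₀ ≤ s) (hst : s ≤ t) :
    ∃ e, HasDerivAt (fun t => M.vacProj (M.prop D lam t s X))
        (((lam ^ 2 : ℝ) : ℂ) • D.generatorAt t (M.vacProj (M.prop D lam t s X)) + e) t ∧
      ‖e‖ ≤ lam ^ 2 * C * (2 * D.tail (t - s) + 2 * D.modulus (D.tail 0 * lam ^ 2)) := by
  have hC : 0 ≤ C := (norm_nonneg _).trans h.norm_le
  choose Y hY1 hY2 using fun α => h.exists_annPair (D.vecAt t α)
  set m := M.vacProj (M.prop D lam t s X) with hm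
  have hmC : ‖m‖ ≤ C := (M.norm_vacProj_le _).trans ((M.norm_prop D lam t s X).le.trans h.norm_le)
  set J : A → ℝ → 𝓚 := fun β r =>
    M.vacProj (M.prop D lam t r (M.op (D.opAt r β) 1 (M.prop D lam r s X))) with hJ
  have hJc : ∀ β, Continuous (J β) := fun β => M.vacProj.continuous.comp
    (M.continuous_prop D lam continuous_const continuous_id
      (((M.continuous_op_left 1).comp (D.continuous_opAt β)).clm_apply
        (M.continuous_prop D lam continuous_id continuous_const continuous_const)))
  have hcorr : ∀ α β, Continuous fun r => D.corr α β (t - r) := fun α β =>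
    (D.continuous_corr α β).comp (continuous_const.sub continuous_id)
  set f : ℝ → 𝓚 := fun r => ∑ α, ∑ β, D.corr α β (t - r) •
    ContinuousLinearMap.adjoint (D.opAt t α) (J β r) with hf
  have hfc : Continuous f := continuous_finsetSum _ fun α _ => continuous_finsetSum _ fun β _ =>
    (hcorr α β).smul ((ContinuousLinearMap.continuous _).comp (hJc β))
  have hkc : Continuous fun r => D.kernel t (t - r) m :=
    ((D.continuous_kernel t).comp (continuous_const.sub continuous_id)).clm_apply continuous_const
  set P := -(Complex.I * (lam : ℂ)) •
    ∑ α, ContinuousLinearMap.adjoint (D.opAt t α) (M.vacProj (M.prop D lam t s (Y α))) with hP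
  -- Duhamel's formula, inserted into the derivative of the vacuum component
  have hderiv : HasDerivAt (fun t => M.vacProj (M.prop D lam t s X))
      (P - ((lam ^ 2 : ℝ) : ℂ) • ∫ r in s..t, f r) t := by
    refine (M.hasDerivAt_vacProj_prop D lam s t X
      (fun α => (hY1 α).prop M D hst)).congr_deriv ?_
    have h1 : ∀ α, ContinuousLinearMap.adjoint (D.opAt t α)
        (M.vacProj (M.duhamel D lam t s (D.vecAt t α) X (Y α))) =
        ContinuousLinearMap.adjoint (D.opAt t α) (M.vacProj (M.prop D lam t s (Y α))) +
        -(Complex.I * (lam : ℂ)) • ∫ r in s..t, ∑ β, D.corr α β (t - r) •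
          ContinuousLinearMap.adjoint (D.opAt t α) (J β r) := by
      intro α
      rw [duhamel, map_add, map_add, map_add, map_smul, map_smul, map_smul]
      congr 2
      have h2 := ((ContinuousLinearMap.adjoint (D.opAt t α)) ∘L M.vacProj ∘L
        M.prop D lam t s).intervalIntegral_comp_comm (μ := volume)
        ((M.continuous_source D lam s (D.vecAt t α) X).intervalIntegrable s t)
      simp only [ContinuousLinearMap.comp_apply] at h2
      rw [← h2]
      refine intervalIntegral.integral_congr fun r _ => ?_
      simp only [source, map_sum, map_smul, M.prop_prop, D.inner_vecAt, hJ]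
    simp only [h1]
    rw [Finset.sum_add_distrib, ← Finset.smul_sum, smul_add, smul_smul, sub_eq_add_neg, ← neg_smul]
    congr 1
    have h3 : ∫ r in s..t, f r = ∑ α, ∫ r in s..t, ∑ β, D.corr α β (t - r) •
        ContinuousLinearMap.adjoint (D.opAt t α) (J β r) := by
      rw [hf, intervalIntegral.integral_finsetSum]
      exact fun α _ => (continuous_finsetSum _ fun β _ =>
        (hcorr α β).smul ((ContinuousLinearMap.continuous _).comp (hJc β))).intervalIntegrable s t
    rw [h3]
    congr 1
    push_cast
    linear_combination (lam : ℂ) ^ 2 * Complex.I_mul_I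
  -- The residual has three parts: the correlations of the state with the coupling before time `s`,
  -- the replacement of `J β r` by `D.opAt r β m` in the memory integral, and the memory before time
  -- `s`.
  refine ⟨P - ((lam ^ 2 : ℝ) : ℂ) • (∫ r in s..t, (f r - D.kernel t (t - r) m)) +
    ((lam ^ 2 : ℝ) : ℂ) • ∫ x in Set.Ioi (t - s), D.kernel t x m, ?_, ?_⟩
  · refine hderiv.congr_deriv ?_
    rw [generatorAt_apply hD hst, intervalIntegral.integral_sub (hfc.intervalIntegrable _ _)
      (hkc.intervalIntegrable _ _), smul_neg, smul_add, smul_sub]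
    abel
  have hP' : ‖P‖ ≤ lam ^ 2 * C * D.tail (t - s) := by
    refine (M.norm_sum_adjoint_opAt_le (a := t₀) (b := s) (C := C) (fun α => ?_)).trans ?_
    · rw [M.norm_prop]; exact hY2 α
    · exact mul_le_mul_of_nonneg_left (hD.integral_weight_sub_le h0 hst) (by positivity)
  have htail : ‖∫ x in Set.Ioi (t - s), D.kernel t x m‖ ≤ C * D.tail (t - s) := by
    rw [Coupling.tail, ← integral_const_mul]
    refine norm_integral_le_of_norm_le
      ((hD.integrableOn_weight_Ioi (sub_nonneg.2 hst)).const_mul C) (Eventually.of_forall fun x => ?_)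
    rw [mul_comm]
    exact ((D.kernel t x).le_opNorm m).trans
      (mul_le_mul (D.norm_kernel_le t x) hmC (norm_nonneg _) (D.weight_nonneg x))
  have hmid : ‖∫ r in s..t, (f r - D.kernel t (t - r) m)‖ ≤
      2 * C * D.modulus (D.tail 0 * lam ^ 2) := by
    set δ := D.tail 0 * lam ^ 2 with hδ
    have hδ0 : 0 ≤ δ := mul_nonneg (D.tail_nonneg 0) (sq_nonneg _)
    have hgc : Continuous fun y => D.weight y * min 1 (δ * y) :=
      D.continuous_weight.mul (by fun_prop)
    have h1 : ‖∫ r in s..t, (f r - D.kernel t (t - r) m)‖ ≤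
        ∫ r in s..t, 2 * C * (D.weight (t - r) * min 1 (δ * (t - r))) := by
      refine intervalIntegral.norm_integral_le_of_norm_le hst (Eventually.of_forall fun r hr => ?_)
        (((hgc.comp (continuous_const.sub continuous_id)).const_mul _).intervalIntegrable _ _)
      rw [kernel_apply, hf]
      simp only [← Finset.sum_sub_distrib, ← smul_sub, ← map_sub, sub_sub_cancel]
      rw [Coupling.weight, Finset.sum_mul, Finset.mul_sum]
      refine (norm_sum_le _ _).trans (Finset.sum_le_sum fun α _ => ?_)
      rw [Finset.mul_sum, Finset.sum_mul, Finset.mul_sum]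
      refine (norm_sum_le _ _).trans (Finset.sum_le_sum fun β _ => ?_)
      rw [norm_smul]
      have h2 := h.norm_vacProj_op_sub_le M hD h0 hr.1.le hr.2 (D.opAt r β)
      have hmin : 0 ≤ min 1 (δ * (t - r)) :=
        le_min zero_le_one (mul_nonneg hδ0 (sub_nonneg.2 hr.2))
      have h3 : ‖ContinuousLinearMap.adjoint (D.opAt t α) (J β r - D.opAt r β m)‖ ≤
          ‖D.E α‖ * (‖D.E β‖ * (2 * C * min 1 (δ * (t - r)))) := by
        refine (ContinuousLinearMap.le_of_opNorm_le _ (D.norm_adjoint_opAt_le t α) _).trans ?_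
        refine mul_le_mul_of_nonneg_left (h2.trans ?_) (norm_nonneg _)
        exact mul_le_mul_of_nonneg_right (D.norm_opAt_le r β) (by positivity)
      exact (mul_le_mul_of_nonneg_left h3 (norm_nonneg _)).trans (le_of_eq (by ring))
    refine h1.trans ?_
    rw [intervalIntegral.integral_const_mul]
    refine mul_le_mul_of_nonneg_left ?_ (by positivity)
    rw [intervalIntegral.integral_comp_sub_left (fun y => D.weight y * min 1 (δ * y)), sub_self,
      intervalIntegral.integral_of_le (sub_nonneg.2 hst), Coupling.modulus]
    refine setIntegral_mono_set (hD.integrableOn_modulus hδ0) ?_ Set.Ioc_subset_Ioi_self.eventuallyLE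
    refine (ae_restrict_iff' measurableSet_Ioi).2 (Eventually.of_forall fun y hy => ?_)
    exact mul_nonneg (D.weight_nonneg y) (le_min zero_le_one (mul_nonneg hδ0 (le_of_lt hy)))
  have hl : ‖((lam ^ 2 : ℝ) : ℂ)‖ = lam ^ 2 := by
    rw [Complex.norm_real, Real.norm_of_nonneg (sq_nonneg _)]
  refine (norm_add_le _ _).trans ((add_le_add_left (norm_sub_le _ _) _).trans ?_)
  have hsm : ∀ y : 𝓚, ‖((lam ^ 2 : ℝ) : ℂ) • y‖ = lam ^ 2 * ‖y‖ := fun y => by rw [norm_smul, hl]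
  rw [hsm, hsm]
  have h4 := mul_le_mul_of_nonneg_left hmid (sq_nonneg lam)
  have h5 := mul_le_mul_of_nonneg_left htail (sq_nonneg lam)
  linarith

/-- The vacuum component of a tame state follows the averaged semigroup `e^{λ²(t-s)G}`, when the
oscillating part `generatorAt - G` has a bounded primitive `B`. The quantity
`e^{-λ²(t-s)G} (1 - λ² B(t)) m(t)` has a derivative of smaller order than that of `m`. -/
theorem exists_averaging_bound (hD : D.IntegrableCorr) {G : 𝓚 →L[ℂ] 𝓚} {B : ℝ → 𝓚 →L[ℂ] 𝓚} {b : ℝ}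
    (hB : ∀ t, ‖B t‖ ≤ b) (hBd : ∀ t, HasDerivAt B (D.generatorAt t - G) t) (T : ℝ) :
    ∃ δ : ℝ → ℝ, Tendsto δ (𝓝[>] 0) (𝓝 0) ∧ ∀ lam : ℝ, 0 < lam → ∀ (t₀ s t C : ℝ) (X : H),
      t₀ ≤ s → s ≤ t → lam ^ 2 * (t - s) ≤ T → M.IsTame D lam t₀ s C X →
      ‖M.vacProj (M.prop D lam t s X) -
        NormedSpace.exp ((lam ^ 2 * (t - s)) • G) (M.vacProj X)‖ ≤ δ lam * C := by
  let _ : NormedAlgebra ℚ (𝓚 →L[ℂ] 𝓚) := NormedAlgebra.restrictScalars ℚ ℝ _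
  -- a bound for the semigroup and its inverse up to the time `T`
  obtain ⟨e0, he0⟩ := (isCompact_Icc (a := -T) (b := T)).exists_bound_of_continuousOn
    (f := fun r : ℝ => NormedSpace.exp (r • G))
    (NormedSpace.exp_continuous.comp (by fun_prop)).continuousOn
  set a := D.tail 0 with ha
  have ha0 : 0 ≤ a := D.tail_nonneg 0
  have hb0 : 0 ≤ b := (norm_nonneg _).trans (hB 0)
  set c : ℝ → ℝ := fun lam => lam ^ 2 * (b * (‖G‖ + a)) + 2 * D.modulus (a * lam ^ 2) with hc
  refine ⟨fun lam => e0 * (e0 * ((c lam + 2 * a) * lam + (c lam + 2 * D.tail lam⁻¹) * T)) +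
    lam ^ 2 * b * (1 + e0), ?_, ?_⟩
  · have hid : Tendsto (fun lam : ℝ => lam) (𝓝[>] 0) (𝓝 0) := tendsto_id.mono_left nhdsWithin_le_nhds
    have hsq : Tendsto (fun lam : ℝ => lam ^ 2) (𝓝[>] 0) (𝓝 0) := by simpa using hid.pow 2
    have hmod : Tendsto (fun lam : ℝ => D.modulus (a * lam ^ 2)) (𝓝[>] 0) (𝓝 0) := by
      refine hD.tendsto_modulus.comp (tendsto_nhdsWithin_iff.2 ⟨by simpa using hsq.const_mul a, ?_⟩)
      exact Eventually.of_forall fun lam => mul_nonneg ha0 (sq_nonneg _)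
    have hc0 : Tendsto c (𝓝[>] 0) (𝓝 0) := by
      simpa using (hsq.mul_const (b * (‖G‖ + a))).add (hmod.const_mul 2)
    have htail : Tendsto (fun lam : ℝ => D.tail lam⁻¹) (𝓝[>] 0) (𝓝 0) :=
      hD.tendsto_tail.comp tendsto_inv_nhdsGT_zero
    simpa using (((((hc0.add_const (2 * a)).mul hid).add
      ((hc0.add (htail.const_mul 2)).mul_const T)).const_mul e0).const_mul e0).add
      ((hsq.mul_const b).mul_const (1 + e0))
  intro lam hlam t₀ s t C X h0 hst hT h
  have hC : 0 ≤ C := (norm_nonneg _).trans h.norm_le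
  set m : ℝ → 𝓚 := fun x => M.vacProj (M.prop D lam x s X) with hm
  have hmC : ∀ x, ‖m x‖ ≤ C := fun x =>
    (M.norm_vacProj_le _).trans ((M.norm_prop D lam x s X).le.trans h.norm_le)
  set κ : ℂ := ((lam ^ 2 : ℝ) : ℂ) with hκ
  have hκn : ‖κ‖ = lam ^ 2 := by
    rw [hκ, Complex.norm_real, Real.norm_of_nonneg (sq_nonneg _)]
  choose! e hm1 he using fun x (hx : s ≤ x) => h.exists_residual M hD h0 hx
  have hm' : ∀ x, s ≤ x → ‖κ • D.generatorAt x (m x) + e x‖ ≤ lam ^ 2 * C * a := by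
    intro x hx
    obtain ⟨m', h1, h2⟩ := h.exists_hasDerivAt_vacProj M hD h0 hx
    rw [(hm1 x hx).unique h1]
    exact h2
  -- the averaged semigroup, run backwards
  set U : ℝ → 𝓚 →L[ℂ] 𝓚 := fun x => NormedSpace.exp ((-(lam ^ 2 * (x - s))) • G) with hU
  have hUn : ∀ x ∈ Set.Icc s t, ‖U x‖ ≤ e0 := by
    intro x hx
    have h1 : 0 ≤ lam ^ 2 * (x - s) := mul_nonneg (sq_nonneg _) (sub_nonneg.2 hx.1)
    have h2 : lam ^ 2 * (x - s) ≤ lam ^ 2 * (t - s) :=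
      mul_le_mul_of_nonneg_left (by linarith [hx.2]) (sq_nonneg _)
    exact he0 _ ⟨by linarith, by linarith⟩
  have he00 : 0 ≤ e0 := (norm_nonneg _).trans (hUn s ⟨le_rfl, hst⟩)
  have hUd : ∀ x, HasDerivAt U (-(κ • (U x * G))) x := by
    intro x
    have h1 : HasDerivAt (fun x : ℝ => -(lam ^ 2 * (x - s))) (-(lam ^ 2)) x := by
      exact (((hasDerivAt_id x).sub_const s).const_mul (lam ^ 2)).neg.congr_deriv (by simp)
    have h2 := (hasDerivAt_exp_smul_const (𝕂 := ℝ) G (-(lam ^ 2 * (x - s)))).scomp x h1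
    refine h2.congr_deriv ?_
    rw [neg_smul, hκ, Complex.coe_smul]
  set N : ℝ → 𝓚 := fun x => m x - κ • B x (m x) with hN
  have hNd : ∀ x, s ≤ x → HasDerivAt N ((κ • D.generatorAt x (m x) + e x) -
      κ • ((D.generatorAt x - G) (m x) + B x (κ • D.generatorAt x (m x) + e x))) x := by
    intro x hx
    exact (hm1 x hx).sub ((HasDerivAt.clm_bilinear (ContinuousLinearMap.id ℂ (𝓚 →L[ℂ] 𝓚))
      (hBd x) (hm1 x hx)).const_smul κ)
  -- `ρ` is what remains of the derivative of `U N` after the terms of order `λ²` cancel. The term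
  -- `-λ² B' m = -λ² (generatorAt - G) m` of `N'` turns the generator into `G`, and then `U'`, which is
  -- `-λ² U G`, compensates it.
  set ρ : ℝ → 𝓚 := fun x => e x - κ • B x (κ • D.generatorAt x (m x) + e x) +
    κ • κ • G (B x (m x)) with hρ
  have hqd : ∀ x, s ≤ x → HasDerivAt (fun x => U x (N x)) (U x (ρ x)) x := by
    intro x hx
    refine (HasDerivAt.clm_bilinear (ContinuousLinearMap.id ℂ (𝓚 →L[ℂ] 𝓚))
      (hUd x) (hNd x hx)).congr_deriv ?_
    have h1 : ρ x = ((κ • D.generatorAt x (m x) + e x) -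
      κ • ((D.generatorAt x - G) (m x) + B x (κ • D.generatorAt x (m x) + e x))) -
        κ • G (N x) := by
      simp only [hρ, hN, sub_apply, map_sub, map_smul, smul_add, smul_sub, map_add]
      abel
    have h2 : ∀ n d : 𝓚, (-(κ • (U x * G))) n + U x d = U x (d - κ • G n) := by
      intro n d
      rw [map_sub, map_smul, neg_apply, smul_apply, mul_apply_eq_comp]
      abel
    rw [h1]
    exact h2 _ _
  have hρn : ∀ x, s ≤ x → ‖ρ x‖ ≤ lam ^ 2 * C * (c lam + 2 * D.tail (x - s)) := by
    intro x hx
    have h1 : ‖κ • B x (κ • D.generatorAt x (m x) + e x)‖ ≤ lam ^ 2 * (b * (lam ^ 2 * C * a)) := by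
      rw [norm_smul, hκn]
      refine mul_le_mul_of_nonneg_left (((B x).le_opNorm _).trans ?_) (sq_nonneg _)
      exact mul_le_mul (hB x) (hm' x hx) (norm_nonneg _) hb0
    have h2 : ‖κ • κ • G (B x (m x))‖ ≤ lam ^ 2 * (lam ^ 2 * (‖G‖ * (b * C))) := by
      rw [norm_smul, norm_smul, hκn]
      refine mul_le_mul_of_nonneg_left (mul_le_mul_of_nonneg_left ((G.le_opNorm _).trans ?_)
        (sq_nonneg _)) (sq_nonneg _)
      refine mul_le_mul_of_nonneg_left (((B x).le_opNorm _).trans ?_) (norm_nonneg _)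
      exact mul_le_mul (hB x) (hmC x) (norm_nonneg _) hb0
    refine (norm_add_le _ _).trans ((add_le_add_left (norm_sub_le _ _) _).trans ?_)
    have h3 := he x hx
    simp only [hc]
    linarith
  have hq : ‖U t (N t) - U s (N s)‖ ≤
      e0 * ((c lam + 2 * a) * lam + (c lam + 2 * D.tail lam⁻¹) * T) * C := by
    have hmod0 : 0 ≤ D.modulus (a * lam ^ 2) := setIntegral_nonneg measurableSet_Ioi fun y hy =>
      mul_nonneg (D.weight_nonneg y) (le_min zero_le_one
        (mul_nonneg (mul_nonneg ha0 (sq_nonneg _)) (le_of_lt hy)))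
    have hc0 : 0 ≤ c lam := by positivity
    have hmv : ∀ x y τ, s ≤ x → x ≤ y → y ≤ t → (∀ r ∈ Set.Ico x y, D.tail (r - s) ≤ τ) →
        ‖U y (N y) - U x (N x)‖ ≤ e0 * (lam ^ 2 * C * (c lam + 2 * τ)) * (y - x) := by
      intro x y τ hsx hxy hyt hτ
      refine norm_image_sub_le_of_norm_deriv_le_segment' (f := fun x => U x (N x))
        (f' := fun x => U x (ρ x)) (a := x) (b := y)
        (fun r hr => (hqd r (hsx.trans hr.1)).hasDerivWithinAt) (fun r hr => ?_) y ⟨hxy, le_rfl⟩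
      refine ((U r).le_opNorm _).trans (mul_le_mul (hUn r ⟨hsx.trans hr.1, hr.2.le.trans hyt⟩)
        ((hρn r (hsx.trans hr.1)).trans ?_) (norm_nonneg _) he00)
      have := hτ r hr
      gcongr
    -- The correlations with the past of `s` die out on the microscopic scale, so that splitting
    -- at the intermediate time `s + 1 / λ` makes both contributions small.
    set y := min t (s + lam⁻¹) with hy
    have hinv : 0 < lam⁻¹ := inv_pos.2 hlam
    have hsy : s ≤ y := le_min hst (by linarith)
    have h1 := hmv s y a le_rfl hsy (min_le_left _ _) fun r hr =>
      hD.tail_anti le_rfl (sub_nonneg.2 hr.1)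
    have h2 : ‖U t (N t) - U y (N y)‖ ≤
        e0 * (lam ^ 2 * C * (c lam + 2 * D.tail lam⁻¹)) * (t - y) := by
      refine hmv y t _ hsy (min_le_left _ _) le_rfl fun r hr => hD.tail_anti hinv.le ?_
      rcases min_choice t (s + lam⁻¹) with h3 | h3
      · rw [hy, h3] at hr; exact absurd hr.2 (not_lt.2 hr.1)
      · rw [hy, h3] at hr; linarith [hr.1]
    have h3 : lam ^ 2 * (y - s) ≤ lam := by
      have : y - s ≤ lam⁻¹ := by linarith [min_le_right t (s + lam⁻¹)]
      calc lam ^ 2 * (y - s) ≤ lam ^ 2 * lam⁻¹ := mul_le_mul_of_nonneg_left this (sq_nonneg _)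
        _ = lam := by field_simp
    have h4 : lam ^ 2 * (t - y) ≤ T :=
      (mul_le_mul_of_nonneg_left (by linarith) (sq_nonneg lam)).trans hT
    have htl : 0 ≤ D.tail lam⁻¹ := D.tail_nonneg _
    calc ‖U t (N t) - U s (N s)‖ ≤ ‖U t (N t) - U y (N y)‖ + ‖U y (N y) - U s (N s)‖ :=
          norm_sub_le_norm_sub_add_norm_sub _ _ _
      _ ≤ e0 * (lam ^ 2 * C * (c lam + 2 * D.tail lam⁻¹)) * (t - y) +
          e0 * (lam ^ 2 * C * (c lam + 2 * a)) * (y - s) := add_le_add h2 h1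
      _ = e0 * C * (c lam + 2 * D.tail lam⁻¹) * (lam ^ 2 * (t - y)) +
          e0 * C * (c lam + 2 * a) * (lam ^ 2 * (y - s)) := by ring
      _ ≤ e0 * C * (c lam + 2 * D.tail lam⁻¹) * T + e0 * C * (c lam + 2 * a) * lam := by
          gcongr
      _ = _ := by ring
  set V := NormedSpace.exp ((lam ^ 2 * (t - s)) • G) with hV
  have hVU : ∀ k, V (U t k) = k := by
    intro k
    have := exp_smul_neg_mul G (-(lam ^ 2 * (t - s)))
    rw [neg_neg] at this
    exact congrArg (fun L : 𝓚 →L[ℂ] 𝓚 => L k) this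
  have hVn : ‖V‖ ≤ e0 := by
    have h1 : 0 ≤ lam ^ 2 * (t - s) := mul_nonneg (sq_nonneg _) (sub_nonneg.2 hst)
    exact he0 _ ⟨by linarith, hT⟩
  have hms : m s = M.vacProj X := by rw [hm]; simp only [M.prop_self]
  have hUs : U s = 1 := by simp [hU, NormedSpace.exp_zero]
  have hfin : m t - V (M.vacProj X) =
      V (U t (N t) - U s (N s)) + κ • B t (m t) - V (κ • B s (m s)) := by
    rw [map_sub, hVU, hUs, one_apply_eq_self, hN, ← hms]
    simp only [map_sub]
    abel
  rw [hfin]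
  have hBn : ∀ x, ‖κ • B x (m x)‖ ≤ lam ^ 2 * (b * C) := fun x => by
    rw [norm_smul, hκn]
    exact mul_le_mul_of_nonneg_left (((B x).le_opNorm _).trans
      (mul_le_mul (hB x) (hmC x) (norm_nonneg _) hb0)) (sq_nonneg _)
  have h1 : ‖V (U t (N t) - U s (N s))‖ ≤
      e0 * (e0 * ((c lam + 2 * a) * lam + (c lam + 2 * D.tail lam⁻¹) * T) * C) :=
    (V.le_opNorm _).trans (mul_le_mul hVn hq (norm_nonneg _) he00)
  have h2 : ‖V (κ • B s (m s))‖ ≤ e0 * (lam ^ 2 * (b * C)) :=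
    (V.le_opNorm _).trans (mul_le_mul hVn (hBn s) (norm_nonneg _) he00)
  refine (norm_sub_le _ _).trans ((add_le_add_left (norm_add_le _ _) _).trans ?_)
  have h3 := hBn t
  linarith

end CoupledModel

/-! ### Spectral averaging and multi-time correlations -/

theorem systemGroup_apply_of_eigenvector {𝓚 : Type v} [NormedAddCommGroup 𝓚]
    [InnerProductSpace ℂ 𝓚] [CompleteSpace 𝓚] {K : 𝓚 →L[ℂ] 𝓚} (hK : IsSelfAdjoint K) {κ : ℝ} {x : 𝓚}
    (hx : K x = (κ : ℂ) • x) (t : ℝ) :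
    systemGroup K t x = Complex.exp (-(Complex.I * t * κ)) • x := by
  have hd : ∀ t : ℝ, HasDerivAt (fun t : ℝ => Complex.exp (Complex.I * t * κ) •
      systemGroup K t x) 0 t := by
    intro t
    have h0 : HasDerivAt (fun t : ℝ => Complex.I * (t : ℂ) * κ) (Complex.I * κ) t := by
      simpa using ((Complex.ofRealCLM.hasDerivAt (x := t)).const_mul Complex.I).mul_const (κ : ℂ)
    refine (h0.cexp.smul (hasDerivAt_systemGroup hK x t)).congr_deriv ?_
    rw [systemGroup_comm, hx, map_smul, ← smul_neg, ← neg_smul, smul_smul, smul_smul, ← add_smul]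
    convert zero_smul ℂ _ using 2
    ring
  have h1 := is_const_of_deriv_eq_zero (fun t => (hd t).differentiableAt) (fun t => (hd t).deriv) t 0
  simp only [(isUnitaryGroupGeneratedBy_systemGroup hK).zero, one_apply_eq_self,
    Complex.ofReal_zero, mul_zero, zero_mul, Complex.exp_zero, one_smul] at h1
  conv_rhs => rw [← h1]
  rw [smul_smul, ← Complex.exp_add, neg_add_cancel, Complex.exp_zero, one_smul]

namespace Coupling

variable {𝓚 : Type v} [NormedAddCommGroup 𝓚] [InnerProductSpace ℂ 𝓚] [CompleteSpace 𝓚]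
variable {R : Type u} [NormedAddCommGroup R] [InnerProductSpace ℂ R] [CompleteSpace R]
variable {A : Type*} [Fintype A]
variable (D : Coupling 𝓚 R A)

theorem heis_comp (t : ℝ) (B C : 𝓚 →L[ℂ] 𝓚) : D.heis t (B ∘L C) = D.heis t B ∘L D.heis t C := by
  ext k
  simp only [heis, ContinuousLinearMap.comp_apply, D.isUnitaryGroup_K.apply_neg]

theorem heis_heis (s t : ℝ) (B : 𝓚 →L[ℂ] 𝓚) : D.heis s (D.heis t B) = D.heis (s + t) B := by
  ext k
  simp only [heis, ContinuousLinearMap.comp_apply]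
  rw [neg_add_rev, add_comm s t, D.isUnitaryGroup_K.add, D.isUnitaryGroup_K.add t s,
    mul_apply_eq_comp, mul_apply_eq_comp]
  rw [← mul_apply_eq_comp (systemGroup D.K (-s)), ← mul_apply_eq_comp (systemGroup D.K (-t)),
    ← D.isUnitaryGroup_K.add, ← D.isUnitaryGroup_K.add, add_comm]

theorem kernel_eq_heis (t x : ℝ) : D.kernel t x = D.heis t (D.kernel 0 x) := by
  have h1 : ∀ α β, ContinuousLinearMap.adjoint (D.opAt t α) ∘L D.opAt (t - x) β =
      D.heis t (ContinuousLinearMap.adjoint (D.opAt 0 α) ∘L D.opAt (0 - x) β) := by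
    intro α β
    rw [D.heis_comp, opAt, opAt, opAt, opAt, D.adjoint_heis, D.adjoint_heis, D.heis_heis,
      D.heis_heis, add_zero, zero_sub, ← sub_eq_add_neg]
  ext k
  simp only [kernel, h1, sum_apply, smul_apply, heis, ContinuousLinearMap.comp_apply, map_sum,
    map_smul]

/-- The generator before averaging is a Heisenberg evolution, hence almost periodic in time. -/
theorem generatorAt_eq_heis (hD : D.IntegrableCorr) (t : ℝ) :
    D.generatorAt t = D.heis t (D.generatorAt 0) := by
  ext k
  simp only [generatorAt, heis, ContinuousLinearMap.comp_apply, neg_apply, map_neg]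
  rw [ContinuousLinearMap.integral_apply (hD.integrableOn_kernel t),
    ContinuousLinearMap.integral_apply (hD.integrableOn_kernel 0)]
  have hK : IntegrableOn (fun x => D.kernel 0 x (systemGroup D.K t k)) (Set.Ioi 0) :=
    (ContinuousLinearMap.apply ℂ 𝓚 (systemGroup D.K t k)).integrable_comp
      (hD.integrableOn_kernel 0)
  rw [← (systemGroup D.K (-t)).integral_comp_comm hK]
  congr 1
  refine integral_congr_ae (Eventually.of_forall fun x => ?_)
  simp only
  rw [D.kernel_eq_heis]
  rfl

variable {ι : Type*} [Fintype ι]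

/-- In an eigenbasis of `K` the oscillating part of a Heisenberg evolution has a bounded
primitive. -/
theorem exists_primitive (b : OrthonormalBasis ι ℂ 𝓚) {κ : ι → ℝ}
    (hb : ∀ i, D.K (b i) = (κ i : ℂ) • b i) (L G : 𝓚 →L[ℂ] 𝓚)
    (hG : ∀ i j, ⟪b i, G (b j)⟫_ℂ = if κ i = κ j then ⟪b i, L (b j)⟫_ℂ else 0) :
    ∃ (B : ℝ → 𝓚 →L[ℂ] 𝓚) (C : ℝ), (∀ t, ‖B t‖ ≤ C) ∧ ∀ t, HasDerivAt B (D.heis t L - G) t := by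
  have hexp : ∀ t i, systemGroup D.K t (b i) = Complex.exp (-(Complex.I * t * κ i)) • b i :=
    fun t i => systemGroup_apply_of_eigenvector D.isSelfAdjoint_K (hb i) t
  set E : ι → ι → 𝓚 →L[ℂ] 𝓚 := fun i j => ContinuousLinearMap.smulRight (innerSL ℂ (b j)) (b i)
    with hE
  have hEa : ∀ i j k, E i j k = ⟪b j, k⟫_ℂ • b i := fun i j k => by simp [hE]
  have hdec : ∀ L : 𝓚 →L[ℂ] 𝓚, L = ∑ i, ∑ j, ⟪b i, L (b j)⟫_ℂ • E i j := by
    intro L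
    ext k
    simp only [sum_apply, smul_apply, hEa]
    have h1 : L k = ∑ j, ⟪b j, k⟫_ℂ • L (b j) := by
      conv_lhs => rw [← b.sum_repr' k]
      simp only [map_sum, map_smul]
    rw [h1, Finset.sum_comm]
    refine Finset.sum_congr rfl fun j _ => ?_
    conv_lhs => rw [← b.sum_repr' (L (b j)), Finset.smul_sum]
    refine Finset.sum_congr rfl fun i _ => ?_
    rw [smul_smul, smul_smul, mul_comm]
  -- the matrix elements of `L` oscillate with the Bohr frequencies
  have hheis : ∀ t i j, ⟪b i, D.heis t L (b j)⟫_ℂ =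
      Complex.exp (Complex.I * t * ((κ i : ℂ) - κ j)) * ⟪b i, L (b j)⟫_ℂ := by
    intro t i j
    rw [heis, ContinuousLinearMap.comp_apply, ContinuousLinearMap.comp_apply,
      ← D.isUnitaryGroup_K.inner_left, hexp, hexp, map_smul, inner_smul_left, inner_smul_right,
      ← Complex.exp_conj, ← mul_assoc, ← Complex.exp_add]
    congr 2
    simp only [map_neg, map_mul, Complex.conj_I, Complex.conj_ofReal]
    ring
  -- the coefficients of the primitive: the oscillating matrix elements divided by `i(κᵢ - κⱼ)`
  set w : ι → ι → ℂ := fun i j =>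
    if κ i = κ j then 0 else ⟪b i, L (b j)⟫_ℂ / (Complex.I * ((κ i : ℂ) - κ j)) with hw
  refine ⟨fun t => ∑ i, ∑ j, (Complex.exp (Complex.I * t * ((κ i : ℂ) - κ j)) * w i j) • E i j,
    ∑ i, ∑ j, ‖w i j‖ * ‖E i j‖, fun t => ?_, fun t => ?_⟩
  · refine (norm_sum_le _ _).trans (Finset.sum_le_sum fun i _ => ?_)
    refine (norm_sum_le _ _).trans (Finset.sum_le_sum fun j _ => ?_)
    have h1 : Complex.I * (t : ℂ) * ((κ i : ℂ) - κ j) = ((t * (κ i - κ j) : ℝ) : ℂ) * Complex.I := by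
      push_cast; ring
    rw [norm_smul, norm_mul, h1, Complex.norm_exp_ofReal_mul_I, one_mul]
  · have h1 : D.heis t L - G = ∑ i, ∑ j, ((Complex.exp (Complex.I * t * ((κ i : ℂ) - κ j)) *
        (Complex.I * ((κ i : ℂ) - κ j))) * w i j) • E i j := by
      rw [hdec (D.heis t L - G)]
      refine Finset.sum_congr rfl fun i _ => Finset.sum_congr rfl fun j _ => ?_
      congr 1
      rw [sub_apply, inner_sub_right, hheis, hG, hw]
      by_cases h : κ i = κ j
      · simp [h]
      · have h2 : (κ i : ℂ) - κ j ≠ 0 := sub_ne_zero.2 (by exact_mod_cast h)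
        have h3 := Complex.I_ne_zero
        simp only [h, if_false, sub_zero]
        field_simp
    rw [h1]
    refine HasDerivAt.fun_sum fun i _ => HasDerivAt.fun_sum fun j _ => ?_
    have h0 : HasDerivAt (fun t : ℝ => Complex.I * (t : ℂ) * ((κ i : ℂ) - κ j))
        (Complex.I * ((κ i : ℂ) - κ j)) t := by
      simpa using ((Complex.ofRealCLM.hasDerivAt (x := t)).const_mul Complex.I).mul_const
        ((κ i : ℂ) - κ j)
    exact (h0.cexp.mul_const (w i j)).smul_const (E i j)

end Coupling

namespace CoupledModel

variable {𝓚 : Type v} [NormedAddCommGroup 𝓚] [InnerProductSpace ℂ 𝓚] [CompleteSpace 𝓚]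
variable {R : Type u} [NormedAddCommGroup R] [InnerProductSpace ℂ R] [CompleteSpace R]
variable {F : Type w} [NormedAddCommGroup F] [InnerProductSpace ℂ F] [CompleteSpace F]
variable {H : Type*} [NormedAddCommGroup H] [InnerProductSpace ℂ H] [CompleteSpace H]
variable (M : CoupledModel 𝓚 R F H)
variable {A : Type*} [Fintype A]
variable {D : Coupling 𝓚 R A}

/-- The weak coupling limit of the multi-time correlations. The states created along the way are
tame, so that the averaging bound applies in each time interval. -/
theorem exists_multiTime_bound (hD : D.IntegrableCorr) {G : 𝓚 →L[ℂ] 𝓚} {B : ℝ → 𝓚 →L[ℂ] 𝓚} {b : ℝ}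
    (hB : ∀ t, ‖B t‖ ≤ b) (hBd : ∀ t, HasDerivAt B (D.generatorAt t - G) t) (T : ℝ) :
    ∀ (ℓ : ℕ) (S : Fin ℓ → 𝓚 →L[ℂ] 𝓚), ∃ (δ : ℝ → ℝ) (C : ℝ), Tendsto δ (𝓝[>] 0) (𝓝 0) ∧
      ∀ lam : ℝ, 0 < lam → ∀ τ : Fin (ℓ + 2) → ℝ, Monotone τ → (∀ i, τ i ∈ Set.Icc (-T) T) →
      ∀ k : 𝓚, M.IsTame D lam (lam⁻¹ ^ 2 * τ 0) (lam⁻¹ ^ 2 * τ (Fin.last (ℓ + 1))) (C * ‖k‖)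
        (multiTimeProduct (fun t t₀ => M.prop D lam (lam⁻¹ ^ 2 * t) (lam⁻¹ ^ 2 * t₀)) ℓ
          (fun i => M.op (S i) 1) τ (M.vac k)) ∧
      ‖M.vacProj (multiTimeProduct (fun t t₀ => M.prop D lam (lam⁻¹ ^ 2 * t) (lam⁻¹ ^ 2 * t₀)) ℓ
          (fun i => M.op (S i) 1) τ (M.vac k)) -
        multiTimeProduct (fun t t₀ : ℝ => NormedSpace.exp ((t - t₀) • G)) ℓ S τ k‖ ≤ δ lam * ‖k‖ := by
  let _ : NormedAlgebra ℚ (𝓚 →L[ℂ] 𝓚) := NormedAlgebra.restrictScalars ℚ ℝ _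
  obtain ⟨e0, he0⟩ := (isCompact_Icc (a := (0 : ℝ)) (b := 2 * T)).exists_bound_of_continuousOn
    (f := fun r : ℝ => NormedSpace.exp (r • G))
    (NormedSpace.exp_continuous.comp (by fun_prop)).continuousOn
  obtain ⟨δ₀, hδ₀, havg⟩ := M.exists_averaging_bound hD hB hBd (2 * T)
  have hscale : ∀ lam : ℝ, 0 < lam → ∀ t s : ℝ,
      lam ^ 2 * (lam⁻¹ ^ 2 * t - lam⁻¹ ^ 2 * s) = t - s := by
    intro lam hlam t s
    have := hlam.ne'
    field_simp
  have hmono : ∀ lam : ℝ, ∀ {t s : ℝ}, t ≤ s → lam⁻¹ ^ 2 * t ≤ lam⁻¹ ^ 2 * s := fun lam _ _ h =>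
    mul_le_mul_of_nonneg_left h (sq_nonneg _)
  intro ℓ
  induction ℓ with
  | zero =>
    intro S
    refine ⟨δ₀, 1, hδ₀, fun lam hlam τ hτ hT k => ?_⟩
    have h01 : τ 0 ≤ τ 1 := hτ (Fin.zero_le _)
    have hv : M.IsTame D lam (lam⁻¹ ^ 2 * τ 0) (lam⁻¹ ^ 2 * τ 0) (1 * ‖k‖) (M.vac k) := by
      rw [one_mul]; exact M.isTame_vac D lam _ k
    refine ⟨hv.prop M D (hmono lam h01), ?_⟩
    have h1 := havg lam hlam _ _ (lam⁻¹ ^ 2 * τ 1) _ _ le_rfl (hmono lam h01)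
      (by rw [hscale lam hlam]; linarith [(hT 1).2, (hT 0).1]) hv
    rw [hscale lam hlam, M.vacProj_vac, one_mul] at h1
    exact h1
  | succ ℓ ih =>
    intro S
    obtain ⟨δ, C, hδ, hih⟩ := ih (Fin.init S)
    set Sl := S (Fin.last ℓ) with hSl
    refine ⟨fun lam => δ₀ lam * (‖Sl‖ * C) + e0 * (‖Sl‖ * δ lam), ‖Sl‖ * C, ?_, ?_⟩
    · simpa using (hδ₀.mul_const (‖Sl‖ * C)).add ((hδ.const_mul ‖Sl‖).const_mul e0)
    intro lam hlam τ hτ hT k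
    have hτ' : Monotone (Fin.init τ) := fun i j hij => hτ (Fin.castSucc_le_castSucc_iff.2 hij)
    obtain ⟨htame, hlim⟩ := hih lam hlam (Fin.init τ) hτ' (fun i => hT _) k
    set X := multiTimeProduct (fun t t₀ => M.prop D lam (lam⁻¹ ^ 2 * t) (lam⁻¹ ^ 2 * t₀)) ℓ
      (fun i => M.op (Fin.init S i) 1) (Fin.init τ) (M.vac k) with hX
    set a := τ (Fin.last (ℓ + 1)).castSucc with ha
    set c := τ (Fin.last (ℓ + 2)) with hc
    have hac : a ≤ c := hτ (Fin.le_last _)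
    have h0a : τ 0 ≤ a := hτ (Fin.zero_le _)
    have htame' : M.IsTame D lam (lam⁻¹ ^ 2 * τ 0) (lam⁻¹ ^ 2 * a) (‖Sl‖ * C * ‖k‖)
        (M.op Sl 1 X) := by
      rw [mul_assoc]; exact htame.op M D Sl
    refine ⟨htame'.prop M D (hmono lam hac), ?_⟩
    have h1 := havg lam hlam _ _ (lam⁻¹ ^ 2 * c) _ _ (hmono lam h0a) (hmono lam hac)
      (by rw [hscale lam hlam]; linarith [(hT (Fin.last (ℓ + 2))).2,
            (hT (Fin.last (ℓ + 1)).castSucc).1]) htame'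
    rw [hscale lam hlam, M.vacProj_op] at h1
    have h2 : ‖NormedSpace.exp ((c - a) • G) (Sl (M.vacProj X)) - NormedSpace.exp ((c - a) • G)
        (Sl (multiTimeProduct (fun t t₀ : ℝ => NormedSpace.exp ((t - t₀) • G)) ℓ (Fin.init S)
          (Fin.init τ) k))‖ ≤ e0 * (‖Sl‖ * (δ lam * ‖k‖)) := by
      rw [← map_sub, ← map_sub]
      have h3 : ‖NormedSpace.exp ((c - a) • G)‖ ≤ e0 := he0 _ ⟨by linarith, by
        linarith [(hT (Fin.last (ℓ + 2))).2, (hT (Fin.last (ℓ + 1)).castSucc).1]⟩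
      refine (ContinuousLinearMap.le_opNorm _ _).trans
        (mul_le_mul h3 ?_ (norm_nonneg _) ((norm_nonneg _).trans h3))
      exact (Sl.le_opNorm _).trans (mul_le_mul_of_nonneg_left hlim (norm_nonneg _))
    refine (norm_sub_le_norm_sub_add_norm_sub _
      (NormedSpace.exp ((c - a) • G) (Sl (M.vacProj X))) _).trans ((add_le_add h1 h2).trans ?_)
    exact le_of_eq (by ring)

end CoupledModel

/-! ### Matrix elements of the coupling and the level shift operator -/

section LevelShift

variable {𝓚 : Type v} [NormedAddCommGroup 𝓚] [InnerProductSpace ℂ 𝓚] [FiniteDimensional ℂ 𝓚]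
  [CompleteSpace 𝓚]
variable {R : Type u} [NormedAddCommGroup R] [InnerProductSpace ℂ R] [CompleteSpace R]
variable {ι : Type*} [Fintype ι]

omit [FiniteDimensional ℂ 𝓚] [CompleteSpace 𝓚] [CompleteSpace R] in
/-- The resolution of the identity of the factor `𝓚`. -/
theorem sum_tmul_partialInner (b : OrthonormalBasis ι ℂ 𝓚) (z : 𝓚 ⊗[ℂ] R) :
    ∑ i, b i ⊗ₜ[ℂ] partialInner R (b i) z = z := by
  induction z with
  | zero => simp
  | add x y hx hy => simp only [map_add, TensorProduct.tmul_add, Finset.sum_add_distrib, hx, hy]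
  | tmul k x =>
    simp only [partialInner_tmul, TensorProduct.tmul_smul]
    simp only [TensorProduct.smul_tmul']
    rw [← TensorProduct.sum_tmul, b.sum_repr' k]

/-- The coupling `V = ∑ᵢⱼ |bᵢ⟩⟨bⱼ| ⊗ vᵢⱼ`, where `vᵢⱼ = (⟨bᵢ| ⊗ 1) V bⱼ` are the matrix elements of
`V` in the orthonormal basis `b`. -/
noncomputable def matrixCoupling (b : OrthonormalBasis ι ℂ 𝓚) {K : 𝓚 →L[ℂ] 𝓚}
    (hK : IsSelfAdjoint K) {HR : R →ₗ.[ℂ] R} (hHR : IsSelfAdjoint HR) (V : 𝓚 →L[ℂ] 𝓚 ⊗[ℂ] R) :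
    Coupling 𝓚 R (ι × ι) where
  K := K
  isSelfAdjoint_K := hK
  HR := HR
  isSelfAdjoint_HR := hHR
  E p := (innerSL ℂ (b p.2)).smulRight (b p.1)
  v p := partialInner R (b p.1) (V (b p.2))

variable (b : OrthonormalBasis ι ℂ 𝓚) {K : 𝓚 →L[ℂ] 𝓚} (hK : IsSelfAdjoint K) {HR : R →ₗ.[ℂ] R}
  (hHR : IsSelfAdjoint HR) (V : 𝓚 →L[ℂ] 𝓚 ⊗[ℂ] R)

omit [FiniteDimensional ℂ 𝓚] in
theorem sum_matrixCoupling (k : 𝓚) :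
    V k = ∑ α, (matrixCoupling b hK hHR V).E α k ⊗ₜ[ℂ] (matrixCoupling b hK hHR V).v α := by
  simp only [matrixCoupling, ContinuousLinearMap.smulRight_apply, innerSL_apply_apply]
  rw [Fintype.sum_prod_type, Finset.sum_comm]
  conv_lhs => rw [← b.sum_repr' k]
  rw [map_sum]
  refine Finset.sum_congr rfl fun j _ => ?_
  rw [map_smul]
  conv_lhs => rw [← sum_tmul_partialInner b (V (b j)), Finset.smul_sum]
  exact Finset.sum_congr rfl fun i _ => TensorProduct.smul_tmul' _ _ _

omit [FiniteDimensional ℂ 𝓚] [CompleteSpace R] in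
theorem oneParticleGroup_tmul (t : ℝ) (k : 𝓚) (f : R) :
    oneParticleGroup K HR t (k ⊗ₜ[ℂ] f) = systemGroup K t k ⊗ₜ[ℂ] unitaryGroup HR.graph t f := rfl

theorem inner_adjoint_tmul (j i : ι) (f : R) :
    ⟪b j, ContinuousLinearMap.adjoint V (b i ⊗ₜ[ℂ] f)⟫_ℂ = ⟪partialInner R (b i) (V (b j)), f⟫_ℂ := by
  classical
  rw [ContinuousLinearMap.adjoint_inner_right]
  conv_lhs => rw [← sum_tmul_partialInner b (V (b j)), sum_inner]
  simp [TensorProduct.inner_tmul, b.inner_eq_ite]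

/-- With the choice `S = |bᵢ⟩⟨bₗ|` the integrand `V* (S ⊗ 1) e^{-itH₀} V` has, up to a phase, a
reservoir correlation function as a matrix element. -/
theorem integrableCorr_matrixCoupling {κ : ι → ℝ} (hb : ∀ i, K (b i) = (κ i : ℂ) • b i)
    (h : IntegrabilityAssumption K HR V) : (matrixCoupling b hK hHR V).IntegrableCorr := by
  classical
  rintro ⟨i, j⟩ ⟨l, m⟩
  set D := matrixCoupling b hK hHR V with hD
  set S : 𝓚 →L[ℂ] 𝓚 := (innerSL ℂ (b l)).smulRight (b i) with hS
  refine ⟨(D.continuous_corr _ _).aestronglyMeasurable, lt_of_le_of_lt (lintegral_mono fun t => ?_) (h S)⟩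
  have h1 : (S.rTensor R) (oneParticleGroup K HR t (V (b m))) =
      Complex.exp (-(Complex.I * t * κ l)) • (b i ⊗ₜ[ℂ] unitaryGroup HR.graph t (D.v (l, m))) := by
    conv_lhs => rw [← sum_tmul_partialInner b (V (b m)), map_sum, map_sum]
    rw [Finset.sum_eq_single l]
    · rw [oneParticleGroup_tmul, systemGroup_apply_of_eigenvector hK (hb l)]
      change S _ ⊗ₜ[ℂ] _ = _
      rw [map_smul, ← TensorProduct.smul_tmul']
      congr 2
      simp [hS]
    · intro p _ hp
      rw [oneParticleGroup_tmul, systemGroup_apply_of_eigenvector hK (hb p)]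
      change S _ ⊗ₜ[ℂ] _ = _
      rw [map_smul]
      have : S (b p) = 0 := by simp [hS, b.inner_eq_ite, Ne.symm hp]
      rw [this, smul_zero, TensorProduct.zero_tmul]
    · simp
  set X := ContinuousLinearMap.adjoint V ∘L S.rTensor R ∘L oneParticleGroup K HR t ∘L V with hX
  have h2 : ⟪b j, X (b m)⟫_ℂ = Complex.exp (-(Complex.I * t * κ l)) * D.corr (i, j) (l, m) t := by
    rw [hX]
    simp only [ContinuousLinearMap.comp_apply]
    rw [h1, map_smul, inner_smul_right, inner_adjoint_tmul]
    rfl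
  have h3 : ‖Complex.exp (-(Complex.I * t * κ l))‖ = 1 := by
    have : -(Complex.I * t * κ l) = ((-(t * κ l) : ℝ) : ℂ) * Complex.I := by push_cast; ring
    rw [this, Complex.norm_exp_ofReal_mul_I]
  have h4 : ‖D.corr (i, j) (l, m) t‖ ≤ ‖X‖ := by
    have h5 := (norm_inner_le_norm (𝕜 := ℂ) (b j) (X (b m))).trans
      (mul_le_mul_of_nonneg_left (X.le_opNorm (b m)) (norm_nonneg _))
    rwa [h2, norm_mul, h3, b.norm_eq_one, b.norm_eq_one, one_mul, one_mul, mul_one] at h5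
  exact enorm_le_iff_norm_le.2 h4

/-- On an eigenvector of `K` the memory kernel is the integrand of `Υ`. -/
theorem kernel_zero_apply_of_eigenvector {κ : ℝ} {x : 𝓚} (hx : K x = (κ : ℂ) • x) (t : ℝ) :
    (matrixCoupling b hK hHR V).kernel 0 t x =
      ContinuousLinearMap.adjoint V
        (Complex.exp (Complex.I * t * κ) • oneParticleGroup K HR t (V x)) := by
  set D := matrixCoupling b hK hHR V with hD
  have h1 : ∀ β, D.opAt (0 - t) β x = Complex.exp (Complex.I * t * κ) • systemGroup K t (D.E β x) := by
    intro β
    simp only [Coupling.opAt, Coupling.heis, ContinuousLinearMap.comp_apply]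
    change systemGroup K _ (D.E β (systemGroup K _ x)) = _
    rw [systemGroup_apply_of_eigenvector hK hx, map_smul, map_smul]
    congr 2
    · push_cast; ring_nf
    · simp
  have h2 : ∀ α, D.opAt 0 α = D.E α := by
    intro α
    simp only [Coupling.opAt, Coupling.heis, neg_zero, D.isUnitaryGroup_K.zero]
    rfl
  conv_rhs => rw [sum_matrixCoupling b hK hHR V x, map_sum, Finset.smul_sum, map_sum]
  simp only [Coupling.kernel, sum_apply, smul_apply, ContinuousLinearMap.comp_apply, h1, h2]
  rw [Finset.sum_comm]
  refine Finset.sum_congr rfl fun β _ => ?_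
  rw [oneParticleGroup_tmul, map_smul, adjoint_apply_tmul (sum_matrixCoupling b hK hHR V),
    Finset.smul_sum]
  refine Finset.sum_congr rfl fun α _ => ?_
  rw [map_smul, smul_comm]
  rfl

omit [FiniteDimensional ℂ 𝓚] in
theorem eigenprojection_mem (k : ℝ) (x : 𝓚) :
    K (eigenprojection K k x) = (k : ℂ) • eigenprojection K k x := by
  have h := Submodule.starProjection_apply_mem (Module.End.eigenspace (K : 𝓚 →ₗ[ℂ] 𝓚) (k : ℂ)) x
  rw [Module.End.mem_eigenspace_iff] at h
  exact h

omit [FiniteDimensional ℂ 𝓚] in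
theorem eigenprojection_apply_of_eigenvector {K : 𝓚 →L[ℂ] 𝓚} (hK : IsSelfAdjoint K) {κ : ℝ}
    {x : 𝓚} (hx : K x = (κ : ℂ) • x) (k : ℝ) : eigenprojection K k x = if κ = k then x else 0 := by
  split_ifs with h
  · subst h
    exact Submodule.starProjection_eq_self_iff.2 (Module.End.mem_eigenspace_iff.2 hx)
  · rw [eigenprojection, Submodule.starProjection_apply_eq_zero_iff, Submodule.mem_orthogonal]
    intro y hy
    have hy' : K y = (k : ℂ) • y := Module.End.mem_eigenspace_iff.1 hy
    have h1 : ⟪K y, x⟫_ℂ = ⟪y, K x⟫_ℂ := by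
      rw [← ContinuousLinearMap.adjoint_inner_right, hK.adjoint_eq]
    rw [hx, hy', inner_smul_left, inner_smul_right, Complex.conj_ofReal] at h1
    have h2 : ((κ : ℂ) - k) * ⟪y, x⟫_ℂ = 0 := by rw [sub_mul, h1, sub_self]
    exact (mul_eq_zero.1 h2).resolve_left (sub_ne_zero.2 (by exact_mod_cast h))

omit [CompleteSpace 𝓚] in
theorem finite_eigenvalueSet (K : 𝓚 →L[ℂ] 𝓚) : (eigenvalueSet K).Finite :=
  (Module.End.finite_hasEigenvalue (K : 𝓚 →ₗ[ℂ] 𝓚)).preimage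
    (Complex.ofReal_injective.injOn)

omit [FiniteDimensional ℂ 𝓚] in
theorem inner_eigenprojection (k : ℝ) (x y : 𝓚) :
    ⟪eigenprojection K k x, y⟫_ℂ = ⟪x, eigenprojection K k y⟫_ℂ :=
  Submodule.inner_starProjection_left_eq_right _ _ _

/-- `Υ` is the diagonal part of the generator before averaging. -/
theorem upsilon_eq (hD : (matrixCoupling b hK hHR V).IntegrableCorr) :
    upsilon K HR V = ∑ᶠ k ∈ eigenvalueSet K, Complex.I • (eigenprojection K k ∘L
      (matrixCoupling b hK hHR V).generatorAt 0 ∘L eigenprojection K k) := by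
  rw [upsilon, ← finsum_mem_neg_distrib _ (finite_eigenvalueSet K)]
  refine finsum_mem_congr rfl fun k _ => ?_
  set P := eigenprojection K k with hP
  set D := matrixCoupling b hK hHR V with hDd
  have h1 : ∀ t : ℝ, P ∘L ContinuousLinearMap.adjoint V ∘L
      (Complex.exp (Complex.I * t * k) • oneParticleGroup K HR t) ∘L V ∘L P =
      ((ContinuousLinearMap.compL ℂ 𝓚 𝓚 𝓚 P) ∘L (ContinuousLinearMap.compL ℂ 𝓚 𝓚 𝓚).flip P)
        (D.kernel 0 t) := by
    intro t
    ext x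
    exact congrArg P (kernel_zero_apply_of_eigenvector b hK hHR V (eigenprojection_mem k x) t).symm
  simp only [h1]
  rw [ContinuousLinearMap.integral_comp_comm _ (hD.integrableOn_kernel 0), ← smul_neg, ← map_neg]
  rfl

/-- In an eigenbasis of `K` the matrix of `-iΥ` is the block diagonal part of the generator before
averaging, i.e. the part that does not oscillate. -/
theorem inner_upsilon {κ : ι → ℝ} (hb : ∀ i, K (b i) = (κ i : ℂ) • b i)
    (hD : (matrixCoupling b hK hHR V).IntegrableCorr) (i j : ι) :
    ⟪b i, (-(Complex.I • upsilon K HR V)) (b j)⟫_ℂ =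
      if κ i = κ j then ⟪b i, (matrixCoupling b hK hHR V).generatorAt 0 (b j)⟫_ℂ else 0 := by
  rw [upsilon_eq b hK hHR V hD, finsum_mem_eq_finite_toFinset_sum _ (finite_eigenvalueSet K)]
  simp only [neg_apply, smul_apply, sum_apply, ContinuousLinearMap.comp_apply, ← inner_eigenprojection,
    inner_neg_right, inner_smul_right, inner_sum, eigenprojection_apply_of_eigenvector hK (hb _)]
  rw [Finset.sum_eq_single (κ j)]
  · rw [if_pos rfl]
    split_ifs
    · rw [← mul_assoc, Complex.I_mul_I]; ring
    · simp
  · intro k _ hk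
    rw [if_neg (Ne.symm hk)]
    simp
  · intro h
    refine absurd ?_ h
    rw [Set.Finite.mem_toFinset]
    refine Module.End.hasEigenvalue_of_hasEigenvector (x := b j) ⟨?_, ?_⟩
    · exact Module.End.mem_eigenspace_iff.2 (hb j)
    · exact fun h0 => by simpa [h0] using b.norm_eq_one j

end LevelShift

/-! ### Identification of the Pauli-Fierz operators -/

section Identification

variable {𝓚 : Type v} [NormedAddCommGroup 𝓚] [InnerProductSpace ℂ 𝓚] [FiniteDimensional ℂ 𝓚]
  [CompleteSpace 𝓚]
variable {R : Type u} [NormedAddCommGroup R] [InnerProductSpace ℂ R] [CompleteSpace R]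
variable {A : Type*} [Fintype A] {E : A → 𝓚 →L[ℂ] 𝓚} {v : A → R} {V : 𝓚 →L[ℂ] 𝓚 ⊗[ℂ] R}

omit [CompleteSpace R] in
theorem creationVec_eq (hV : ∀ k, V k = ∑ α, E α k ⊗ₜ[ℂ] v α) (k : 𝓚) {n : ℕ} (f : Fin n → R) :
    creationVec V k f = ((fockModel R).coupled 𝓚).fieldCre E v (n + 1)
      (((fockModel R).coupled 𝓚).vec n k f) := by
  simp only [creationVec, CoupledModel.fieldCre, sum_apply, CoupledModel.vec]
  rw [hV, map_sum, Finset.smul_sum]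
  refine Finset.sum_congr rfl fun α _ => ?_
  rw [CoupledModel.op_tmul]
  have h := (fockModel R).cre_succ_sym n (v α) f
  change (Real.sqrt (n + 1) : ℂ) • (E α k ⊗ₜ[ℂ] symCons f (v α)) =
    E α k ⊗ₜ[ℂ] (ContinuousLinearMap.adjoint ((fockModel R).ann (n + 1) (v α)) ((fockModel R).sym n f))
  rw [h, TensorProduct.tmul_smul]
  rfl

theorem annihilationVec_eq (hV : ∀ k, V k = ∑ α, E α k ⊗ₜ[ℂ] v α) (k : 𝓚) {n : ℕ}
    (f : Fin n → R) : annihilationVec V k f = ((fockModel R).coupled 𝓚).fieldAnn E v n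
      (((fockModel R).coupled 𝓚).vec n k f) := by
  cases n with
  | zero => rw [CoupledModel.fieldAnn_zero]; rfl
  | succ n =>
    simp only [annihilationVec, CoupledModel.fieldAnn, sum_apply, CoupledModel.vec]
    simp only [adjoint_apply_tmul hV, TensorProduct.sum_tmul]
    rw [Finset.sum_comm, Finset.smul_sum]
    refine Finset.sum_congr rfl fun α _ => ?_
    rw [CoupledModel.op_tmul]
    have h := (fockModel R).ann_succ_sym n (v α) f
    change _ = ContinuousLinearMap.adjoint (E α) k ⊗ₜ[ℂ]
      ((fockModel R).ann (n + 1) (v α) ((fockModel R).sym (n + 1) f))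
    rw [h, TensorProduct.tmul_smul, TensorProduct.tmul_sum]
    congr 1
    refine Finset.sum_congr rfl fun j _ => ?_
    rw [TensorProduct.tmul_smul, TensorProduct.smul_tmul']
    rfl

theorem pauliFierzGraph_eq (hV : ∀ k, V k = ∑ α, E α k ⊗ₜ[ℂ] v α) (K : 𝓚 →L[ℂ] 𝓚)
    (HR : R →ₗ.[ℂ] R) (lam : ℝ) :
    pauliFierzGraph K HR V lam = ((fockModel R).coupled 𝓚).coupledGraph K HR E v lam := by
  rw [pauliFierzGraph, CoupledModel.coupledGraph]
  simp only [creationVec_eq hV, annihilationVec_eq hV]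
  rfl

theorem interactionPropagator_eq (D : Coupling 𝓚 R A) (hV : ∀ k, V k = ∑ α, D.E α k ⊗ₜ[ℂ] D.v α)
    (lam t s : ℝ) :
    interactionPropagator D.K D.HR V lam t s = ((fockModel R).coupled 𝓚).prop D lam t s := by
  simp only [interactionPropagator, pauliFierzGroup, pauliFierzGraph_eq hV]
  rfl

omit [CompleteSpace R] in
theorem rTensor_eq_op (S : 𝓚 →L[ℂ] 𝓚) :
    S.rTensor (FockSpace R) = ((fockModel R).coupled 𝓚).op S 1 :=
  ((fockModel R).coupled 𝓚).clm_ext fun _ _ => rfl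

omit [CompleteSpace R] in
theorem vacuumEmbedding_eq : vacuumEmbedding 𝓚 R = ((fockModel R).coupled 𝓚).vac := rfl

end Identification

/-! ### The weak coupling limit -/

theorem mainTheorem4
    {𝓚 : Type v} [NormedAddCommGroup 𝓚] [InnerProductSpace ℂ 𝓚] [FiniteDimensional ℂ 𝓚]
    [CompleteSpace 𝓚]
    {R : Type u} [NormedAddCommGroup R] [InnerProductSpace ℂ R] [CompleteSpace R]
    (K : 𝓚 →L[ℂ] 𝓚) (hK : IsSelfAdjoint K)
    (HR : R →ₗ.[ℂ] R) (hHR : IsSelfAdjoint HR)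
    (V : 𝓚 →L[ℂ] 𝓚 ⊗[ℂ] R)
    (𝔥 : bohrFrequencies K → Type w) [∀ ω, NormedAddCommGroup (𝔥 ω)]
    [∀ ω, InnerProductSpace ℂ (𝔥 ω)] [∀ ω, CompleteSpace (𝔥 ω)]
    (I : bohrFrequencies K → Set ℝ)
    (J : ∀ ω, Lp (𝔥 ω) 2 (volume.restrict (I ω)) →ₗᵢ[ℂ] R)
    (h₁ : SpectralAssumption K HR 𝔥 I J)
    (v : ∀ ω, ℝ → 𝓚 →L[ℂ] 𝓚 ⊗[ℂ] 𝔥 ω)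
    (h₂ : FormFactorAssumption K V 𝔥 I J v)
    (h₄ : IntegrabilityAssumption K HR V)
    (T : ℝ) (ℓ : ℕ) (S : Fin ℓ → 𝓚 →L[ℂ] 𝓚) :
    TendstoUniformlyOn
      (fun (lam : ℝ) (τ : Fin (ℓ + 2) → ℝ) =>
        ContinuousLinearMap.adjoint (vacuumEmbedding 𝓚 R) ∘L
          multiTimeProduct
            (fun t t₀ => interactionPropagator K HR V lam (lam⁻¹ ^ 2 * t) (lam⁻¹ ^ 2 * t₀))
            ℓ (fun i => (S i).rTensor (FockSpace R)) τ ∘L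
          vacuumEmbedding 𝓚 R)
      (fun τ =>
        multiTimeProduct
          (fun t t₀ => NormedSpace.exp ((-(Complex.I * ((t - t₀ : ℝ) : ℂ))) • upsilon K HR V)) ℓ S τ)
      (𝓝[>] (0 : ℝ))
      {τ | Monotone τ ∧ ∀ i, τ i ∈ Set.Icc (-T) T} := by
  have hsym : (K : 𝓚 →ₗ[ℂ] 𝓚).IsSymmetric :=
    (ContinuousLinearMap.isSelfAdjoint_iff_isSymmetric.1 hK)
  let b := hsym.eigenvectorBasis rfl
  have hb : ∀ i, K (b i) = (hsym.eigenvalues rfl i : ℂ) • b i :=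
    fun i => hsym.apply_eigenvectorBasis rfl i
  set D := matrixCoupling b hK hHR V with hDdef
  have hV : ∀ k, V k = ∑ α, D.E α k ⊗ₜ[ℂ] D.v α := sum_matrixCoupling b hK hHR V
  have hD : D.IntegrableCorr := integrableCorr_matrixCoupling b hK hHR V hb h₄
  -- `G = -iΥ` generates the limit
  set G : 𝓚 →L[ℂ] 𝓚 := -(Complex.I • upsilon K HR V) with hG
  obtain ⟨B, C, hB, hBd⟩ := D.exists_primitive b hb (D.generatorAt 0) G
    (inner_upsilon b hK hHR V hb hD)
  simp only [← D.generatorAt_eq_heis hD] at hBd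
  obtain ⟨δ, _, hδ, h⟩ := ((fockModel R).coupled 𝓚).exists_multiTime_bound hD hB hBd T ℓ S
  have hP : ∀ lam t s, interactionPropagator K HR V lam t s =
      ((fockModel R).coupled 𝓚).prop D lam t s := interactionPropagator_eq D hV
  have hexp : ∀ r : ℝ, (-(Complex.I * (r : ℂ))) • upsilon K HR V = r • G := by
    intro r
    rw [hG, smul_neg, neg_smul, mul_comm, mul_smul]
    rfl
  rw [Metric.tendstoUniformlyOn_iff]
  intro ε hε
  have hδ' : ∀ᶠ lam in 𝓝[>] (0 : ℝ), |δ lam| < ε := by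
    filter_upwards [hδ.eventually (Metric.ball_mem_nhds 0 hε)] with lam hlam
    simpa [Real.dist_eq] using hlam
  filter_upwards [hδ', self_mem_nhdsWithin] with lam hlam hpos τ hτ
  rw [dist_comm, dist_eq_norm]
  refine lt_of_le_of_lt (ContinuousLinearMap.opNorm_le_bound _ (abs_nonneg _) fun k => ?_) hlam
  refine le_trans ?_ (mul_le_mul_of_nonneg_right (le_abs_self (δ lam)) (norm_nonneg k))
  simp only [hP, hexp, rTensor_eq_op, vacuumEmbedding_eq]
  exact (h lam hpos τ hτ.1 hτ.2 k).2
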